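/- Let $N>1$, let $\chi$ be a real primitive Dirichlet character modulo $N$, and let $\nu=0$ if $\chi$ is even and $\nu=1$ if $\chi$ is odd. Let $$\Lambda(\chi,s)=\Big(\frac N\pi\Big)^{\frac{s+\nu}2}\,\Gamma\Big(\frac{s+\nu}2\Big)L(\chi,s)$$ (analytically continued) be the completed Dirichlet $L$-function, and let $\Xi(\chi,z)=\Lambda(\chi,\tfrac12-iz)$. (a) For every integer $n\ge1$ the equation $$n=\tfrac12\Big(\pi e^{\frac{L-\log (N^2)}2}+\tfrac34-\tfrac\nu2\Big)L$$ has a unique positive solution $L=L(n)$, and $L(n)=2\log\Big(\dfrac{nN}{\log(nN)}\Big)+O(1)$ as $n\to\infty$. (b) There are rational functions $b_1,b_2,\dots\in\mathbb Q(X)$, with $$b_1(X)=\frac{X^4+9X^3+32X^2+24X+16}{24(X+2)^3},$$ such that, to all orders as $n\to\infty$, with $L=L(n)$ and $b_k=b_k(L(n))$, $$\Lambda^{(n)}(\chi,\tfrac12)\sim M(n)\Big(1+\frac{b_1}n+\frac{b_2}{n^2}+\cdots\Big),\qquad \Xi^{(n)}(\chi,0)\sim(-i)^nM(n)\Big(1+\frac{b_1}n+\frac{b_2}{n^2}+\cdots\Big),$$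 where $$M(n)=\frac{\sqrt{2\pi}\,N^{\frac14+\frac\nu2}(1+(-1)^n)}{2^{2n}}\cdot\frac{L^{n+1}}{\sqrt{4n(1+\frac L2)-(\frac34-\frac\nu2)L^2}}\;e^{(\frac18+\frac\nu4)(L-\log (N^2))-\frac{2n}L+\frac34-\frac\nu2}.$$ That is, for every integer $K\ge0$ and every real $\delta>0$, as $n\to\infty$, $$\Lambda^{(n)}(\chi,\tfrac12)=M(n)\Big(1+\sum_{k=1}^K\frac{b_k(L(n))}{n^k}+O\big(n^{-(K+1)+\delta}\big)\Big),\qquad \Xi^{(n)}(\chi,0)=(-i)^nM(n)\Big(1+\sum_{k=1}^K\frac{b_k(L(n))}{n^k}+O\big(n^{-(K+1)+\delta}\big)\Big).$$ For odd $n$ one has $M(n)=0$, and these formulas say that, for all sufficiently large odd $n$, both derivatives vanish. -/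

import Mathlib

open Asymptotics

namespace DirichletAsymptotics

/-- The parity `ν` of a Dirichlet character: `0` if `χ(-1) = 1`, and `1` otherwise. -/
noncomputable def parity {N : ℕ} (χ : DirichletCharacter ℂ N) : ℕ :=
  open scoped Classical in if χ.Even then 0 else 1

/-- The completed Dirichlet `L`-function
`Λ(χ, s) = (N / π) ^ ((s + ν) / 2) * Γ((s + ν) / 2) * L(χ, s)`, continued analytically.
Mathlib's `completedLFunction` is the same product without the power of `N`, and it has the
right values at the poles of the Gamma factor; see `completedL_eq`. -/
noncomputable def completedL {N : ℕ} [NeZero N] (χ : DirichletCharacter ℂ N) (s : ℂ) : ℂ :=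
  (N : ℂ) ^ ((s + parity χ) / 2) * χ.completedLFunction s

/-- To the right of the poles of the Gamma factor, `completedL` is the textbook product. -/
theorem completedL_eq {N : ℕ} [NeZero N] (χ : DirichletCharacter ℂ N) {s : ℂ} (hs : 0 < s.re) :
    completedL χ s = ((N : ℂ) / (Real.pi : ℂ)) ^ ((s + parity χ) / 2) *
      Complex.Gamma ((s + parity χ) / 2) * χ.LFunction s := by
  have hs0 : s ≠ 0 := by
    rintro rfl
    simp at hs
  have hpi : (Real.pi : ℂ) ≠ 0 := by exact_mod_cast Real.pi_ne_zero
  have hg : χ.gammaFactor s = Complex.Gammaℝ (s + parity χ) := by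
    unfold DirichletCharacter.gammaFactor parity
    split_ifs <;> simp
  have hg0 : Complex.Gammaℝ (s + parity χ) ≠ 0 := by
    apply Complex.Gammaℝ_ne_zero_of_re_pos
    have : (0 : ℝ) ≤ parity χ := Nat.cast_nonneg _
    simp only [Complex.add_re, Complex.natCast_re]
    linarith
  have hd : ((N : ℂ) / (Real.pi : ℂ)) ^ ((s + parity χ) / 2) =
      (N : ℂ) ^ ((s + parity χ) / 2) * (Real.pi : ℂ) ^ (-(s + parity χ) / 2) := by
    have h := Complex.mul_cpow_ofReal_nonneg (Nat.cast_nonneg N : (0 : ℝ) ≤ N)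
      (inv_nonneg.mpr Real.pi_pos.le) ((s + parity χ) / 2)
    rw [Complex.ofReal_natCast, Complex.ofReal_inv] at h
    rw [div_eq_mul_inv (N : ℂ), h, Complex.inv_cpow _ _ (by
      rw [Complex.arg_ofReal_of_nonneg Real.pi_pos.le]; exact Real.pi_pos.ne), neg_div,
      Complex.cpow_neg]
  rw [DirichletCharacter.LFunction_eq_completed_div_gammaFactor χ s (Or.inl hs0), hg, completedL,
    hd]
  have : (Real.pi : ℂ) ^ (-(s + parity χ) / 2) * Complex.Gamma ((s + parity χ) / 2) =
      Complex.Gammaℝ (s + parity χ) := rfl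
  rw [mul_assoc ((N : ℂ) ^ _), this]
  field_simp

/-- The function `Ξ(χ, z)`; its derivatives at `0` correspond to those of `Λ(χ, s)` at `1/2`. -/
noncomputable def Xi {N : ℕ} [NeZero N] (χ : DirichletCharacter ℂ N) (z : ℂ) : ℂ :=
  open scoped Classical in
  if χ = 1 then (-z ^ 2 - 1 / 4) * completedL χ (1 / 2 - Complex.I * z)
  else completedL χ (1 / 2 - Complex.I * z)

/-- `ℓ` is a positive solution of `n = (π * exp ((ℓ - log (N ^ 2)) / 2) + 3/4 - ν/2) * ℓ / 2`. -/
def IsSaddle (N ν n : ℕ) (ℓ : ℝ) : Prop :=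
  0 < ℓ ∧ (n : ℝ) =
    1 / 2 * (Real.pi * Real.exp ((ℓ - Real.log ((N : ℝ) ^ 2)) / 2) + 3 / 4 - (ν : ℝ) / 2) * ℓ

/-- The leading factor of the expansion, with `ℓ` in place of `L(n)`. -/
noncomputable def mainTerm (N ν n : ℕ) (ℓ : ℝ) : ℝ :=
  √(2 * Real.pi) * (N : ℝ) ^ (1 / 4 + (ν : ℝ) / 2) * (1 + (-1) ^ n) / 2 ^ (2 * n) *
    (ℓ ^ (n + 1) / √(4 * n * (1 + ℓ / 2) - (3 / 4 - (ν : ℝ) / 2) * ℓ ^ 2)) *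
    Real.exp ((1 / 8 + (ν : ℝ) / 4) * (ℓ - Real.log ((N : ℝ) ^ 2)) - 2 * n / ℓ
      + 3 / 4 - (ν : ℝ) / 2)

/-- The truncation `1 + b₁(ℓ) / n + ⋯ + b_K(ℓ) / n ^ K`, where each `b_k` is a rational function
with rational coefficients. -/
noncomputable def truncation (b : ℕ → RatFunc ℚ) (K n : ℕ) (ℓ : ℝ) : ℝ :=
  1 + ∑ k ∈ Finset.Icc 1 K, (b k).eval (algebraMap ℚ ℝ) ℓ / (n : ℝ) ^ k

end DirichletAsymptotics

/-! ### Quadratic Gauss sums modulo p from the behaviour of theta series at a cusp. -/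

section

open Complex Filter Topology HurwitzZeta

/-! Let θ(x) = ∑ χ(m) m^ν exp(-π m² x / N). The completed L-function is a Mellin transform of θ, and
the substitution x = e^(-u) turns its n-th derivative at 1/2 into 2^(-n) ∫ (-u)^n Φ(u) du over the
real line, with Φ(u) = exp((1/4 + ν/2) u) θ(e^u). The functional equation of θ says that Φ is even:
odd derivatives vanish, and the even ones are twice an integral over u > 0
(`mellin_logTheta_center`). Evenness needs root number 1, hence the exact sign of the Gauss sum of a
primitive real character. For primes the sign comes from the Jacobi theta function near the cusp 2/p
(`sum_stdAddChar_sq_mul`); reciprocity and the Chinese remainder theorem then give every level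
(`gaussSum_int_of_isPrimitive`).

For u > 0, θ(e^u) is exp(-q e^u) with q = π/N, up to an exponentially smaller error. Laplace's
method is applied at y = L/2, the critical point of n log u - c u - q e^u with c = 3/4 - ν/2. The
true exponent has (1 - c) u in place of -c u, so a factor e^u stays outside the saddle and appears
as the linear term of `phase`. On the window |u| ≤ n^(-49/100) around y the exponential of all
non-quadratic Taylor terms is replaced by a polynomial; the rest is negligible
(`abs_laplace_sub_gaussMean_le`). Gaussian moments of that polynomial are, to any precision,
polynomials in 1/n over ℚ(L) (`exists_hasExpansion_gaussMean`).

Since L grows like log n, a nonzero rational function of L is n^(o(1)) and so is its inverse. The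
coefficients of such an expansion are therefore unique (`coeff_eq_zero_of_isOrderAtMost`), and the
expansions for different K fit together into one sequence b_k. The constant c enters only with an
extra factor 1/n, which is why b_1 is the same for both parities. -/

theorem hasSum_int_of_residues {k : ℕ} [NeZero k] {f : ℤ → ℂ} {g : ZMod k → ℂ}
    (h : ∀ r : ZMod k, HasSum (fun m : ℤ ↦ f (m * k + r.val)) (g r)) :
    HasSum f (∑ r, g r) := by
  classical
  have hk : (k : ℤ) ≠ 0 := by exact_mod_cast NeZero.ne k
  have key : ∀ r : ZMod k, HasSum (fun n : ℤ ↦ if (n : ZMod k) = r then f n else 0) (g r) := by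
    intro r
    have hinj : Function.Injective (fun m : ℤ ↦ m * (k : ℤ) + (r.val : ℤ)) := by
      intro a b hab
      exact mul_right_cancel₀ hk (add_right_cancel hab)
    have := h r
    rw [← hinj.hasSum_iff (f := fun n : ℤ ↦ if (n : ZMod k) = r then f n else 0)]
    · convert this using 2 with m
      simp
    · intro n hn
      refine if_neg fun hnr ↦ hn ?_
      have : ((n - r.val : ℤ) : ZMod k) = 0 := by simp [hnr]
      obtain ⟨m, hm⟩ := (ZMod.intCast_zmod_eq_zero_iff_dvd _ _).mp this
      exact ⟨m, by simp only; linarith [mul_comm (k : ℤ) m]⟩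
  have := hasSum_sum (s := Finset.univ) (fun r _ ↦ key r)
  simpa using this

/-- The term of index 0 is 1. For real x the norms of the other terms do not depend on x, and they
add up to `cosKernel 0 - 1`, which decays exponentially. -/
theorem tendsto_jacobiTheta₂_of_im_tendsto {α : Type*} {l : Filter α} (x : ℝ) {τ : α → ℂ}
    (hτ : Tendsto (fun a ↦ (τ a).im) l atTop) :
    Tendsto (fun a ↦ jacobiTheta₂ x (τ a)) l (𝓝 1) := by
  have hbound : ∀ t : ℂ, 0 < t.im → ‖jacobiTheta₂ x t - 1‖ ≤ cosKernel (0 : ℝ) t.im - 1 := by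
    intro t ht
    have h1 := hasSum_ite_sub_hasSum (hasSum_jacobiTheta₂_term (x : ℂ) ht) 0
    have h2 := hasSum_ite_sub_hasSum (hasSum_ofReal.mp (by
      simpa using hasSum_int_cosKernel 0 ht : HasSum
        (fun n : ℤ ↦ ((Real.exp (-Real.pi * n ^ 2 * t.im) : ℝ) : ℂ)) _)) 0
    have h0 : jacobiTheta₂_term 0 x t = 1 := by simp [jacobiTheta₂_term]
    rw [h0] at h1
    have h0' : Real.exp (-Real.pi * ((0 : ℤ) : ℝ) ^ 2 * t.im) = 1 := by simp
    rw [h0'] at h2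
    rw [← h1.tsum_eq]
    refine tsum_of_norm_bounded (by simpa using h2) fun n ↦ ?_
    split_ifs with hn
    · simp
    · rw [norm_jacobiTheta₂_term]
      simp
  obtain ⟨p, hp, hO⟩ := isBigO_atTop_cosKernel_sub ((0 : ℝ) : UnitAddCircle)
  have h0 : Tendsto (fun t : ℝ ↦ cosKernel ((0 : ℝ) : UnitAddCircle) t - 1) atTop (𝓝 0) := by
    refine hO.trans_tendsto ?_
    refine Real.tendsto_exp_atBot.comp ?_
    exact tendsto_id.const_mul_atTop_of_neg (by linarith)
  rw [tendsto_iff_norm_sub_tendsto_zero]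
  refine squeeze_zero' (Eventually.of_forall fun _ ↦ norm_nonneg _) ?_ (h0.comp hτ)
  filter_upwards [hτ.eventually_gt_atTop 0] with a ha using hbound _ ha

theorem ofReal_mul_cpow {x : ℝ} (hx : 0 < x) {z : ℂ} (hz : z ≠ 0) (s : ℂ) :
    ((x : ℂ) * z) ^ s = (x : ℂ) ^ s * z ^ s := by
  have hx0 : (x : ℂ) ≠ 0 := ofReal_ne_zero.mpr hx.ne'
  rw [cpow_def_of_ne_zero (mul_ne_zero hx0 hz), cpow_def_of_ne_zero hx0, cpow_def_of_ne_zero hz,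
    log_ofReal_mul hx hz, ofReal_log hx.le, add_mul, Complex.exp_add]

/-- A theta series with periodic coefficients, transformed by Poisson summation. -/
theorem hasSum_periodic_theta {k : ℕ} [NeZero k] (c : ZMod k → ℂ) {w : ℂ} (hw : 0 < w.im) :
    HasSum (fun n : ℤ ↦ c n * cexp (Real.pi * I * n ^ 2 * w))
      (∑ r : ZMod k, c r * (1 / (-I * (k ^ 2 * w)) ^ (1 / 2 : ℂ) *
        jacobiTheta₂ ((r.val / k : ℝ) : ℂ) (-1 / (k ^ 2 * w)))) := by
  have hk : (k : ℂ) ≠ 0 := by exact_mod_cast NeZero.ne k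
  have hw0 : w ≠ 0 := by rintro rfl; simp at hw
  have him : 0 < ((k : ℂ) ^ 2 * w).im := by
    have : ((k : ℂ) ^ 2 * w).im = (k : ℝ) ^ 2 * w.im := by
      rw [← ofReal_natCast, ← ofReal_pow, im_ofReal_mul]
    rw [this]
    have : (0 : ℝ) < k := by exact_mod_cast Nat.pos_of_ne_zero (NeZero.ne k)
    positivity
  refine hasSum_int_of_residues fun r ↦ ?_
  have h := (hasSum_jacobiTheta₂_term (r.val * k * w : ℂ) him).mul_left
    (c r * cexp (Real.pi * I * r.val ^ 2 * w))
  rw [jacobiTheta₂_functional_equation] at h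
  convert! h using 1
  · ext m
    simp only [jacobiTheta₂_term]
    rw [mul_assoc (c r), ← Complex.exp_add]
    push_cast
    simp only [ZMod.natCast_self, mul_zero, zero_add, ZMod.natCast_val, ZMod.cast_id]
    congr 2
    ring
  · have e1 : (r.val * k * w : ℂ) / (k ^ 2 * w) = ((r.val / k : ℝ) : ℂ) := by
      push_cast; field_simp
    have e2 : -(Real.pi : ℂ) * I * (r.val * k * w) ^ 2 / (k ^ 2 * w) =
        -(Real.pi * I * r.val ^ 2 * w) := by field_simp
    rw [e1, e2]
    have : cexp (Real.pi * I * r.val ^ 2 * w) * cexp (-(Real.pi * I * r.val ^ 2 * w)) = 1 := by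
      rw [← Complex.exp_add]; simp
    linear_combination (-(c r) * (1 / (-I * (k ^ 2 * w)) ^ (1 / 2 : ℂ)) *
      jacobiTheta₂ ((r.val / k : ℝ) : ℂ) (-1 / (k ^ 2 * w))) * this

/-- Behaviour of a theta series with periodic coefficients near the real line. -/
theorem tendsto_periodic_theta {α : Type*} {l : Filter α} {k : ℕ} [NeZero k] (c : ZMod k → ℂ)
    {w : α → ℂ} (hw : ∀ᶠ a in l, 0 < (w a).im) (hw' : Tendsto (fun a ↦ (-1 / w a).im) l atTop) :
    Tendsto (fun a ↦ (-I * w a) ^ (1 / 2 : ℂ) *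
      ∑' n : ℤ, c n * cexp (Real.pi * I * n ^ 2 * w a)) l (𝓝 ((∑ r, c r) / k)) := by
  have hk : (0 : ℝ) < k := by exact_mod_cast Nat.pos_of_ne_zero (NeZero.ne k)
  have hk0 : (k : ℂ) ≠ 0 := by exact_mod_cast NeZero.ne k
  have hlim : Tendsto (fun a ↦ (1 / (k : ℂ)) * ∑ r : ZMod k, c r *
      jacobiTheta₂ ((r.val / k : ℝ) : ℂ) (-1 / (k ^ 2 * w a))) l
      (𝓝 ((1 / (k : ℂ)) * ∑ r : ZMod k, c r * 1)) := by
    refine tendsto_const_nhds.mul (tendsto_finsetSum _ fun r _ ↦ tendsto_const_nhds.mul ?_)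
    refine tendsto_jacobiTheta₂_of_im_tendsto _ ?_
    have : ∀ a, (-1 / ((k : ℂ) ^ 2 * w a)).im = (-1 / w a).im * ((k : ℝ) ^ 2)⁻¹ := by
      intro a
      have : (-1 / ((k : ℂ) ^ 2 * w a)) = (-1 / w a) * (((k : ℝ) ^ 2)⁻¹ : ℝ) := by
        push_cast; field_simp
      rw [this, im_mul_ofReal]
    simp_rw [this]
    exact hw'.atTop_mul_const (by positivity)
  have e : (1 / (k : ℂ)) * ∑ r : ZMod k, c r * 1 = (∑ r, c r) / k := by
    simp [div_eq_inv_mul]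
  rw [e] at hlim
  refine hlim.congr' ?_
  filter_upwards [hw] with a ha
  have hw0 : w a ≠ 0 := by intro h; simp [h] at ha
  rw [(hasSum_periodic_theta c ha).tsum_eq, Finset.mul_sum, Finset.mul_sum]
  refine Finset.sum_congr rfl fun r _ ↦ ?_
  have e1 : (-I * ((k : ℂ) ^ 2 * w a)) ^ (1 / 2 : ℂ) = k * (-I * w a) ^ (1 / 2 : ℂ) := by
    have : -I * ((k : ℂ) ^ 2 * w a) = ((k ^ 2 : ℝ) : ℂ) * (-I * w a) := by push_cast; ring
    rw [this, ofReal_mul_cpow (by positivity) (by simp [hw0]), ← ofReal_ofNat, ← ofReal_one,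
      ← ofReal_div, ← ofReal_cpow (by positivity), ← Real.sqrt_eq_rpow, Real.sqrt_sq hk.le,
      ofReal_natCast]
  have e2 : (-I * w a) ^ (1 / 2 : ℂ) ≠ 0 := by
    simp [cpow_eq_zero_iff, hw0]
  rw [e1]
  field_simp

theorem im_pos_of_im_neg_one_div_pos {z : ℂ} (h : 0 < (-1 / z).im) : 0 < z.im := by
  rw [neg_div, one_div, neg_im, inv_im, neg_div, neg_neg] at h
  by_contra hz
  exact absurd h (not_lt.mpr (div_nonpos_of_nonpos_of_nonneg (not_lt.mp hz) (normSq_nonneg z)))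

/-- Near the cusp 2/p the theta function grows with leading coefficient the quadratic sum modulo p.
After τ ↦ -1/τ the cusp becomes -p/2, where the coefficient is a sum over residues modulo 2 only.
Comparing the two limits evaluates the sum with its sign. -/
theorem sum_stdAddChar_sq_mul (p : ℕ) [NeZero p] :
    (∑ x : ZMod p, ZMod.stdAddChar (x ^ 2)) * (1 - I) = √p * (1 + (-I) ^ p) := by
  have hp : (0 : ℝ) < p := by exact_mod_cast Nat.pos_of_ne_zero (NeZero.ne p)
  have hp0 : (p : ℂ) ≠ 0 := by exact_mod_cast NeZero.ne p
  set w : ℝ → ℂ := fun d ↦ I * d with hw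
  -- Chosen so that -1 / (2/p + w) = -p/2 + w'.
  set w' : ℝ → ℂ := fun d ↦ p ^ 2 * w d / (4 + 2 * p * w d) with hw'
  -- The value of exp(-π i n² p / 2), which depends only on the parity of n.
  set c : ZMod 2 → ℂ := fun r ↦ if r = 0 then 1 else (-I) ^ p with hc
  have hpos : ∀ᶠ d : ℝ in 𝓝[>] 0, 0 < d := eventually_mem_nhdsWithin
  have hden : ∀ d : ℝ, (4 : ℂ) + 2 * p * w d ≠ 0 := by
    intro d h
    have := congrArg re h
    simp [hw] at this
  have him : ∀ d : ℝ, 0 < d → (-1 / w d).im = d⁻¹ := by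
    intro d hd
    have : -1 / w d = I * (d⁻¹ : ℝ) := by
      have : (d : ℂ) ≠ 0 := ofReal_ne_zero.mpr hd.ne'
      simp only [hw]; push_cast; field_simp; simp
    rw [this]; simp
  have him' : ∀ d : ℝ, 0 < d → (-1 / w' d).im = (4 / (p : ℝ) ^ 2) * d⁻¹ := by
    intro d hd
    have hd0 : (d : ℂ) ≠ 0 := ofReal_ne_zero.mpr hd.ne'
    have hwd : w d ≠ 0 := by simp [hw, hd.ne']
    have : -1 / w' d = ((4 / (p : ℝ) ^ 2 : ℝ) : ℂ) * (-1 / w d) + ((-2 / p : ℝ) : ℂ) := by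
      have := hden d
      simp only [hw']; push_cast; field_simp; ring
    rw [this, add_im, im_ofReal_mul, him d hd]
    simp
  have hinv : Tendsto (fun d : ℝ ↦ d⁻¹) (𝓝[>] 0) atTop := tendsto_inv_nhdsGT_zero
  have lim1 := tendsto_periodic_theta (l := 𝓝[>] (0 : ℝ)) (w := w)
    (fun x : ZMod p ↦ ZMod.stdAddChar (x ^ 2))
    (by filter_upwards [hpos] with d hd
        simpa [hw] using hd)
    (hinv.congr' (by filter_upwards [hpos] with d hd using (him d hd).symm))
  have lim2 := tendsto_periodic_theta (l := 𝓝[>] (0 : ℝ)) (w := w') c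
    (by filter_upwards [hpos] with d hd
        refine im_pos_of_im_neg_one_div_pos ?_
        rw [him' d hd]; positivity)
    ((hinv.const_mul_atTop (by positivity : 0 < 4 / (p : ℝ) ^ 2)).congr'
      (by filter_upwards [hpos] with d hd using (him' d hd).symm))
  have hw0 : Tendsto w (𝓝[>] 0) (𝓝 0) := by
    have : Tendsto w (𝓝 0) (𝓝 (w 0)) := by
      apply Continuous.tendsto; simp only [hw]; fun_prop
    simpa [hw] using this.mono_left nhdsWithin_le_nhds
  have lim3 : Tendsto (fun d ↦ ((p : ℂ) ^ 2 / (4 + 2 * p * w d)) ^ (1 / 2 : ℂ)) (𝓝[>] 0)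
      (𝓝 ((p : ℂ) / 2)) := by
    have e : (p : ℂ) / 2 = ((p : ℂ) ^ 2 / (4 + 2 * p * 0)) ^ (1 / 2 : ℂ) := by
      have : (p : ℂ) ^ 2 / (4 + 2 * p * 0) = ((p : ℂ) / 2) ^ 2 := by ring
      rw [this, one_div, sq_cpow_two_inv]
      have : (p : ℂ) / 2 = ((p / 2 : ℝ) : ℂ) := by push_cast; rfl
      rw [this, ofReal_re]; positivity
    rw [e]
    refine Tendsto.cpow ?_ tendsto_const_nhds ?_
    · exact tendsto_const_nhds.div (tendsto_const_nhds.add (hw0.const_mul _)) (by norm_num)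
    · have : (p : ℂ) ^ 2 / (4 + 2 * p * 0) = ((p ^ 2 / 4 : ℝ) : ℂ) := by push_cast; ring
      rw [this]
      exact ofReal_mem_slitPlane.mpr (by positivity)
  -- The principal branch selects the root with positive real part; this is where the sign of the
  -- Gauss sum is decided.
  have hsq : ((-I) * (2 / p + 0)) ^ (1 / 2 : ℂ) = (1 - I) / √p := by
    have h1 : ((√p : ℝ) : ℂ) ^ 2 = p := by
      rw [← ofReal_pow, Real.sq_sqrt hp.le, ofReal_natCast]
    have : (-I) * (2 / p + 0) = ((1 - I) / √p) ^ 2 := by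
      rw [div_pow, h1]; ring_nf; simp
    rw [this, one_div, sq_cpow_two_inv]
    have : (1 - I) / (√p : ℂ) = ((√p)⁻¹ : ℝ) * (1 - I) := by push_cast; field_simp
    rw [this, re_ofReal_mul]
    simp [hp]
  have lim4 : Tendsto (fun d ↦ (-I * (2 / p + w d)) ^ (1 / 2 : ℂ)) (𝓝[>] 0)
      (𝓝 ((1 - I) / √p)) := by
    rw [← hsq]
    refine Tendsto.cpow ((hw0.const_add _).const_mul _) tendsto_const_nhds ?_
    refine Or.inr ?_
    have : -I * (2 / p + 0) = ((-2 / p : ℝ) : ℂ) * I := by push_cast; ring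
    rw [this, im_ofReal_mul]
    simp [hp.ne']
  have key := tendsto_nhds_unique ((lim1.mul lim4).mul lim3) (lim2.congr' ?_)
  · have hs : ((√p : ℝ) : ℂ) ≠ 0 := by simp [hp.ne']
    have hsum : ∑ r : ZMod 2, c r = 1 + (-I) ^ p := by
      rw [show (Finset.univ : Finset (ZMod 2)) = {0, 1} by decide]
      simp [hc]
    rw [hsum] at key
    field_simp at key
    push_cast at key
    linear_combination key / 2
  · filter_upwards [hpos] with d hd
    have hd0 : (d : ℂ) ≠ 0 := ofReal_ne_zero.mpr hd.ne'
    have hwd : w d ≠ 0 := by simp [hw, hd.ne']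
    have hτ : (2 : ℂ) / p + w d ≠ 0 := by
      have := hden d
      intro h
      apply this
      have : (4 : ℂ) + 2 * p * w d = 2 * p * (2 / p + w d) := by field_simp; ring
      rw [this, h, mul_zero]
    have s1 : ∑' n : ℤ, ZMod.stdAddChar ((n : ZMod p) ^ 2) * cexp (Real.pi * I * n ^ 2 * w d) =
        jacobiTheta₂ 0 (2 / p + w d) := by
      refine tsum_congr fun n ↦ ?_
      have : (n : ZMod p) ^ 2 = ((n ^ 2 : ℤ) : ZMod p) := by push_cast; rfl
      rw [this, ZMod.stdAddChar_coe, ← Complex.exp_add, jacobiTheta₂_term]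
      push_cast
      congr 1
      ring
    have s2 : ∑' n : ℤ, c n * cexp (Real.pi * I * n ^ 2 * w' d) =
        jacobiTheta₂ 0 (-1 / (2 / p + w d)) := by
      refine tsum_congr fun n ↦ ?_
      have e : -1 / (2 / p + w d) = -p / 2 + w' d := by
        have := hden d
        have h2 : (2 : ℂ) + p * w d ≠ 0 := by
          intro h; apply this; linear_combination 2 * h
        simp only [hw']; field_simp; ring
      have e3 : jacobiTheta₂_term n 0 (-1 / (2 / p + w d)) =
          cexp (-(Real.pi * I * n ^ 2 * p / 2)) * cexp (Real.pi * I * n ^ 2 * w' d) := by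
        rw [jacobiTheta₂_term, e, ← Complex.exp_add]
        congr 1
        ring
      rw [e3]
      congr 1
      have hI : cexp (-(Real.pi * I / 2)) = -I := by
        rw [Complex.exp_neg, mul_div_right_comm, exp_pi_div_two_mul_I]; simp
      rcases Int.even_or_odd' n with ⟨m, rfl | rfl⟩
      · have : -(Real.pi * I * ((2 * m : ℤ) : ℂ) ^ 2 * p / 2) =
            ((-(m ^ 2 * p) : ℤ) : ℂ) * (2 * Real.pi * I) := by push_cast; ring
        rw [this, exp_int_mul_two_pi_mul_I]
        have h0 : ((2 * m : ℤ) : ZMod 2) = 0 := by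
          rw [ZMod.intCast_zmod_eq_zero_iff_dvd]; exact ⟨m, rfl⟩
        simp only [hc, h0, if_true]
      · have : -(Real.pi * I * ((2 * m + 1 : ℤ) : ℂ) ^ 2 * p / 2) =
            ((-((m ^ 2 + m) * p) : ℤ) : ℂ) * (2 * Real.pi * I) + p * (-(Real.pi * I / 2)) := by
          push_cast; ring
        rw [this, Complex.exp_add, exp_int_mul_two_pi_mul_I, Complex.exp_nat_mul, hI, one_mul]
        have h0 : ((2 * m + 1 : ℤ) : ZMod 2) ≠ 0 := by
          rw [Ne, ZMod.intCast_zmod_eq_zero_iff_dvd]; omega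
        simp only [hc, h0, if_false]
    have s3 : (-I * w' d) ^ (1 / 2 : ℂ) = (-I * w d) ^ (1 / 2 : ℂ) *
        ((p : ℂ) ^ 2 / (4 + 2 * p * w d)) ^ (1 / 2 : ℂ) := by
      have e1 : -I * w d = (d : ℂ) := by
        simp only [hw]; rw [← mul_assoc]; simp
      have e2 : -I * w' d = d * ((p : ℂ) ^ 2 / (4 + 2 * p * w d)) := by
        simp only [hw']; linear_combination ((p : ℂ) ^ 2 / (4 + 2 * p * w d)) * e1
      rw [e1, e2, ofReal_mul_cpow hd (div_ne_zero (by positivity) (hden d))]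
    rw [s1, s2, s3, jacobiTheta₂_functional_equation 0 (2 / p + w d)]
    have : (-I * (2 / p + w d)) ^ (1 / 2 : ℂ) ≠ 0 := by
      simp [cpow_eq_zero_iff, hτ]
    simp only [zero_div, ne_eq, OfNat.ofNat_ne_zero, not_false_eq_true, zero_pow, mul_zero,
      Complex.exp_zero, mul_one]
    generalize jacobiTheta₂ 0 (-1 / (2 / p + w d)) = J at *
    generalize (-I * (2 / p + w d)) ^ (1 / 2 : ℂ) = Z at *
    field_simp

end

/-! ### Primitive real characters: reciprocity and factorization of Gauss sums. -/

section

open Complex Filter Topology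

theorem DirichletCharacter.IsPrimitive.eq_of_factorsThrough {R : Type*} [CommMonoidWithZero R] {N : ℕ}
    [NeZero N] {χ : DirichletCharacter R N} (hχ : χ.IsPrimitive) {d : ℕ}
    (h : χ.FactorsThrough d) : d = N := by
  have h1 : χ.conductor ≤ d := Nat.sInf_le h
  rw [hχ] at h1
  exact le_antisymm (Nat.le_of_dvd (Nat.pos_of_ne_zero (NeZero.ne N)) h.dvd) h1

theorem DirichletCharacter.isPrimitive_of_forall {R : Type*} [CommMonoidWithZero R] {N : ℕ} [NeZero N]
    {χ : DirichletCharacter R N}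
    (h : ∀ d : ℕ, ∀ hd : d ∣ N, (∀ u : (ZMod N)ˣ, ZMod.unitsMap hd u = 1 → χ u = 1) → d = N) :
    χ.IsPrimitive := by
  have hc := χ.factorsThrough_conductor
  refine h _ hc.dvd fun u hu ↦ ?_
  have := (factorsThrough_iff_ker_unitsMap hc.dvd).mp hc (MonoidHom.mem_ker.mpr hu)
  rw [MonoidHom.mem_ker] at this
  rw [← MulChar.coe_toUnitHom, this, Units.val_one]

theorem DirichletCharacter.IsPrimitive.eq_of_forall {R : Type*} [CommMonoidWithZero R] {N : ℕ}
    [NeZero N] {χ : DirichletCharacter R N} (hχ : χ.IsPrimitive) {d : ℕ} (hd : d ∣ N)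
    (h : ∀ u : (ZMod N)ˣ, ZMod.unitsMap hd u = 1 → χ u = 1) : d = N := by
  refine hχ.eq_of_factorsThrough ((factorsThrough_iff_ker_unitsMap hd).mpr fun u hu ↦ ?_)
  rw [MonoidHom.mem_ker] at hu ⊢
  ext
  rw [MulChar.coe_toUnitHom, h u hu, Units.val_one]

theorem MulChar.eq_one_or_neg_one_of_isUnit {R : Type*} [CommMonoid R] (χ : MulChar R ℤ) {a : R}
    (ha : IsUnit a) : χ a = 1 ∨ χ a = -1 := Int.isUnit_iff.mp (ha.map χ)

theorem MulChar.isQuadratic_int {R : Type*} [CommMonoid R] (χ : MulChar R ℤ) : χ.IsQuadratic := by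
  intro a
  by_cases ha : IsUnit a
  · exact Or.inr (χ.eq_one_or_neg_one_of_isUnit ha)
  · exact Or.inl (χ.map_nonunit ha)

/-- On units the values are ±1, and these stay distinct outside characteristic 2. Integer values
thus allow the same character to be used in ℂ and in an extension of a finite field. -/
theorem DirichletCharacter.IsPrimitive.ringHomComp {N : ℕ} [NeZero N] {χ : DirichletCharacter ℤ N}
    (hχ : χ.IsPrimitive) {R : Type*} [CommRing R] [Nontrivial R] (hR : ringChar R ≠ 2) :
    DirichletCharacter.IsPrimitive (χ.ringHomComp (Int.castRingHom R)) := by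
  refine DirichletCharacter.isPrimitive_of_forall fun d hd h ↦ hχ.eq_of_forall hd fun u hu ↦ ?_
  have := h u hu
  rcases χ.eq_one_or_neg_one_of_isUnit u.isUnit with h1 | h1
  · exact h1
  · rw [MulChar.ringHomComp_apply, h1] at this
    simp only [eq_intCast, Int.cast_neg, Int.cast_one] at this
    exact absurd this (Ring.neg_one_ne_one_of_char_ne_two hR)

/-- The square of the Gauss sum of a primitive quadratic character. -/
theorem gaussSum_sq_of_isPrimitive {N : ℕ} [NeZero N] {R : Type*} [CommRing R] [IsDomain R]
    {χ : DirichletCharacter R N} (hχ : χ.IsPrimitive) (hq : χ.IsQuadratic)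
    {ψ : AddChar (ZMod N) R} (hψ : ψ.IsPrimitive) :
    gaussSum χ ψ ^ 2 = χ (-1) * N := by
  classical
  have hinv : χ⁻¹ = χ := hq.inv
  have h1 : gaussSum χ ψ * gaussSum χ ψ = ∑ b, ψ b * gaussSum χ (ψ.mulShift b) := by
    conv_lhs => enter [1]; rw [gaussSum]
    rw [Finset.sum_mul]
    refine Finset.sum_congr rfl fun b _ ↦ ?_
    rw [gaussSum_mulShift_of_isPrimitive ψ hχ, hinv]
    ring
  have h2 : ∀ b a, ψ b * (χ a * ψ.mulShift b a) = χ a * ψ (b * (1 + a)) := by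
    intro b a
    rw [AddChar.mulShift_apply, mul_add, mul_one, AddChar.map_add_eq_mul]
    ring
  rw [sq, h1]
  simp_rw [gaussSum, Finset.mul_sum, h2]
  rw [Finset.sum_comm]
  simp_rw [← Finset.mul_sum, AddChar.sum_mulShift _ hψ]
  rw [Finset.sum_eq_single (-1)]
  · simp [ZMod.card]
  · intro b _ hb
    rw [if_neg]
    · simp
    · intro h; exact hb (by linear_combination h)
  · simp

/-- An element a has 1 + (a/p) square roots, and a nontrivial additive character sums to 0. -/
theorem gaussSum_quadraticChar (p : ℕ) [Fact p.Prime] (hp : p ≠ 2) (ψ : AddChar (ZMod p) ℂ)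
    (hψ : ψ ≠ 1) :
    gaussSum ((quadraticChar (ZMod p)).ringHomComp (Int.castRingHom ℂ)) ψ = ∑ x, ψ (x ^ 2) := by
  have hc : ringChar (ZMod p) ≠ 2 := by rwa [ZMod.ringChar_zmod_n]
  have h1 : ∑ x, ψ (x ^ 2) = ∑ a, ∑ x with x ^ 2 = a, ψ a := by
    rw [← Finset.sum_fiberwise Finset.univ (fun x : ZMod p ↦ x ^ 2)]
    refine Finset.sum_congr rfl fun a _ ↦ Finset.sum_congr rfl fun x hx ↦ ?_
    rw [(Finset.mem_filter.mp hx).2]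
  rw [h1]
  have h2 : ∀ a : ZMod p, ∑ x with x ^ 2 = a, ψ a = ((quadraticChar (ZMod p) a : ℤ) : ℂ) * ψ a + ψ a := by
    intro a
    rw [Finset.sum_const, nsmul_eq_mul]
    have h3 := quadraticChar_card_sqrts hc a
    have h4 : ((Finset.univ.filter fun x : ZMod p ↦ x ^ 2 = a).card : ℤ) =
        quadraticChar (ZMod p) a + 1 := by
      rw [← h3]; congr 2; ext x; simp
    have h5 : (((Finset.univ.filter fun x : ZMod p ↦ x ^ 2 = a).card : ℤ) : ℂ) = _ :=
      congrArg Int.cast h4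
    push_cast at h5
    rw [h5]; ring
  simp_rw [h2]
  rw [Finset.sum_add_distrib, AddChar.sum_eq_zero_of_ne_one hψ, add_zero]
  rfl

/-- The factor 1 + (-I)^p equals 1 - I when p ≡ 1 modulo 4 and 1 + I = I (1 - I) when p ≡ 3, so 1 -
I cancels. -/
theorem gaussSum_quadraticChar_eq (p : ℕ) [Fact p.Prime] (hp : p ≠ 2) :
    gaussSum ((quadraticChar (ZMod p)).ringHomComp (Int.castRingHom ℂ)) ZMod.stdAddChar =
      √p * (if quadraticChar (ZMod p) (-1) = 1 then 1 else I) := by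
  have hc : ringChar (ZMod p) ≠ 2 := by rwa [ZMod.ringChar_zmod_n]
  have hψ : (ZMod.stdAddChar : AddChar (ZMod p) ℂ) ≠ 1 := by
    intro h
    have := ZMod.isPrimitive_stdAddChar p one_ne_zero
    rw [AddChar.mulShift_one] at this
    exact this h
  have h0 : (1 - I : ℂ) ≠ 0 := by
    intro h; have := congrArg re h; simp at this
  have hm := sum_stdAddChar_sq_mul p
  rw [gaussSum_quadraticChar p hp _ hψ, quadraticChar_neg_one hc, ZMod.card]
  refine mul_right_cancel₀ h0 (hm.trans ?_)
  have hodd := (Fact.out : p.Prime).eq_two_or_odd.resolve_left hp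
  have hI2 := I_sq
  rcases Nat.odd_mod_four_iff.mp hodd with h | h
  · rw [ZMod.χ₄_nat_one_mod_four h, if_pos rfl]
    have : (-I) ^ p = -I := by
      rw [← Nat.div_add_mod p 4, h, pow_add, pow_mul, Even.neg_pow (by decide : Even 4)]; simp
    rw [this]; ring
  · rw [ZMod.χ₄_nat_three_mod_four h, if_neg (by decide)]
    have : (-I) ^ p = I := by
      rw [← Nat.div_add_mod p 4, h, pow_add, pow_mul, Even.neg_pow (by decide : Even 4), I_pow_four,
        one_pow, one_mul]
      linear_combination -I * hI2
    rw [this]; linear_combination (√p : ℂ) * hI2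

/-- Reciprocity between a primitive real character and the Legendre symbol. -/
theorem DirichletCharacter.IsPrimitive.apply_prime {M : ℕ} [NeZero M] {χ : DirichletCharacter ℤ M}
    (hχ : χ.IsPrimitive) (p : ℕ) [Fact p.Prime] (hp : p ≠ 2) (hpM : p.Coprime M) :
    χ p = quadraticChar (ZMod p) ((χ (-1) * M : ℤ) : ZMod p) := by
  have hM : ((⟨M, Nat.pos_of_ne_zero (NeZero.ne M)⟩ : ℕ+) : ZMod p) ≠ 0 := by
    intro h
    replace h : ((M : ℕ) : ZMod p) = 0 := h
    rw [ZMod.natCast_eq_zero_iff] at h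
    have := Nat.dvd_gcd dvd_rfl h
    rw [hpM] at this
    exact (Fact.out : p.Prime).one_lt.ne' (Nat.dvd_one.mp this)
  let ψ := AddChar.primitiveZModChar ⟨M, Nat.pos_of_ne_zero (NeZero.ne M)⟩ (ZMod p) hM
  let F := CyclotomicField ψ.n (ZMod p)
  have hchar : CharP F p := charP_of_injective_algebraMap (algebraMap (ZMod p) F).injective p
  have hF2 : ringChar F ≠ 2 := by rwa [ringChar.eq F p]
  let ψ' : AddChar (ZMod M) F := ψ.char
  have hψ' : ψ'.IsPrimitive := ψ.prim
  have hsq := gaussSum_sq_of_isPrimitive (hχ.ringHomComp hF2) (χ.isQuadratic_int.comp _) hψ'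
  have hu : IsUnit (p : ZMod M) := (ZMod.isUnit_iff_coprime p M).mpr hpM
  -- Frobenius in characteristic p multiplies the Gauss sum by χ(p), while the square of the Gauss
  -- sum is χ(-1) M. Hence χ(p) is the power (p-1)/2 of χ(-1) M in `F`, which Euler's criterion
  -- identifies with a Legendre symbol.
  have key := Char.card_pow_char_pow (χ.isQuadratic_int.comp (Int.castRingHom F)) ψ' p 1 hu hp
    (by rw [hsq, ZMod.card])
  rw [ZMod.card, pow_one, pow_one] at key
  simp only [MulChar.ringHomComp_apply, eq_intCast] at key
  have hq := quadraticChar_eq_pow_of_char_ne_two' (F := ZMod p) (by rwa [ZMod.ringChar_zmod_n])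
    ((χ (-1) * M : ℤ) : ZMod p)
  rw [ZMod.card] at hq
  have hq' := congrArg (algebraMap (ZMod p) F) hq
  rw [map_pow, map_intCast (algebraMap (ZMod p) F), map_intCast (algebraMap (ZMod p) F)] at hq'
  have hcast : ((χ (-1) * M : ℤ) : F) = (χ (-1) : F) * M := by push_cast; rfl
  rw [hcast, key] at hq'
  have hne : ((χ (-1) * M : ℤ) : ZMod p) ≠ 0 := by
    rcases χ.eq_one_or_neg_one_of_isUnit (isUnit_one.neg) with h | h <;> rw [h] <;>
    simpa using hM
  refine Int.cast_injOn_of_ringChar_ne_two hF2 ?_ ?_ hq'.symm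
  · rcases χ.eq_one_or_neg_one_of_isUnit hu with h | h <;> simp [h]
  · rcases quadraticChar_dichotomy hne with h | h <;> simp only [h] <;> simp

/-- The component at the first factor of a Dirichlet character of level `m * n`. -/
noncomputable def DirichletCharacter.fstFactor {m n : ℕ} (h : m.Coprime n)
    (χ : DirichletCharacter ℤ (m * n)) : DirichletCharacter ℤ m where
  toFun a := χ ((ZMod.chineseRemainder h).symm (a, 1))
  map_one' := by rw [← Prod.one_eq_mk, map_one, map_one]
  map_mul' a b := by rw [← map_mul, ← map_mul, Prod.mk_mul_mk, one_mul]
  map_nonunit' a ha := by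
    refine χ.map_nonunit fun h' ↦ ha ?_
    have := h'.map (ZMod.chineseRemainder h)
    rw [RingEquiv.apply_symm_apply] at this
    exact (Prod.isUnit_iff.mp this).1

/-- The component at the second factor of a Dirichlet character of level `m * n`. -/
noncomputable def DirichletCharacter.sndFactor {m n : ℕ} (h : m.Coprime n)
    (χ : DirichletCharacter ℤ (m * n)) : DirichletCharacter ℤ n where
  toFun a := χ ((ZMod.chineseRemainder h).symm (1, a))
  map_one' := by rw [← Prod.one_eq_mk, map_one, map_one]
  map_mul' a b := by rw [← map_mul, ← map_mul, Prod.mk_mul_mk, one_mul]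
  map_nonunit' a ha := by
    refine χ.map_nonunit fun h' ↦ ha ?_
    have := h'.map (ZMod.chineseRemainder h)
    rw [RingEquiv.apply_symm_apply] at this
    exact (Prod.isUnit_iff.mp this).2

namespace DirichletCharacter

variable {m n : ℕ} (h : m.Coprime n) (χ : DirichletCharacter ℤ (m * n))

theorem apply_chineseRemainder_symm (a : ZMod m) (b : ZMod n) :
    χ ((ZMod.chineseRemainder h).symm (a, b)) = χ.fstFactor h a * χ.sndFactor h b := by
  change _ = χ _ * χ _
  rw [← map_mul, ← map_mul, Prod.mk_mul_mk, one_mul, mul_one]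

theorem fst_chineseRemainder (x : ZMod (m * n)) :
    (ZMod.chineseRemainder h x).1 = ZMod.castHom (dvd_mul_right m n) (ZMod m) x := by
  have : (RingHom.fst (ZMod m) (ZMod n)).comp (ZMod.chineseRemainder h).toRingHom =
    ZMod.castHom (dvd_mul_right m n) (ZMod m) := Subsingleton.elim _ _
  rw [← this]; rfl

theorem snd_chineseRemainder (x : ZMod (m * n)) :
    (ZMod.chineseRemainder h x).2 = ZMod.castHom (dvd_mul_left n m) (ZMod n) x := by
  have : (RingHom.snd (ZMod m) (ZMod n)).comp (ZMod.chineseRemainder h).toRingHom =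
    ZMod.castHom (dvd_mul_left n m) (ZMod n) := Subsingleton.elim _ _
  rw [← this]; rfl

theorem apply_eq_fstFactor_mul_sndFactor (x : ZMod (m * n)) :
    χ x = χ.fstFactor h (ZMod.castHom (dvd_mul_right m n) (ZMod m) x) *
      χ.sndFactor h (ZMod.castHom (dvd_mul_left n m) (ZMod n) x) := by
  rw [← fst_chineseRemainder h, ← snd_chineseRemainder h, ← apply_chineseRemainder_symm]
  simp

/-- A unit congruent to 1 modulo d n has trivial second component, so a first factor trivial on the
kernel modulo d would make χ trivial on the kernel modulo d n. -/
theorem fstFactor_isPrimitive [NeZero m] [NeZero n] (hχ : χ.IsPrimitive) :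
    (χ.fstFactor h).IsPrimitive := by
  refine isPrimitive_of_forall fun d hd hu ↦ ?_
  have hdn : d * n ∣ m * n := Nat.mul_dvd_mul_right hd n
  refine Nat.eq_of_mul_eq_mul_right (Nat.pos_of_ne_zero (NeZero.ne n))
    (hχ.eq_of_forall hdn fun u h1 ↦ ?_)
  rw [apply_eq_fstFactor_mul_sndFactor h]
  have e1 := hu (ZMod.unitsMap (dvd_mul_right m n) u) (by
    have := congrArg (ZMod.unitsMap (dvd_mul_right d n)) h1
    rw [map_one, ← MonoidHom.comp_apply, ZMod.unitsMap_comp] at this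
    rw [← MonoidHom.comp_apply, ZMod.unitsMap_comp, this])
  have e2 := congrArg (ZMod.unitsMap (dvd_mul_left n d)) h1
  rw [map_one, ← MonoidHom.comp_apply, ZMod.unitsMap_comp] at e2
  have e3 : ZMod.castHom (dvd_mul_left n m) (ZMod n) u = 1 := congrArg Units.val e2
  have e4 : χ.fstFactor h (ZMod.castHom (dvd_mul_right m n) (ZMod m) u) = 1 := e1
  rw [e3, e4, map_one, one_mul]

theorem sndFactor_isPrimitive [NeZero m] [NeZero n] (hχ : χ.IsPrimitive) :
    (χ.sndFactor h).IsPrimitive := by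
  refine isPrimitive_of_forall fun d hd hu ↦ ?_
  have hdn : m * d ∣ m * n := Nat.mul_dvd_mul_left m hd
  refine Nat.eq_of_mul_eq_mul_left (Nat.pos_of_ne_zero (NeZero.ne m))
    (hχ.eq_of_forall hdn fun u h1 ↦ ?_)
  rw [apply_eq_fstFactor_mul_sndFactor h]
  have e1 := hu (ZMod.unitsMap (dvd_mul_left n m) u) (by
    have := congrArg (ZMod.unitsMap (dvd_mul_left d m)) h1
    rw [map_one, ← MonoidHom.comp_apply, ZMod.unitsMap_comp] at this
    rw [← MonoidHom.comp_apply, ZMod.unitsMap_comp, this])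
  have e2 := congrArg (ZMod.unitsMap (dvd_mul_right m d)) h1
  rw [map_one, ← MonoidHom.comp_apply, ZMod.unitsMap_comp] at e2
  have e3 : ZMod.castHom (dvd_mul_right m n) (ZMod m) u = 1 := congrArg Units.val e2
  have e4 : χ.sndFactor h (ZMod.castHom (dvd_mul_left n m) (ZMod n) u) = 1 := e1
  rw [e3, e4, map_one, one_mul]

end DirichletCharacter

/-- The pair (n a, m b) lifts to n a + m b, and (n a + m b) / (m n) = a/m + b/n. This rescaling is
the source of the values of the two factors at n and m in `gaussSum_eq_mul_of_coprime`. -/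
theorem stdAddChar_chineseRemainder_symm {m n : ℕ} [NeZero m] [NeZero n] (h : m.Coprime n)
    (a : ZMod m) (b : ZMod n) :
    (ZMod.stdAddChar ((ZMod.chineseRemainder h).symm (n * a, m * b)) : ℂ) =
      ZMod.stdAddChar a * ZMod.stdAddChar b := by
  obtain ⟨a, rfl⟩ := ZMod.intCast_surjective a
  obtain ⟨b, rfl⟩ := ZMod.intCast_surjective b
  have : ((ZMod.chineseRemainder h).symm ((n : ZMod m) * a, (m : ZMod n) * b)) =
      ((n * a + m * b : ℤ) : ZMod (m * n)) := by
    rw [RingEquiv.symm_apply_eq]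
    ext <;> simp
  have hm : (m : ℂ) ≠ 0 := by exact_mod_cast NeZero.ne m
  have hn : (n : ℂ) ≠ 0 := by exact_mod_cast NeZero.ne n
  rw [this, ZMod.stdAddChar_coe, ZMod.stdAddChar_coe, ZMod.stdAddChar_coe, ← Complex.exp_add]
  congr 1
  push_cast
  field_simp

theorem gaussSum_eq_mul_of_coprime {m n : ℕ} [NeZero m] [NeZero n] (h : m.Coprime n)
    (χ : DirichletCharacter ℤ (m * n)) :
    gaussSum (χ.ringHomComp (Int.castRingHom ℂ)) ZMod.stdAddChar =
      (χ.fstFactor h n * χ.sndFactor h m : ℤ) *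
        (gaussSum ((χ.fstFactor h).ringHomComp (Int.castRingHom ℂ)) ZMod.stdAddChar *
        gaussSum ((χ.sndFactor h).ringHomComp (Int.castRingHom ℂ)) ZMod.stdAddChar) := by
  have hn : IsUnit (n : ZMod m) := (ZMod.isUnit_iff_coprime n m).mpr h.symm
  have hm : IsUnit (m : ZMod n) := (ZMod.isUnit_iff_coprime m n).mpr h
  have hb : Function.Bijective (fun x : ZMod m × ZMod n ↦
      (ZMod.chineseRemainder h).symm (n * x.1, m * x.2)) := by
    refine (ZMod.chineseRemainder h).symm.bijective.comp ?_
    refine Function.Bijective.prodMap ?_ ?_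
    · exact hn.unit.mulLeft_bijective
    · exact hm.unit.mulLeft_bijective
  simp only [gaussSum]
  rw [← Fintype.sum_bijective _ hb _ _ (fun _ ↦ rfl), Fintype.sum_prod_type, Finset.sum_mul_sum,
    Finset.mul_sum]
  refine Finset.sum_congr rfl fun a _ ↦ ?_
  rw [Finset.mul_sum]
  refine Finset.sum_congr rfl fun b _ ↦ ?_
  rw [stdAddChar_chineseRemainder_symm]
  simp only [MulChar.ringHomComp_apply, eq_intCast]
  rw [DirichletCharacter.apply_chineseRemainder_symm, map_mul, map_mul]
  push_cast
  ring

/-- Values ±1 force squares to map to 1. Nontriviality gives one nonsquare v with value -1, and any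
other nonsquare becomes a square after multiplication by v. -/
theorem MulChar.eq_quadraticChar {F : Type*} [Field F] [Fintype F] [DecidableEq F]
    {χ : MulChar F ℤ} (hχ : χ ≠ 1) : χ = quadraticChar F := by
  obtain ⟨v, hv⟩ := MulChar.ne_one_iff.mp hχ
  have hsq : ∀ a : F, a ≠ 0 → IsSquare a → χ a = 1 := by
    rintro a ha ⟨b, rfl⟩
    have hb : IsUnit b := by
      rw [isUnit_iff_ne_zero]; rintro rfl; simp at ha
    rw [map_mul]
    rcases χ.eq_one_or_neg_one_of_isUnit hb with h | h <;> simp [h]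
  have hv1 : χ v = -1 := (χ.eq_one_or_neg_one_of_isUnit v.isUnit).resolve_left hv
  have hvs : quadraticChar F v = -1 := by
    rw [quadraticChar_neg_one_iff_not_isSquare]
    exact fun h ↦ hv (hsq _ v.ne_zero h)
  refine MulChar.ext fun u ↦ ?_
  rcases quadraticChar_dichotomy u.ne_zero with h | h
  · rw [h]; exact hsq _ u.ne_zero ((quadraticChar_one_iff_isSquare u.ne_zero).mp h)
  · have h1 : quadraticChar F (u * v) = 1 := by rw [map_mul, h, hvs]; rfl
    have h2 := hsq _ (mul_ne_zero u.ne_zero v.ne_zero)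
      ((quadraticChar_one_iff_isSquare (mul_ne_zero u.ne_zero v.ne_zero)).mp h1)
    rw [map_mul, hv1] at h2
    rw [h]; linarith

end

/-! ### Prime-power levels, and the sign of the Gauss sum at every level. -/

section

open Complex Filter Topology

theorem one_add_pow_of_sq_eq_zero {R : Type*} [CommRing R] {x : R} (hx : x * x = 0) (n : ℕ) :
    (1 + x) ^ n = 1 + n * x := by
  induction n with
  | zero => simp
  | succ n ih =>
    rw [pow_succ, ih]
    push_cast
    linear_combination (n : R) * hx

theorem ZMod.exists_eq_one_add_of_unitsMap_eq_one {d N : ℕ} (hd : d ∣ N) {u : (ZMod N)ˣ}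
    (hu : ZMod.unitsMap hd u = 1) : ∃ k : ZMod N, (u : ZMod N) = 1 + d * k := by
  have h1 : ZMod.castHom hd (ZMod d) u = 1 := congrArg Units.val hu
  obtain ⟨a, ha⟩ := ZMod.intCast_surjective (u : ZMod N)
  rw [← ha, map_intCast] at h1
  have h2 : ((a - 1 : ℤ) : ZMod d) = 0 := by push_cast; rw [h1, sub_self]
  obtain ⟨k, hk⟩ := (ZMod.intCast_zmod_eq_zero_iff_dvd _ _).mp h2
  refine ⟨k, ?_⟩
  rw [← ha]
  have : a = 1 + d * k := by linarith
  rw [this]; push_cast; rfl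

/-- If M = p m, then u = 1 + p m k satisfies u^p = 1, so χ(u) = ±1 with p odd forces χ(u) = 1. The
character would then have level p m. -/
theorem DirichletCharacter.IsPrimitive.coprime_of_odd_prime {p M : ℕ} [NeZero M] (hp : p.Prime)
    (hp2 : _root_.Odd p) {χ : DirichletCharacter ℤ (p * M)} (hχ : χ.IsPrimitive) : p.Coprime M := by
  have : NeZero p := ⟨hp.ne_zero⟩
  rw [hp.coprime_iff_not_dvd]
  rintro ⟨m, rfl⟩
  refine absurd (hχ.eq_of_forall (dvd_mul_left (p * m) p) fun u hu ↦ ?_) ?_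
  · obtain ⟨k, hk⟩ := ZMod.exists_eq_one_add_of_unitsMap_eq_one _ hu
    have hN : ((p * (p * m) : ℕ) : ZMod (p * (p * m))) = 0 := ZMod.natCast_self _
    push_cast at hN hk
    have h1 : (u : ZMod (p * (p * m))) ^ p = 1 := by
      rw [hk, one_add_pow_of_sq_eq_zero]
      · linear_combination k * hN
      · linear_combination m * k ^ 2 * hN
    have h2 := congrArg χ h1
    rw [map_pow, map_one] at h2
    rcases χ.eq_one_or_neg_one_of_isUnit u.isUnit with h | h
    · exact h
    · rw [h, hp2.neg_one_pow] at h2; norm_num at h2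
  · have := Nat.pos_of_ne_zero (NeZero.ne (p * m))
    nlinarith [hp.one_lt]

theorem stdAddChar_natCast_eq_pow {N : ℕ} [NeZero N] {ζ : ℂ} (hζ : cexp (2 * Real.pi * I / N) = ζ)
    (j : ℕ) : (ZMod.stdAddChar ((j : ℕ) : ZMod N) : ℂ) = ζ ^ j := by
  have := ZMod.stdAddChar_coe (N := N) j
  rw [Int.cast_natCast] at this
  rw [this, ← hζ, ← Complex.exp_nat_mul]
  congr 1; push_cast; ring

theorem gaussSum_four {χ : DirichletCharacter ℤ 4} (hχ : χ.IsPrimitive) :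
    gaussSum (χ.ringHomComp (Int.castRingHom ℂ)) ZMod.stdAddChar =
      √(4 : ℕ) * (if χ (-1) = 1 then 1 else I) := by
  have hI2 := I_sq
  have h3 : χ 3 = -1 := by
    refine (χ.eq_one_or_neg_one_of_isUnit (by decide)).resolve_left fun h3 ↦ ?_
    have := hχ.eq_of_forall (one_dvd _) fun u _ ↦ ?_
    · norm_num at this
    · rcases (by decide : ∀ u : (ZMod 4)ˣ, (u : ZMod 4) = 1 ∨ (u : ZMod 4) = 3) u with h | h
      · rw [h, map_one]
      · rw [h, h3]
  have hψ := stdAddChar_natCast_eq_pow (N := 4) (ζ := I) (by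
    conv_rhs => rw [← exp_pi_div_two_mul_I]
    congr 1; push_cast; ring)
  have h0 : χ 0 = 0 := χ.map_nonunit (by decide)
  have h2 : χ 2 = 0 := χ.map_nonunit (by decide)
  have h1 : χ 1 = 1 := map_one χ
  have hneg : χ (-1) = -1 := h3
  have e1 := hψ 1
  have e3 := hψ 3
  have hs : √((4 : ℕ) : ℝ) = 2 := by
    rw [show ((4 : ℕ) : ℝ) = 2 ^ 2 by norm_num, Real.sqrt_sq (by norm_num)]
  rw [hs, gaussSum, hneg, if_neg (by decide),
    show (Finset.univ : Finset (ZMod 4)) = {0, 1, 2, 3} by decide, Finset.sum_insert (by decide),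
    Finset.sum_insert (by decide), Finset.sum_insert (by decide), Finset.sum_singleton]
  simp only [MulChar.ringHomComp_apply, eq_intCast, h0, h1, h2, h3]
  push_cast at e1 e3 ⊢
  rw [e1, e3]
  linear_combination -I * hI2

theorem gaussSum_eight {χ : DirichletCharacter ℤ 8} (hχ : χ.IsPrimitive) :
    gaussSum (χ.ringHomComp (Int.castRingHom ℂ)) ZMod.stdAddChar =
      √(8 : ℕ) * (if χ (-1) = 1 then 1 else I) := by
  have hI2 := I_sq
  -- The kernel of reduction modulo 4 is {1, 5}, so primitivity is detected at 5. The value at 3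
  -- remains free and gives the two primitive characters.
  have h5 : χ 5 = -1 := by
    refine (χ.eq_one_or_neg_one_of_isUnit (by decide)).resolve_left fun h5 ↦ ?_
    have := hχ.eq_of_forall (d := 4) ⟨2, by norm_num⟩ fun u hu ↦ ?_
    · norm_num at this
    · obtain ⟨k, hk⟩ := ZMod.exists_eq_one_add_of_unitsMap_eq_one _ hu
      rcases (by decide : ∀ k : ZMod 8, 1 + ((4 : ℕ) : ZMod 8) * k = 1 ∨
        1 + ((4 : ℕ) : ZMod 8) * k = 5) k with h | h
      · rw [hk, h, map_one]
      · rw [hk, h, h5]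
  have h37 : χ 7 = - χ 3 := by
    have : (7 : ZMod 8) = 5 * 3 := by decide
    rw [this, map_mul, h5]; ring
  set ζ : ℂ := (1 + I) / √2 with hζ
  have hs2 : ((√2 : ℝ) : ℂ) ^ 2 = 2 := by
    rw [← ofReal_pow, Real.sq_sqrt (by norm_num)]; norm_num
  have hs0 : ((√2 : ℝ) : ℂ) ≠ 0 := by simp
  have hζ2 : ζ ^ 2 = I := by
    rw [hζ, div_pow, hs2]; linear_combination hI2 / 2
  have hψ := stdAddChar_natCast_eq_pow (N := 8) (ζ := ζ) (by
    have : (2 * Real.pi * I / (8 : ℕ) : ℂ) = ((Real.pi / 4 : ℝ) : ℂ) * I := by push_cast; ring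
    rw [this, exp_mul_I, ← ofReal_cos, ← ofReal_sin, Real.cos_pi_div_four,
      Real.sin_pi_div_four, hζ]
    push_cast
    field_simp
    linear_combination (1 + I) * hs2)
  have h0 : χ 0 = 0 := χ.map_nonunit (by decide)
  have h2 : χ 2 = 0 := χ.map_nonunit (by decide)
  have h4 : χ 4 = 0 := χ.map_nonunit (by decide)
  have h6 : χ 6 = 0 := χ.map_nonunit (by decide)
  have h1 : χ 1 = 1 := map_one χ
  have hneg : χ (-1) = - χ 3 := h37
  have e1 := hψ 1
  have e3 := hψ 3
  have e5 := hψ 5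
  have e7 := hψ 7
  have hs : √((8 : ℕ) : ℝ) = 2 * √2 := by
    rw [show ((8 : ℕ) : ℝ) = 2 ^ 2 * 2 by norm_num, Real.sqrt_mul (by norm_num),
      Real.sqrt_sq (by norm_num)]
  rw [hs, gaussSum, hneg, show (Finset.univ : Finset (ZMod 8)) = {0, 1, 2, 3, 4, 5, 6, 7} by decide,
    Finset.sum_insert (by decide), Finset.sum_insert (by decide), Finset.sum_insert (by decide),
    Finset.sum_insert (by decide), Finset.sum_insert (by decide), Finset.sum_insert (by decide),
    Finset.sum_insert (by decide), Finset.sum_singleton]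
  simp only [MulChar.ringHomComp_apply, eq_intCast, h0, h1, h2, h4, h5, h6, h37]
  push_cast at e1 e3 e5 e7 ⊢
  rw [e1, e3, e5, e7]
  have f3 : ζ ^ 3 = I * ζ := by rw [pow_succ, hζ2]
  have f5 : ζ ^ 5 = -ζ := by
    linear_combination ζ * (ζ ^ 2 + I) * hζ2 + ζ * hI2
  have f7 : ζ ^ 7 = -(I * ζ) := by
    linear_combination ζ ^ 2 * f5 - ζ * hζ2
  have fs : ζ * √2 = 1 + I := by rw [hζ]; field_simp
  rw [f3, f5, f7]
  refine mul_right_cancel₀ hs0 ?_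
  rcases χ.eq_one_or_neg_one_of_isUnit (a := 3) (by decide) with h | h
  · rw [h, if_neg (by decide)]
    push_cast
    linear_combination 2 * (1 + I) * fs + 2 * hI2 - 2 * I * hs2
  · rw [h, if_pos (by decide)]
    push_cast
    linear_combination 2 * (1 - I) * fs - 2 * hI2 - 2 * hs2

/-- From 16 on, a unit congruent to 1 modulo half the level is the square of 1 + 2^(m+2) k, hence is
killed by a character with values ±1. Only the levels 1, 2, 4 and 8 remain, and 2 has no primitive
character. -/
theorem gaussSum_two_pow {N k : ℕ} (hN : N = 2 ^ k) [NeZero N] {χ : DirichletCharacter ℤ N}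
    (hχ : χ.IsPrimitive) :
    gaussSum (χ.ringHomComp (Int.castRingHom ℂ)) ZMod.stdAddChar =
      √N * (if χ (-1) = 1 then 1 else I) := by
  have hk : k ≤ 3 := by
    subst hN
    by_contra! hk
    obtain ⟨m, rfl⟩ := Nat.exists_eq_add_of_le' (Nat.succ_le_of_lt hk)
    have hd : 2 ^ (m + 3) ∣ 2 ^ (m + 4) := pow_dvd_pow 2 (by omega)
    have := hχ.eq_of_forall hd fun u hu ↦ ?_
    · exact absurd this (by rw [pow_succ 2 (m + 3)]; have := Nat.pow_pos (n := m + 3) two_pos; omega)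
    · obtain ⟨k, hk⟩ := ZMod.exists_eq_one_add_of_unitsMap_eq_one _ hu
      have hN : ((2 ^ (m + 4) : ℕ) : ZMod (2 ^ (m + 4))) = 0 := ZMod.natCast_self _
      push_cast at hN hk
      have h1 : (u : ZMod (2 ^ (m + 4))) = (1 + 2 ^ (m + 2) * k) ^ 2 := by
        rw [hk]; linear_combination (-2 ^ m * k ^ 2) * hN
      have hv : IsUnit (1 + 2 ^ (m + 2) * k : ZMod (2 ^ (m + 4))) := by
        rw [← isUnit_pow_iff two_ne_zero, ← h1]; exact u.isUnit
      rw [h1, map_pow]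
      rcases χ.eq_one_or_neg_one_of_isUnit hv with h | h <;> simp [h]
  interval_cases k <;> norm_num at hN <;> subst hN
  · have : χ = 1 := Subsingleton.elim _ _
    subst this
    have h1 : ∀ a : ZMod 1, a = 0 := by decide
    rw [gaussSum, Fintype.sum_eq_single 0 (fun a ha ↦ absurd (h1 a) ha)]
    have : (1 : DirichletCharacter ℤ 1) (-1) = 1 := MulChar.one_apply (isUnit_one.neg)
    rw [if_pos this, AddChar.map_zero_eq_one, MulChar.ringHomComp_apply,
      MulChar.one_apply (by decide)]
    simp
  · exfalso
    have := hχ.eq_of_forall (one_dvd _) fun u _ ↦ ?_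
    · norm_num at this
    · rw [show u = 1 from (by decide : ∀ u : (ZMod 2)ˣ, u = 1) u, Units.val_one, map_one]
  · exact gaussSum_four hχ
  · exact gaussSum_eight hχ

/-- The Gauss sum of a primitive real character, including its sign. -/
theorem gaussSum_int_of_isPrimitive (N : ℕ) : ∀ [NeZero N] (χ : DirichletCharacter ℤ N),
    χ.IsPrimitive →
    gaussSum (χ.ringHomComp (Int.castRingHom ℂ)) ZMod.stdAddChar =
      √N * (if χ (-1) = 1 then 1 else I) := by
  induction N using Nat.strong_induction_on with
  | _ N ih =>
  intro _ χ hχ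
  rcases Nat.eq_two_pow_or_exists_odd_prime_and_dvd N with ⟨k, hk⟩ | ⟨p, hp, ⟨M, rfl⟩, hodd⟩
  · exact gaussSum_two_pow hk hχ
  have : Fact p.Prime := ⟨hp⟩
  have : NeZero M := ⟨fun h ↦ NeZero.ne (p * M) (by simp [h])⟩
  have hc := hχ.coprime_of_odd_prime hp hodd
  have hp2 : p ≠ 2 := by rintro rfl; exact absurd hodd (by decide)
  have hlt : M < p * M := by
    have := Nat.pos_of_ne_zero (NeZero.ne M)
    nlinarith [hp.one_lt]
  have h1 : χ.fstFactor hc = quadraticChar (ZMod p) := by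
    refine MulChar.eq_quadraticChar fun h ↦ ?_
    have := χ.fstFactor_isPrimitive hc hχ
    rw [h, DirichletCharacter.isPrimitive_def, DirichletCharacter.conductor_one] at this
    exact hp.one_lt.ne this
  have h2 := χ.sndFactor_isPrimitive hc hχ
  have hχ1 : χ (-1) = quadraticChar (ZMod p) (-1) * χ.sndFactor hc (-1) := by
    rw [χ.apply_eq_fstFactor_mul_sndFactor hc, h1]; simp
  have hMp : (M : ZMod p) ≠ 0 := by
    rw [Ne, ZMod.natCast_eq_zero_iff]
    exact (hp.coprime_iff_not_dvd).mp hc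
  have hqM : quadraticChar (ZMod p) (M : ZMod p) * quadraticChar (ZMod p) (M : ZMod p) = 1 := by
    rcases quadraticChar_dichotomy hMp with h | h <;> rw [h] <;> rfl
  -- By reciprocity the factors (M/p) and χ₂(p) = (χ₂(-1) M / p), with χ₂ the component modulo M,
  -- multiply to (χ₂(-1)/p). This is -1 exactly when both components are odd, where it compensates I
  -- * I = -1.
  have hprod : quadraticChar (ZMod p) (M : ZMod p) *
      quadraticChar (ZMod p) (((χ.sndFactor hc (-1) * M : ℤ)) : ZMod p) =
      quadraticChar (ZMod p) ((χ.sndFactor hc (-1) : ℤ) : ZMod p) := by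
    rw [Int.cast_mul, Int.cast_natCast, map_mul, mul_left_comm, hqM, mul_one]
  rw [gaussSum_eq_mul_of_coprime hc, h1, gaussSum_quadraticChar_eq p hp2, ih M hlt _ h2,
    h2.apply_prime p hp2 hc, hχ1, hprod, Nat.cast_mul, Real.sqrt_mul (by positivity)]
  have hI2 := I_sq
  have hm1 : quadraticChar (ZMod p) (-1) = 1 ∨ quadraticChar (ZMod p) (-1) = -1 :=
    quadraticChar_dichotomy (neg_ne_zero.mpr one_ne_zero)
  rcases (χ.sndFactor hc).eq_one_or_neg_one_of_isUnit (isUnit_one.neg) with h | h <;>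
  rcases hm1 with h' | h' <;> simp [h, h']
  · ring
  · ring
  · linear_combination -(√p * √M : ℂ) * hI2

end

/-! ### Functional equation of the theta series, with root number 1. -/

section

open Complex Filter Topology Asymptotics DirichletAsymptotics HurwitzZeta

/-- Values at units are real of norm 1, hence ±1. -/
theorem DirichletCharacter.exists_int_of_real {N : ℕ} [NeZero N] {χ : DirichletCharacter ℂ N}
    (hreal : ∀ a : ZMod N, (χ a).im = 0) (hprim : χ.IsPrimitive) :
    ∃ X : DirichletCharacter ℤ N, X.IsPrimitive ∧ χ = X.ringHomComp (Int.castRingHom ℂ) := by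
  have hval : ∀ u : (ZMod N)ˣ, χ u = 1 ∨ χ u = -1 := by
    intro u
    have h1 : ‖χ u‖ = 1 := χ.unit_norm_eq_one u
    have h2 : χ u = ((χ u).re : ℂ) := Complex.ext rfl (by simp [hreal])
    rw [h2, norm_real, Real.norm_eq_abs] at h1
    rw [h2]
    rcases (abs_eq zero_le_one).mp h1 with h | h <;> simp [h]
  classical
  let f : (ZMod N)ˣ →* ℤˣ :=
    { toFun := fun u ↦ if χ u = 1 then 1 else -1
      map_one' := by simp
      map_mul' := by
        intro u v
        rcases hval u with hu | hu <;> rcases hval v with hv | hv <;>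
          norm_num [hu, hv, Complex.ext_iff, Units.ext_iff] }
  have hf : χ = (MulChar.ofUnitHom f : DirichletCharacter ℤ N).ringHomComp (Int.castRingHom ℂ) := by
    refine MulChar.ext fun u ↦ ?_
    rw [MulChar.ringHomComp_apply, MulChar.ofUnitHom_coe]
    rcases hval u with hu | hu
    · simp [f, hu]
    · have : (-1 : ℂ) ≠ 1 := by norm_num
      simp [f, hu, this]
  refine ⟨MulChar.ofUnitHom f, isPrimitive_of_forall fun d hd h ↦ ?_, hf⟩
  refine hprim.eq_of_forall hd fun u hu ↦ ?_
  rw [hf, MulChar.ringHomComp_apply, h u hu]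
  simp

theorem DirichletCharacter.sum_mul_stdAddChar {N : ℕ} [NeZero N] {X : DirichletCharacter ℤ N}
    (hX : X.IsPrimitive) (n : ZMod N) :
    ∑ j, (X j : ℂ) * ZMod.stdAddChar (n * j) =
      X n * (√N * (if X (-1) = 1 then 1 else I)) := by
  have hc : ringChar ℂ ≠ 2 := by rw [ringChar.eq_zero]; norm_num
  have hX' := hX.ringHomComp hc
  have h := gaussSum_mulShift_of_isPrimitive ZMod.stdAddChar hX' n
  rw [gaussSum_int_of_isPrimitive N X hX, (X.isQuadratic_int.comp _).inv] at h
  simpa [gaussSum, AddChar.mulShift_apply] using h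

/-- The theta series `∑ χ(n) n^ν exp(-π n² t)` over all integers. -/
noncomputable def intTheta {N : ℕ} (X : DirichletCharacter ℤ N) (ν : ℕ) (t : ℝ) : ℂ :=
  ∑' n : ℤ, (X n : ℂ) * (n : ℂ) ^ ν * (Real.exp (-Real.pi * n ^ 2 * t) : ℂ)

theorem hasSum_even_residues {N : ℕ} [NeZero N] (X : DirichletCharacter ℤ N) {t : ℝ} (ht : 0 < t) :
    HasSum (fun n : ℤ ↦ (X n : ℂ) * (n : ℂ) ^ 0 * (Real.exp (-Real.pi * n ^ 2 * t) : ℂ))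
      (∑ j : ZMod N, (X j : ℂ) * evenKernel ((j.val / N : ℝ) : UnitAddCircle) (N ^ 2 * t)) := by
  have hN : (0 : ℝ) < N := by exact_mod_cast Nat.pos_of_ne_zero (NeZero.ne N)
  refine hasSum_int_of_residues fun j ↦ ?_
  have := (hasSum_ofReal.mpr (hasSum_int_evenKernel (j.val / N)
    (by positivity : 0 < (N : ℝ) ^ 2 * t))).mul_left (X j : ℂ)
  convert! this using 2 with m
  push_cast
  simp only [ZMod.natCast_self, mul_zero, zero_add, ZMod.natCast_val, ZMod.cast_id, pow_zero, mul_one]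
  congr 2
  have : (N : ℂ) ≠ 0 := by exact_mod_cast hN.ne'
  field_simp

theorem hasSum_odd_residues {N : ℕ} [NeZero N] (X : DirichletCharacter ℤ N) {t : ℝ} (ht : 0 < t) :
    HasSum (fun n : ℤ ↦ (X n : ℂ) * (n : ℂ) ^ 1 * (Real.exp (-Real.pi * n ^ 2 * t) : ℂ))
      (∑ j : ZMod N, (X j * N : ℂ) * oddKernel ((j.val / N : ℝ) : UnitAddCircle) (N ^ 2 * t)) := by
  have hN : (0 : ℝ) < N := by exact_mod_cast Nat.pos_of_ne_zero (NeZero.ne N)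
  refine hasSum_int_of_residues fun j ↦ ?_
  have := (hasSum_ofReal.mpr (hasSum_int_oddKernel (j.val / N)
    (by positivity : 0 < (N : ℝ) ^ 2 * t))).mul_left (X j * N : ℂ)
  convert! this using 2 with m
  push_cast
  simp only [ZMod.natCast_self, mul_zero, zero_add, ZMod.natCast_val, ZMod.cast_id, pow_one]
  have : (N : ℂ) ≠ 0 := by exact_mod_cast hN.ne'
  have e : -(Real.pi : ℂ) * (m * N + j.cast) ^ 2 * t =
    -Real.pi * (m + j.cast / N) ^ 2 * (N ^ 2 * t) := by field_simp
  rw [e]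
  field_simp

theorem stdAddChar_eq_exp {N : ℕ} [NeZero N] (j : ZMod N) (n : ℤ) :
    (ZMod.stdAddChar ((n : ZMod N) * j) : ℂ) =
      cexp (2 * Real.pi * I * ((j.val / N : ℝ) : ℂ) * n) := by
  have : (n : ZMod N) * j = ((n * j.val : ℤ) : ZMod N) := by simp
  rw [this, ZMod.stdAddChar_coe]
  congr 1
  push_cast
  ring

theorem hasSum_cos_residues {N : ℕ} [NeZero N] {X : DirichletCharacter ℤ N} (hX : X.IsPrimitive)
    {t : ℝ} (ht : 0 < t) :
    HasSum (fun n : ℤ ↦ (√N * (if X (-1) = 1 then 1 else I) : ℂ) *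
      ((X n : ℂ) * (n : ℂ) ^ 0 * (Real.exp (-Real.pi * n ^ 2 * t) : ℂ)))
      (∑ j : ZMod N, (X j : ℂ) * cosKernel ((j.val / N : ℝ) : UnitAddCircle) t) := by
  have := hasSum_sum (s := Finset.univ) (fun (j : ZMod N) _ ↦
    (hasSum_int_cosKernel (j.val / N) ht).mul_left (X j : ℂ))
  convert! this using 2 with n
  have h := DirichletCharacter.sum_mul_stdAddChar hX n
  simp_rw [stdAddChar_eq_exp] at h
  simp_rw [← mul_assoc]
  rw [← Finset.sum_mul]
  simp_rw [← mul_assoc] at h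
  rw [h]
  ring

theorem hasSum_sin_residues {N : ℕ} [NeZero N] {X : DirichletCharacter ℤ N} (hX : X.IsPrimitive)
    {t : ℝ} (ht : 0 < t) :
    HasSum (fun n : ℤ ↦ (-I * √N * (if X (-1) = 1 then 1 else I) : ℂ) *
      ((X n : ℂ) * (n : ℂ) ^ 1 * (Real.exp (-Real.pi * n ^ 2 * t) : ℂ)))
      (∑ j : ZMod N, (X j : ℂ) * sinKernel ((j.val / N : ℝ) : UnitAddCircle) t) := by
  have := hasSum_sum (s := Finset.univ) (fun (j : ZMod N) _ ↦
    (hasSum_int_sinKernel (j.val / N) ht).mul_left (X j : ℂ))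
  convert! this using 2 with n
  have h := DirichletCharacter.sum_mul_stdAddChar hX n
  simp_rw [stdAddChar_eq_exp] at h
  have e : ∀ j : ZMod N, (X j : ℂ) * (-I * n * cexp (2 * Real.pi * I * ((j.val / N : ℝ) : ℂ) * n) *
      (Real.exp (-Real.pi * n ^ 2 * t) : ℂ)) = ((X j : ℂ) *
      cexp (2 * Real.pi * I * ((j.val / N : ℝ) : ℂ) * n)) * (-I * n *
      (Real.exp (-Real.pi * n ^ 2 * t) : ℂ)) := fun j ↦ by ring
  simp_rw [e]
  rw [← Finset.sum_mul, h]
  ring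

/-- Split by residues modulo N, the series is a combination of values of `evenKernel`. Poisson
summation turns these into `cosKernel`, and the sum over residues is then a Gauss sum times the same
series. The known Gauss sum √N leaves no constant behind. -/
theorem intTheta_zero_functional_equation {N : ℕ} [NeZero N] {X : DirichletCharacter ℤ N}
    (hX : X.IsPrimitive) (hev : X (-1) = 1) {x : ℝ} (hx : 0 < x) :
    intTheta X 0 (1 / x / N) = (x ^ (1 / 2 : ℝ) : ℝ) * intTheta X 0 (x / N) := by
  have hN : (0 : ℝ) < N := by exact_mod_cast Nat.pos_of_ne_zero (NeZero.ne N)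
  have h1 := (hasSum_even_residues X (t := x / N) (by positivity)).tsum_eq
  have h2 := (hasSum_cos_residues hX (t := 1 / x / N) (by positivity)).tsum_eq
  rw [tsum_mul_left, if_pos hev, mul_one] at h2
  have e1 : (N : ℝ) ^ 2 * (x / N) = N * x := by field_simp
  have e2 : 1 / (N * x) = 1 / x / N := by field_simp
  simp_rw [e1, evenKernel_functional_equation _ (N * x), e2] at h1
  have h3 : intTheta X 0 (x / N) = ((1 / (N * x) ^ (1 / 2 : ℝ) : ℝ) : ℂ) *
      (√N * intTheta X 0 (1 / x / N)) := by
    rw [intTheta, intTheta, h1, h2, Finset.mul_sum]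
    refine Finset.sum_congr rfl fun j _ ↦ ?_
    push_cast; ring
  rw [h3, Real.mul_rpow hN.le hx.le, Real.sqrt_eq_rpow]
  have n1 : (((N : ℝ) ^ (1 / 2 : ℝ) : ℝ) : ℂ) ≠ 0 := ofReal_ne_zero.mpr (by positivity)
  have n2 : ((x ^ (1 / 2 : ℝ) : ℝ) : ℂ) ≠ 0 := ofReal_ne_zero.mpr (by positivity)
  rw [ofReal_div, ofReal_mul, ofReal_one]
  field_simp

/-- The argument of the even case with the odd kernels; the factor -I of `sinKernel` cancels the I
of the odd Gauss sum. -/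
theorem intTheta_one_functional_equation {N : ℕ} [NeZero N] {X : DirichletCharacter ℤ N}
    (hX : X.IsPrimitive) (hodd : X (-1) = -1) {x : ℝ} (hx : 0 < x) :
    intTheta X 1 (1 / x / N) = (x ^ (3 / 2 : ℝ) : ℝ) * intTheta X 1 (x / N) := by
  have hN : (0 : ℝ) < N := by exact_mod_cast Nat.pos_of_ne_zero (NeZero.ne N)
  have h1 := (hasSum_odd_residues X (t := x / N) (by positivity)).tsum_eq
  have h2 := (hasSum_sin_residues hX (t := 1 / x / N) (by positivity)).tsum_eq
  rw [tsum_mul_left, if_neg (by rw [hodd]; decide),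
    (by linear_combination -(√N : ℂ) * I_sq : -I * √N * I = (√N : ℂ))] at h2
  have e1 : (N : ℝ) ^ 2 * (x / N) = N * x := by field_simp
  have e2 : 1 / (N * x) = 1 / x / N := by field_simp
  simp_rw [e1, oddKernel_functional_equation _ (N * x), e2] at h1
  have h3 : intTheta X 1 (x / N) = ((1 / (N * x) ^ (3 / 2 : ℝ) : ℝ) : ℂ) *
      (N * (√N * intTheta X 1 (1 / x / N))) := by
    rw [intTheta, intTheta, h1, h2, Finset.mul_sum, Finset.mul_sum]
    refine Finset.sum_congr rfl fun j _ ↦ ?_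
    push_cast; ring
  have e3 : (N : ℝ) ^ (3 / 2 : ℝ) = N * √N := by
    rw [Real.sqrt_eq_rpow, show (3 / 2 : ℝ) = 1 + 1 / 2 by norm_num, Real.rpow_add hN,
      Real.rpow_one]
  rw [h3, Real.mul_rpow hN.le hx.le, e3]
  have n1 : ((√N : ℝ) : ℂ) ≠ 0 := ofReal_ne_zero.mpr (by positivity)
  have n3 : (N : ℂ) ≠ 0 := by exact_mod_cast NeZero.ne N
  have n2 : ((x ^ (3 / 2 : ℝ) : ℝ) : ℂ) ≠ 0 := ofReal_ne_zero.mpr (by positivity)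
  rw [ofReal_div, ofReal_mul, ofReal_mul, ofReal_one, ofReal_natCast]
  field_simp

end

/-! ### Size of the theta series at infinity and at zero. -/

section

open Complex Filter Topology Asymptotics DirichletAsymptotics HurwitzZeta MeasureTheory

/-- The theta series `∑_{m ≥ 1} χ(m) m^ν exp(-π m² x / N)` of a real character. -/
noncomputable def realTheta {N : ℕ} (X : DirichletCharacter ℤ N) (ν : ℕ) (x : ℝ) : ℝ :=
  ∑' m : ℕ, (X m : ℝ) * (m : ℝ) ^ ν * Real.exp (-(Real.pi / N) * m ^ 2 * x)

theorem abs_intCast_char_le_one {N : ℕ} (X : DirichletCharacter ℤ N) (a : ZMod N) : |(X a : ℝ)| ≤ 1 := by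
  rcases X.isQuadratic_int a with h | h | h <;> rw [h] <;> norm_num

/-- A single majorant, independent of χ and ν, that serves convergence, continuity and the tail
estimate. The term m = 0 vanishes because N > 1. -/
theorem norm_realTheta_term_le {N ν : ℕ} (hN : 1 < N) (hν : ν ≤ 1) (X : DirichletCharacter ℤ N) (m : ℕ)
    {q t x : ℝ} (hq : 0 ≤ q) (hx : t ≤ x) :
    ‖(X m : ℝ) * (m : ℝ) ^ ν * Real.exp (-q * m ^ 2 * x)‖ ≤
      (m : ℝ) * Real.exp (-(q * t) * m ^ 2) := by
  rw [norm_mul, norm_mul, Real.norm_eq_abs, Real.norm_eq_abs, Real.norm_eq_abs, Real.abs_exp]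
  rcases Nat.eq_zero_or_pos m with rfl | hm
  · have : X ((0 : ℕ) : ZMod N) = 0 := by
      rw [Nat.cast_zero]; exact X.map_zero' hN.ne'
    rw [this]
    simp
  have h1 : |(m : ℝ) ^ ν| ≤ m := by
    rw [abs_of_nonneg (by positivity)]
    simpa using pow_le_pow_right₀ (by exact_mod_cast hm : (1 : ℝ) ≤ m) hν
  have h2 := abs_intCast_char_le_one X m
  have h3 : Real.exp (-q * m ^ 2 * x) ≤ Real.exp (-(q * t) * m ^ 2) := by
    refine Real.exp_le_exp.mpr ?_
    have : 0 ≤ q * (m : ℝ) ^ 2 := by positivity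
    nlinarith
  calc _ ≤ 1 * (m : ℝ) * Real.exp (-(q * t) * m ^ 2) := by gcongr
    _ = _ := by ring

section

variable {N : ℕ} {X : DirichletCharacter ℤ N} {ν : ℕ}

theorem summable_nat_mul_exp_neg_sq {q : ℝ} (hq : 0 < q) :
    Summable fun m : ℕ ↦ (m : ℝ) * Real.exp (-q * m ^ 2) := by
  refine Summable.of_nonneg_of_le (fun m ↦ by positivity) (fun m ↦ ?_)
    (by simpa using Real.summable_pow_mul_exp_neg_nat_mul 1 hq)
  refine mul_le_mul_of_nonneg_left (Real.exp_le_exp.mpr ?_) (by positivity)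
  have : (m : ℝ) ≤ (m : ℝ) ^ 2 := by exact_mod_cast Nat.le_self_pow two_ne_zero m
  nlinarith

theorem hasSum_realTheta (hN : 1 < N) (hν : ν ≤ 1) (X : DirichletCharacter ℤ N) {x : ℝ}
    (hx : 0 < x) :
    HasSum (fun m : ℕ ↦ (X m : ℝ) * (m : ℝ) ^ ν * Real.exp (-(Real.pi / N) * m ^ 2 * x))
      (realTheta X ν x) := by
  have hq : 0 < Real.pi / N := div_pos Real.pi_pos (by exact_mod_cast (by omega : 0 < N))
  refine Summable.hasSum (Summable.of_norm_bounded (summable_nat_mul_exp_neg_sq (mul_pos hq hx))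
    fun m ↦ norm_realTheta_term_le hN hν X m hq.le le_rfl)

theorem continuousOn_realTheta (hN : 1 < N) (hν : ν ≤ 1) (X : DirichletCharacter ℤ N) :
    ContinuousOn (realTheta X ν) (Set.Ioi 0) := by
  have hq : 0 < Real.pi / N := div_pos Real.pi_pos (by exact_mod_cast (by omega : 0 < N))
  intro x (hx : 0 < x)
  have h1 : ContinuousOn (realTheta X ν) (Set.Ici (x / 2)) := by
    refine continuousOn_tsum (fun m ↦ by fun_prop)
      (summable_nat_mul_exp_neg_sq (mul_pos hq (half_pos hx))) fun m y hy ↦ ?_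
    exact norm_realTheta_term_le hN hν X m hq.le hy
  exact (h1.continuousAt (Ici_mem_nhds (half_lt_self hx))).continuousWithinAt

/-- On `[1, ∞)` the theta series is given by its first term up to an exponentially smaller error. -/
theorem exists_realTheta_sub_le (hN : 1 < N) (hν : ν ≤ 1) (X : DirichletCharacter ℤ N) :
    ∃ C : ℝ, ∀ x : ℝ, 1 ≤ x → |realTheta X ν x - Real.exp (-(Real.pi / N) * x)| ≤
      C * Real.exp (-(Real.pi / N) * (4 * x)) := by
  have hq : 0 < Real.pi / N := div_pos Real.pi_pos (by exact_mod_cast (by omega : 0 < N))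
  set q := Real.pi / N with hqdef
  have hs := summable_nat_mul_exp_neg_sq hq
  refine ⟨Real.exp (q * 4) * ∑' m : ℕ, (m : ℝ) * Real.exp (-q * m ^ 2), fun x hx ↦ ?_⟩
  have h1 := hasSum_ite_sub_hasSum (hasSum_realTheta hN hν X (by linarith : 0 < x)) 1
  simp only [Nat.cast_one, map_one, Int.cast_one, one_pow, mul_one] at h1
  rw [← hqdef] at h1
  rw [one_mul] at h1
  rw [← h1.tsum_eq, ← Real.norm_eq_abs]
  have h2 := (hs.hasSum).mul_left (Real.exp (q * 4) * Real.exp (-q * (4 * x)))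
  refine (tsum_of_norm_bounded h2 fun m ↦ ?_).trans (le_of_eq (by ring))
  split_ifs with hm
  · rw [norm_zero]; positivity
  rcases Nat.eq_zero_or_pos m with rfl | hm0
  · have : X ((0 : ℕ) : ZMod N) = 0 := by
      rw [Nat.cast_zero]; exact X.map_zero' hN.ne'
    rw [Nat.cast_zero] at this
    simp [this]
  · refine (norm_realTheta_term_le hN hν X m hq.le le_rfl).trans ?_
    rw [mul_comm (Real.exp _ * Real.exp _), mul_assoc]
    refine mul_le_mul_of_nonneg_left ?_ (by positivity)
    rw [← Real.exp_add, ← Real.exp_add]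
    refine Real.exp_le_exp.mpr ?_
    have hm2 : (2 : ℝ) ≤ m := by exact_mod_cast (by omega : 2 ≤ m)
    -- Expanded, this reads q m² x ≥ 4 q x - 4 q + q m²: the decay exp(-4 q x) separates from a
    -- summable factor in m.
    have : 0 ≤ q * ((m : ℝ) ^ 2 - 4) * (x - 1) := by
      have : (0 : ℝ) ≤ (m : ℝ) ^ 2 - 4 := by nlinarith
      have : 0 ≤ x - 1 := by linarith
      positivity
    nlinarith

theorem intTheta_eq_two_mul [NeZero N] (hN : 1 < N) (hν : ν ≤ 1) (hpar : X (-1) = (-1) ^ ν) {x : ℝ}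
    (hx : 0 < x) : intTheta X ν (x / N) = 2 * (realTheta X ν x : ℂ) := by
  have hN0 : (0 : ℝ) < N := by exact_mod_cast Nat.pos_of_ne_zero (NeZero.ne N)
  have hs : Summable fun n : ℤ ↦ (X n : ℂ) * (n : ℂ) ^ ν *
      (Real.exp (-Real.pi * n ^ 2 * (x / N)) : ℂ) := by
    interval_cases ν
    · exact (hasSum_even_residues X (t := x / N) (by positivity)).summable
    · exact (hasSum_odd_residues X (t := x / N) (by positivity)).summable
  have h1 := hs.hasSum.nat_add_neg
  have h0 : X ((0 : ℤ) : ZMod N) = 0 := by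
    rw [Int.cast_zero]; exact X.map_zero' hN.ne'
  rw [h0, Int.cast_zero, zero_mul, zero_mul, add_zero] at h1
  refine h1.unique ?_
  have h2 := (hasSum_ofReal.mpr (hasSum_realTheta hN hν X hx)).mul_left 2
  convert! h2 using 2 with m
  have hneg : X (((-m : ℤ)) : ZMod N) = (-1) ^ ν * X m := by
    rw [← hpar, ← map_mul]; push_cast; ring_nf
  have e : -Real.pi * ((m : ℤ) : ℝ) ^ 2 * (x / N) = -(Real.pi / N) * m ^ 2 * x := by
    push_cast; ring
  have e' : -Real.pi * ((-m : ℤ) : ℝ) ^ 2 * (x / N) = -(Real.pi / N) * m ^ 2 * x := by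
    push_cast; ring
  have e3 : ((-1 : ℂ) ^ ν) * (-1) ^ ν = 1 := by
    rw [← mul_pow]; norm_num
  rw [hneg, e, e']
  push_cast
  rw [neg_pow (m : ℂ)]
  linear_combination (X m : ℂ) * m ^ ν * cexp (-(Real.pi / N) * m ^ 2 * x) * e3

theorem realTheta_functional_equation [NeZero N] (hN : 1 < N) (hν : ν ≤ 1) (hX : X.IsPrimitive)
    (hpar : X (-1) = (-1) ^ ν) {x : ℝ} (hx : 0 < x) :
    realTheta X ν (1 / x) = x ^ (1 / 2 + ν : ℝ) * realTheta X ν x := by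
  have h1 := intTheta_eq_two_mul hN hν hpar hx
  have h2 := intTheta_eq_two_mul hN hν hpar (one_div_pos.mpr hx)
  have h3 : intTheta X ν (1 / x / N) = (x ^ (1 / 2 + ν : ℝ) : ℝ) * intTheta X ν (x / N) := by
    interval_cases ν
    · rw [intTheta_zero_functional_equation hX (by simpa using hpar) hx]
      norm_num
    · rw [intTheta_one_functional_equation hX (by simpa using hpar) hx]
      norm_num
  rw [h1, h2] at h3
  have : ((realTheta X ν (1 / x) : ℝ) : ℂ) = ((x ^ (1 / 2 + ν : ℝ) * realTheta X ν x : ℝ) : ℂ) := by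
    rw [ofReal_mul]; linear_combination h3 / 2
  exact_mod_cast this

theorem realTheta_isBigO_exp (hN : 1 < N) (hν : ν ≤ 1) (X : DirichletCharacter ℤ N) :
    realTheta X ν =O[atTop] fun x ↦ Real.exp (-(Real.pi / N) * x) := by
  obtain ⟨C, hC⟩ := exists_realTheta_sub_le hN hν X
  have hq : 0 < Real.pi / N := div_pos Real.pi_pos (by exact_mod_cast (by omega : 0 < N))
  refine IsBigO.of_bound (1 + |C|) ?_
  filter_upwards [eventually_ge_atTop 1] with x hx
  have h := hC x hx
  rw [Real.norm_eq_abs, Real.norm_eq_abs, Real.abs_exp]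
  have h4 : Real.exp (-(Real.pi / N) * (4 * x)) ≤ Real.exp (-(Real.pi / N) * x) := by
    refine Real.exp_le_exp.mpr ?_
    nlinarith
  have h5 : C * Real.exp (-(Real.pi / N) * (4 * x)) ≤ |C| * Real.exp (-(Real.pi / N) * x) :=
    (mul_le_mul_of_nonneg_right (le_abs_self C) (Real.exp_nonneg _)).trans
      (mul_le_mul_of_nonneg_left h4 (abs_nonneg C))
  have h6 := abs_le.mp (h.trans h5)
  rw [abs_le]
  have := Real.exp_nonneg (-(Real.pi / N) * x)
  constructor <;> nlinarith

theorem realTheta_isBigO_rpow (hN : 1 < N) (hν : ν ≤ 1) (X : DirichletCharacter ℤ N) (a : ℝ) :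
    realTheta X ν =O[atTop] fun x ↦ x ^ (-a) := by
  have hq : 0 < Real.pi / N := div_pos Real.pi_pos (by exact_mod_cast (by omega : 0 < N))
  exact (realTheta_isBigO_exp hN hν X).trans (isLittleO_exp_neg_mul_rpow_atTop hq _).isBigO

/-- The functional equation carries the exponential decay at infinity over to 0. With decay at both
ends, the Mellin transform converges for every s and may be differentiated under the integral. -/
theorem realTheta_isBigO_zero [NeZero N] (hN : 1 < N) (hν : ν ≤ 1) (hX : X.IsPrimitive)
    (hpar : X (-1) = (-1) ^ ν) (b : ℝ) :
    realTheta X ν =O[𝓝[>] 0] fun x ↦ x ^ (-b) := by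
  have h := (realTheta_isBigO_rpow hN hν X (-b + (1 / 2 + ν))).comp_tendsto tendsto_inv_nhdsGT_zero
  have h2 := (isBigO_refl (fun x : ℝ ↦ x ^ (-(1 / 2 + ν : ℝ))) (𝓝[>] 0)).mul h
  refine (h2.congr' ?_ ?_)
  · filter_upwards [self_mem_nhdsWithin] with x (hx : 0 < x)
    have := realTheta_functional_equation hN hν hX hpar hx
    simp only [Function.comp]
    rw [← one_div, this, ← mul_assoc, ← Real.rpow_add hx]
    simp
  · filter_upwards [self_mem_nhdsWithin] with x (hx : 0 < x)
    simp only [Function.comp]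
    rw [← Real.rpow_neg_one x, ← Real.rpow_mul hx.le, ← Real.rpow_add hx]
    congr 1
    ring

end

end

/-! ### Derivatives of the completed L-function as logarithmic Mellin integrals. -/

section

open Complex Filter Topology Asymptotics DirichletAsymptotics HurwitzZeta MeasureTheory

section

variable {N : ℕ} {X : DirichletCharacter ℤ N} {ν : ℕ}

/-- `realTheta` times a power of the logarithm, with complex values. -/
noncomputable def logTheta {N : ℕ} (X : DirichletCharacter ℤ N) (ν n : ℕ) (x : ℝ) : ℂ :=
  ((Real.log x ^ n * realTheta X ν x : ℝ) : ℂ)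

theorem log_pow_isBigO_atTop (n : ℕ) :
    (fun x : ℝ ↦ Real.log x ^ n) =O[atTop] fun x ↦ x ^ (1 : ℝ) := by
  simpa using (isLittleO_log_rpow_rpow_atTop (n : ℝ) one_pos).isBigO

theorem log_pow_isBigO_zero (n : ℕ) :
    (fun x : ℝ ↦ Real.log x ^ n) =O[𝓝[>] 0] fun x ↦ x ^ (-1 : ℝ) := by
  have h := (log_pow_isBigO_atTop n).comp_tendsto tendsto_inv_nhdsGT_zero
  rw [← isBigO_norm_left] at h ⊢
  refine h.congr' (Eventually.of_forall fun x ↦ ?_) (Eventually.of_forall fun x ↦ ?_)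
  · simp
  · simp only [Function.comp]
    rw [Real.rpow_one, Real.rpow_neg_one]

theorem logTheta_isBigO_atTop (hN : 1 < N) (hν : ν ≤ 1) (X : DirichletCharacter ℤ N) (n : ℕ) (a : ℝ) :
    logTheta X ν n =O[atTop] fun x ↦ x ^ (-a) := by
  have h := (log_pow_isBigO_atTop n).mul (realTheta_isBigO_rpow hN hν X (a + 1))
  have h2 : (fun x : ℝ ↦ Real.log x ^ n * realTheta X ν x) =O[atTop] fun x ↦ x ^ (-a) := by
    refine h.congr' EventuallyEq.rfl ?_
    filter_upwards [eventually_gt_atTop 0] with x hx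
    rw [← Real.rpow_add hx]; congr 1; ring
  rw [← isBigO_norm_left] at h2 ⊢
  simpa only [logTheta, norm_real] using h2

theorem logTheta_isBigO_zero [NeZero N] (hN : 1 < N) (hν : ν ≤ 1) (hX : X.IsPrimitive)
    (hpar : X (-1) = (-1) ^ ν) (n : ℕ) (b : ℝ) :
    logTheta X ν n =O[𝓝[>] 0] fun x ↦ x ^ (-b) := by
  have h := (log_pow_isBigO_zero n).mul (realTheta_isBigO_zero hN hν hX hpar (b - 1))
  have h2 : (fun x : ℝ ↦ Real.log x ^ n * realTheta X ν x) =O[𝓝[>] 0] fun x ↦ x ^ (-b) := by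
    refine h.congr' EventuallyEq.rfl ?_
    filter_upwards [self_mem_nhdsWithin] with x (hx : 0 < x)
    rw [← Real.rpow_add hx]; congr 1; ring
  rw [← isBigO_norm_left] at h2 ⊢
  simpa only [logTheta, norm_real] using h2

theorem locallyIntegrableOn_logTheta (hN : 1 < N) (hν : ν ≤ 1) (X : DirichletCharacter ℤ N) (n : ℕ) :
    LocallyIntegrableOn (logTheta X ν n) (Set.Ioi 0) := by
  refine ContinuousOn.locallyIntegrableOn ?_ measurableSet_Ioi
  refine continuous_ofReal.comp_continuousOn (ContinuousOn.mul ?_ (continuousOn_realTheta hN hν X))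
  exact (Real.continuousOn_log.mono fun x (hx : 0 < x) ↦ hx.ne').pow n

theorem hasDerivAt_mellin_logTheta [NeZero N] (hN : 1 < N) (hν : ν ≤ 1) (hX : X.IsPrimitive)
    (hpar : X (-1) = (-1) ^ ν) (n : ℕ) (s : ℂ) :
    HasDerivAt (mellin (logTheta X ν n)) (mellin (logTheta X ν (n + 1)) s) s := by
  have h := (mellin_hasDerivAt_of_isBigO_rpow (s := s) (locallyIntegrableOn_logTheta hN hν X n)
    (logTheta_isBigO_atTop hN hν X n (s.re + 1)) (by linarith)
    (logTheta_isBigO_zero hN hν hX hpar n (s.re - 1)) (by linarith)).2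
  convert! h using 2
  ext x
  simp only [logTheta, real_smul, pow_succ]
  push_cast
  ring

/-- Termwise integration, justified for Re s > 1 by the convergence of ∑ m^(-Re s). -/
theorem mellin_realTheta_eq [NeZero N] (hN : 1 < N) (hν : ν ≤ 1) {χ : DirichletCharacter ℂ N}
    (hχ : χ = X.ringHomComp (Int.castRingHom ℂ)) (hpar : parity χ = ν) {s : ℂ} (hs : 1 < s.re) :
    mellin (logTheta X ν 0) ((s + ν) / 2) = completedL χ s := by
  have hN0 : (0 : ℝ) < N := by exact_mod_cast (by omega : 0 < N)
  have hq : 0 < Real.pi / N := div_pos Real.pi_pos hN0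
  have hw : ((s + ν) / 2).re = (s.re + ν) / 2 := by
    have : (s + ν) / 2 = ((1 / 2 : ℝ) : ℂ) * (s + (ν : ℝ)) := by push_cast; ring
    rw [this, re_ofReal_mul]; simp; ring
  have hw0 : 0 < ((s + ν) / 2).re := by
    rw [hw]; positivity
  have hX0 : X ((0 : ℕ) : ZMod N) = 0 := by rw [Nat.cast_zero]; exact X.map_zero' hN.ne'
  have hX1 : X (0 : ZMod N) = 0 := X.map_zero' hN.ne'
  have hterm : ∀ m : ℕ, m ≠ 0 → ∀ z : ℂ, (((Real.pi / N) * (m : ℝ) ^ 2 : ℝ) : ℂ) ^ z =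
      ((Real.pi / N : ℝ) : ℂ) ^ z * (m : ℂ) ^ (2 * z) := by
    intro m hm z
    have hm0 : (m : ℂ) ≠ 0 := by exact_mod_cast hm
    rw [ofReal_mul, ofReal_mul_cpow hq (by simpa using hm)]
    congr 1
    push_cast
    rw [sq, natCast_mul_natCast_cpow, ← cpow_add _ _ hm0]
    congr 1; ring
  have key := hasSum_mellin (ι := ℕ) (a := fun m ↦ (X m : ℂ) * (m : ℂ) ^ ν)
    (p := fun m ↦ (Real.pi / N) * (m : ℝ) ^ 2) (F := logTheta X ν 0) (s := (s + ν) / 2) ?_ hw0 ?_ ?_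
  · rw [completedL_eq χ (by linarith), χ.LFunction_eq_LSeries hs, hpar, ← key.tsum_eq, LSeries,
      ← tsum_mul_left]
    refine tsum_congr fun m ↦ ?_
    rcases eq_or_ne m 0 with rfl | hm
    · simp [hX1]
    have hm0 : (m : ℂ) ≠ 0 := by exact_mod_cast hm
    rw [LSeries.term_of_ne_zero hm, hterm m hm, hχ, MulChar.ringHomComp_apply]
    have e1 : ((N : ℂ) / (Real.pi : ℂ)) ^ ((s + ν) / 2) *
        ((Real.pi / N : ℝ) : ℂ) ^ ((s + ν) / 2) = 1 := by
      have : ((N : ℂ) / (Real.pi : ℂ)) = ((N / Real.pi : ℝ) : ℂ) := by push_cast; rfl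
      rw [this, ← mul_cpow_ofReal_nonneg (by positivity) hq.le, ← ofReal_mul]
      have : (N : ℝ) / Real.pi * (Real.pi / N) = 1 := by field_simp
      rw [this]; simp
    have e2 : (m : ℂ) ^ (2 * ((s + ν) / 2)) = (m : ℂ) ^ s * (m : ℂ) ^ ν := by
      rw [mul_div_cancel₀ _ two_ne_zero, cpow_add _ _ hm0, cpow_natCast]
    rw [e2]
    have h1 : ((Real.pi / N : ℝ) : ℂ) ^ ((s + ν) / 2) ≠ 0 := by
      rw [Ne, cpow_eq_zero_iff]
      exact fun h ↦ hq.ne' (ofReal_eq_zero.mp h.1)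
    have h2 : (m : ℂ) ^ s ≠ 0 := by simp [cpow_eq_zero_iff, hm]
    have h3 : (m : ℂ) ^ ν ≠ 0 := pow_ne_zero _ hm0
    generalize ((Real.pi / N : ℝ) : ℂ) ^ ((s + ν) / 2) = A at *
    generalize ((N : ℂ) / (Real.pi : ℂ)) ^ ((s + ν) / 2) = B at *
    field_simp
    simp only [eq_intCast]
    linear_combination -(Gamma ((s + ν) / 2) * X m : ℂ) * e1
  · intro m
    rcases eq_or_ne m 0 with rfl | hm
    · left; simp [hX1]
    · right
      have : (0 : ℝ) < m := by exact_mod_cast Nat.pos_of_ne_zero hm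
      positivity
  · intro t ht
    have := hasSum_ofReal.mpr (hasSum_realTheta hN hν X ht)
    simp only [logTheta, pow_zero, one_mul]
    convert! this using 2 with m
    push_cast
    ring_nf
  · have hs1 : Summable fun m : ℕ ↦ ((Real.pi / N) ^ ((s.re + ν) / 2))⁻¹ * (1 / (m : ℝ) ^ s.re) :=
      (Real.summable_one_div_nat_rpow.mpr hs).mul_left _
    refine Summable.of_nonneg_of_le (fun m ↦ by positivity) (fun m ↦ ?_) hs1
    rcases eq_or_ne m 0 with rfl | hm
    · simp [hX1]; positivity
    have hm0 : (0 : ℝ) < m := by exact_mod_cast Nat.pos_of_ne_zero hm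
    have e1 : ((Real.pi / N) * (m : ℝ) ^ 2) ^ ((s.re + ν) / 2) =
        (Real.pi / N) ^ ((s.re + ν) / 2) * ((m : ℝ) ^ s.re * (m : ℝ) ^ ν) := by
      rw [Real.mul_rpow hq.le (by positivity), ← Real.rpow_natCast, ← Real.rpow_mul hm0.le,
        ← Real.rpow_natCast (m : ℝ) ν, ← Real.rpow_add hm0]
      congr 2; push_cast; ring
    have e2 : ‖(X m : ℂ) * (m : ℂ) ^ ν‖ ≤ (m : ℝ) ^ ν := by
      rw [norm_mul, norm_pow, Complex.norm_natCast]
      have : ‖(X m : ℂ)‖ ≤ 1 := by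
        rw [norm_intCast]; exact abs_intCast_char_le_one X _
      exact mul_le_of_le_one_left (by positivity) this
    rw [hw, e1]
    calc _ ≤ (m : ℝ) ^ ν / ((Real.pi / N) ^ ((s.re + ν) / 2) * ((m : ℝ) ^ s.re * (m : ℝ) ^ ν)) := by
          gcongr
      _ = _ := by field_simp

theorem differentiable_completedL [NeZero N] (hN : 1 < N) {χ : DirichletCharacter ℂ N} (hχ : χ ≠ 1) :
    Differentiable ℂ (completedL χ) := by
  have hN0 : (N : ℂ) ≠ 0 := by exact_mod_cast (by omega : N ≠ 0)
  refine Differentiable.mul ?_ (DirichletCharacter.differentiable_completedLFunction hχ)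
  intro s
  exact (((differentiableAt_id.add_const _).div_const _).const_cpow (Or.inl hN0))

/-- The completed `L`-function is a Mellin transform of the theta series, for every `s`. -/
theorem completedL_eq_mellin [NeZero N] (hN : 1 < N) (hν : ν ≤ 1) (hX : X.IsPrimitive)
    (hpar : X (-1) = (-1) ^ ν) {χ : DirichletCharacter ℂ N} (hχ1 : χ ≠ 1)
    (hχ : χ = X.ringHomComp (Int.castRingHom ℂ)) (hpar' : parity χ = ν) (s : ℂ) :
    completedL χ s = mellin (logTheta X ν 0) ((s + ν) / 2) := by
  have hd : Differentiable ℂ fun s : ℂ ↦ mellin (logTheta X ν 0) ((s + ν) / 2) := by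
    intro s
    exact (hasDerivAt_mellin_logTheta hN hν hX hpar 0 _).differentiableAt.comp s
      ((differentiableAt_id.add_const _).div_const _)
  have h := AnalyticOnNhd.eq_of_eventuallyEq (z₀ := 2)
    (fun z _ ↦ (differentiable_completedL hN hχ1).analyticAt z)
    (fun z _ ↦ hd.analyticAt z) ?_
  · exact congrFun h s
  · have : {z : ℂ | 1 < z.re} ∈ 𝓝 (2 : ℂ) :=
      (isOpen_lt continuous_const continuous_re).mem_nhds (by simp)
    filter_upwards [this] with z hz
    exact (mellin_realTheta_eq hN hν hχ hpar' hz).symm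

theorem iteratedDeriv_completedL [NeZero N] (hN : 1 < N) (hν : ν ≤ 1) (hX : X.IsPrimitive)
    (hpar : X (-1) = (-1) ^ ν) {χ : DirichletCharacter ℂ N} (hχ1 : χ ≠ 1)
    (hχ : χ = X.ringHomComp (Int.castRingHom ℂ)) (hpar' : parity χ = ν) (n : ℕ) :
    iteratedDeriv n (completedL χ) =
      fun s ↦ (1 / 2 : ℂ) ^ n * mellin (logTheta X ν n) ((s + ν) / 2) := by
  induction n with
  | zero =>
    ext s
    rw [iteratedDeriv_zero, completedL_eq_mellin hN hν hX hpar hχ1 hχ hpar']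
    simp
  | succ n ih =>
    rw [iteratedDeriv_succ, ih]
    ext s
    have h1 : HasDerivAt (fun s : ℂ ↦ (s + ν) / 2) (1 / 2) s :=
      ((hasDerivAt_id s).add_const _).div_const _
    have h2 := ((hasDerivAt_mellin_logTheta hN hν hX hpar n ((s + ν) / 2)).comp s h1).const_mul
      ((1 / 2 : ℂ) ^ n)
    refine h2.deriv.trans ?_
    ring

/-- At the centre, the Mellin integral in the variable u is a Fourier integral at frequency 0. Its
weight Φ is even by the functional equation, so the half-lines contribute equally up to (-1)^n. -/
theorem mellin_logTheta_center [NeZero N] (hN : 1 < N) (hν : ν ≤ 1) (hX : X.IsPrimitive)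
    (hpar : X (-1) = (-1) ^ ν) (n : ℕ) :
    mellin (logTheta X ν n) ((1 / 2 + ν) / 2) = (((1 + (-1) ^ n) *
      ∫ u in Set.Ioi (0 : ℝ), u ^ n * (Real.exp ((1 / 4 + ν / 2) * u) *
        realTheta X ν (Real.exp u)) : ℝ) : ℂ) := by
  set a : ℝ := 1 / 4 + ν / 2 with ha
  set Φ : ℝ → ℝ := fun u ↦ Real.exp (a * u) * realTheta X ν (Real.exp u) with hΦ
  have hΦeven : ∀ u, Φ (-u) = Φ u := by
    intro u
    have h := realTheta_functional_equation hN hν hX hpar (Real.exp_pos u)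
    simp only [hΦ]
    rw [Real.exp_neg, ← one_div, h, ← Real.exp_mul, ← mul_assoc, ← Real.exp_add]
    congr 2
    rw [ha]; ring
  have h1 : ((1 / 2 + ν) / 2 : ℂ) = (a : ℂ) := by rw [ha]; push_cast; ring
  have h2 : mellin (logTheta X ν n) ((1 / 2 + ν) / 2) = ((∫ u : ℝ, (-u) ^ n * Φ u : ℝ) : ℂ) := by
    rw [h1, mellin_eq_fourier, ofReal_im, zero_div, Real.fourier_real_eq_integral_exp_smul,
      ← integral_complex_ofReal]
    refine integral_congr_ae (Eventually.of_forall fun u ↦ ?_)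
    simp only [mul_zero, ofReal_zero, zero_mul, Complex.exp_zero, one_smul, ofReal_re, logTheta,
      Real.log_exp, real_smul]
    rw [← hΦeven u]
    simp only [hΦ]
    push_cast
    ring_nf
  rw [h2]
  congr 1
  rcases Nat.even_or_odd n with hn | hn
  · have h3 := integral_comp_abs (f := fun u ↦ u ^ n * Φ u)
    have h4 : ∀ u : ℝ, |u| ^ n * Φ |u| = (-u) ^ n * Φ u := by
      intro u
      rw [hn.pow_abs, hn.neg_pow]
      rcases abs_choice u with h | h <;> rw [h]
      rw [hΦeven]
    simp_rw [h4] at h3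
    rw [h3, hn.neg_one_pow, one_add_one_eq_two]
  · have h3 := integral_neg_eq_self (fun u : ℝ ↦ (-u) ^ n * Φ u) volume
    have h4 : ∀ u : ℝ, (- -u) ^ n * Φ (-u) = -((-u) ^ n * Φ u) := by
      intro u
      rw [hΦeven, neg_neg, hn.neg_pow]; ring
    simp_rw [h4] at h3
    rw [integral_neg] at h3
    rw [hn.neg_one_pow]
    linarith

end

end

/-! ### The saddle-point equation and the size of its solution. -/

section

open Filter Topology Asymptotics DirichletAsymptotics

/-- `y` is the positive solution of `t = y * (q * exp y + c)`. -/
def IsHalfSaddle (q c t y : ℝ) : Prop :=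
  0 < y ∧ t = y * (q * Real.exp y + c)

/-- With y = ℓ/2 the term log(N²) is absorbed into q = π/N and the parity into c = 3/4 - ν/2; the
analysis sees only q and c. -/
theorem isSaddle_iff {N ν n : ℕ} (hN : 0 < N) {l : ℝ} :
    IsSaddle N ν n l ↔ IsHalfSaddle (Real.pi / N) (3 / 4 - ν / 2) n (l / 2) := by
  have hN' : (0 : ℝ) < N := by exact_mod_cast hN
  have h : Real.exp ((l - Real.log ((N : ℝ) ^ 2)) / 2) = Real.exp (l / 2) / N := by
    rw [Real.log_pow, show (l - ((2 : ℕ) : ℝ) * Real.log N) / 2 = l / 2 - Real.log N by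
      push_cast; ring, Real.exp_sub, Real.exp_log hN']
  unfold IsSaddle IsHalfSaddle
  rw [h]
  refine and_congr (by constructor <;> intro h <;> linarith) ?_
  rw [show Real.pi * (Real.exp (l / 2) / N) = Real.pi / N * Real.exp (l / 2) by ring]
  constructor <;> intro h <;> linarith

section

variable {q c : ℝ}

theorem strictMonoOn_mul_exp_add (hq : 0 < q) (hc : 0 < c) :
    StrictMonoOn (fun y : ℝ ↦ y * (q * Real.exp y + c)) (Set.Ici 0) := by
  intro a ha b _ hab
  have ha' : 0 ≤ a := ha
  have h : Real.exp a < Real.exp b := Real.exp_lt_exp.mpr hab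
  have h1 : q * Real.exp a + c < q * Real.exp b + c := by nlinarith
  have h2 : 0 < q * Real.exp a + c := by positivity
  exact mul_lt_mul'' hab h1 ha' h2.le

theorem existsUnique_isHalfSaddle (hq : 0 < q) (hc : 0 < c) {t : ℝ} (ht : 0 < t) :
    ∃! y, IsHalfSaddle q c t y := by
  have hcont : ContinuousOn (fun y : ℝ ↦ y * (q * Real.exp y + c)) (Set.Icc 0 (t / c)) := by
    fun_prop
  have hmem : t ∈ Set.Icc ((fun y : ℝ ↦ y * (q * Real.exp y + c)) 0)
      ((fun y : ℝ ↦ y * (q * Real.exp y + c)) (t / c)) := by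
    refine ⟨by simpa using ht.le, ?_⟩
    have h1 : 0 < t / c * (q * Real.exp (t / c)) := by positivity
    have h2 : t / c * c = t := by field_simp
    dsimp only
    linarith
  obtain ⟨y, hy, hyt⟩ := intermediate_value_Icc (by positivity) hcont hmem
  have hy0 : 0 < y := by
    rcases hy.1.lt_or_eq with h | h
    · exact h
    · rw [← h] at hyt
      simp only [zero_mul] at hyt
      exact absurd hyt ht.ne
  refine ⟨y, ⟨hy0, hyt.symm⟩, fun z hz ↦ ?_⟩
  exact (strictMonoOn_mul_exp_add hq hc).injOn hz.1.le hy0.le (hz.2.symm.trans hyt.symm)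

theorem tendsto_of_isHalfSaddle (hq : 0 < q) (hc : 0 < c) {y : ℕ → ℝ}
    (hy : ∀ n : ℕ, 1 ≤ n → IsHalfSaddle q c n (y n)) : Tendsto y atTop atTop := by
  rw [tendsto_atTop]
  intro M
  filter_upwards [eventually_ge_atTop 1,
    tendsto_natCast_atTop_atTop.eventually_gt_atTop (|M| * (q * Real.exp |M| + c))] with n hn h
  obtain ⟨h0, h1⟩ := hy n hn
  refine (le_abs_self M).trans (le_of_lt ?_)
  refine ((strictMonoOn_mul_exp_add hq hc).lt_iff_lt (abs_nonneg M) h0.le).mp ?_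
  simpa only [← h1] using h

/-- Once q e^y ≥ c, the number n lies between y q e^y and twice that; take logarithms. -/
theorem eventually_log_bounds_of_isHalfSaddle (hq : 0 < q) (hc : 0 < c) {y : ℕ → ℝ}
    (hy : ∀ n : ℕ, 1 ≤ n → IsHalfSaddle q c n (y n)) :
    ∃ C, ∀ᶠ n : ℕ in atTop, |y n + Real.log (y n) - Real.log n| ≤ C := by
  refine ⟨|Real.log q| + Real.log 2, ?_⟩
  have h1 := ((Real.tendsto_exp_atTop.comp (tendsto_of_isHalfSaddle hq hc hy)).const_mul_atTop
    hq).eventually_ge_atTop c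
  filter_upwards [eventually_ge_atTop 1, h1] with n hn hn1
  obtain ⟨h0, h2⟩ := hy n hn
  simp only [Function.comp] at hn1
  have hn0 : (0 : ℝ) < n := by exact_mod_cast hn
  have e : Real.log (y n * (q * Real.exp (y n))) = Real.log (y n) + Real.log q + y n := by
    rw [Real.log_mul h0.ne' (by positivity), Real.log_mul hq.ne' (by positivity), Real.log_exp]
    ring
  have hle : y n * (q * Real.exp (y n)) ≤ n := by nlinarith
  have hge : (n : ℝ) ≤ 2 * (y n * (q * Real.exp (y n))) := by nlinarith
  have l1 := Real.log_le_log (by positivity) hle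
  have l2 := Real.log_le_log hn0 hge
  rw [Real.log_mul two_ne_zero (by positivity)] at l2
  rw [e] at l1 l2
  have := abs_le.mp (le_refl |Real.log q|)
  have hl2 := Real.log_pos one_lt_two
  rw [abs_le]
  constructor <;> linarith

theorem isBigO_of_isHalfSaddle (hq : 0 < q) (hc : 0 < c) {y : ℕ → ℝ}
    (hy : ∀ n : ℕ, 1 ≤ n → IsHalfSaddle q c n (y n)) {N : ℝ} (hN : 0 < N) :
    (fun n : ℕ ↦ y n - Real.log ((n : ℝ) * N / Real.log ((n : ℝ) * N)))
      =O[atTop] fun _ ↦ (1 : ℝ) := by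
  obtain ⟨C, hC⟩ := eventually_log_bounds_of_isHalfSaddle hq hc hy
  set C' := |C| + |Real.log N| with hC'
  have hlim : Tendsto (fun n : ℕ ↦ Real.log ((n : ℝ) * N)) atTop atTop :=
    Real.tendsto_log_atTop.comp (tendsto_natCast_atTop_atTop.atTop_mul_const hN)
  refine IsBigO.of_bound (C' + Real.log 4) ?_
  -- For x = log(nN) ≥ 2C' + 1, the estimate y + log y = x + O(C') puts y and x within a factor 4 of
  -- each other, so log y may be replaced by log x at the cost of log 4.
  filter_upwards [hC, eventually_ge_atTop 1, hlim.eventually_ge_atTop (2 * C' + 1),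
    (tendsto_of_isHalfSaddle hq hc hy).eventually_ge_atTop 1] with n h1 hn h2 hy1
  set x := Real.log ((n : ℝ) * N) with hx
  have hn0 : (0 : ℝ) < n := by exact_mod_cast hn
  have hC0 : 0 ≤ C' := by positivity
  have hx0 : 0 < x := by linarith
  have hxe : x = Real.log n + Real.log N := Real.log_mul hn0.ne' hN.ne'
  have hS : |y n + Real.log (y n) - x| ≤ C' := by
    rw [hxe, show y n + Real.log (y n) - (Real.log n + Real.log N) =
      (y n + Real.log (y n) - Real.log n) - Real.log N by ring]
    exact (abs_sub _ _).trans (add_le_add (h1.trans (le_abs_self C)) le_rfl)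
  have hS' := abs_le.mp hS
  have hlog0 : 0 ≤ Real.log (y n) := Real.log_nonneg hy1
  have hlog1 : Real.log (y n) ≤ y n := (Real.log_le_sub_one_of_pos (by linarith)).trans (by linarith)
  have hu : Real.log (y n) ≤ Real.log 4 + Real.log x := by
    rw [← Real.log_mul (by norm_num) hx0.ne']
    exact Real.log_le_log (by linarith) (by linarith)
  have hl : Real.log x ≤ Real.log 4 + Real.log (y n) := by
    rw [← Real.log_mul (by norm_num) (by linarith)]
    exact Real.log_le_log hx0 (by linarith)
  rw [Real.log_div (by positivity) hx0.ne', ← hx, Real.norm_eq_abs, norm_one, mul_one, abs_le]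
  constructor <;> linarith

theorem eventually_le_two_mul_log_of_isHalfSaddle (hq : 0 < q) (hc : 0 < c) {y : ℕ → ℝ}
    (hy : ∀ n : ℕ, 1 ≤ n → IsHalfSaddle q c n (y n)) :
    ∀ᶠ n : ℕ in atTop, y n ≤ 2 * Real.log n := by
  obtain ⟨C, hC⟩ := eventually_log_bounds_of_isHalfSaddle hq hc hy
  filter_upwards [hC, (tendsto_of_isHalfSaddle hq hc hy).eventually_ge_atTop 1,
    (Real.tendsto_log_atTop.comp tendsto_natCast_atTop_atTop).eventually_ge_atTop C] with n h1 h2 h3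
  have := Real.log_nonneg h2
  simp only [Function.comp] at h3
  linarith [(abs_le.mp h1).2]

theorem pow_isBigO_rpow_of_isHalfSaddle (hq : 0 < q) (hc : 0 < c) {y : ℕ → ℝ}
    (hy : ∀ n : ℕ, 1 ≤ n → IsHalfSaddle q c n (y n)) (k : ℕ) {ε : ℝ} (hε : 0 < ε) :
    (fun n : ℕ ↦ y n ^ k) =O[atTop] fun n : ℕ ↦ (n : ℝ) ^ ε := by
  have h1 : (fun n : ℕ ↦ y n ^ k) =O[atTop] fun n : ℕ ↦ Real.log n ^ k := by
    refine IsBigO.pow (IsBigO.of_bound 2 ?_) k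
    filter_upwards [eventually_le_two_mul_log_of_isHalfSaddle hq hc hy,
      eventually_ge_atTop 1] with n h hn
    rw [Real.norm_of_nonneg (hy n hn).1.le]
    exact h.trans (mul_le_mul_of_nonneg_left (le_abs_self _) two_pos.le)
  refine h1.trans ?_
  have := ((isLittleO_log_rpow_rpow_atTop (k : ℝ) hε).isBigO).comp_tendsto
    (tendsto_natCast_atTop_atTop (R := ℝ))
  simpa [Function.comp_def] using this

end

end

/-! ### Expansions in 1/n with coefficients rational in a slowly growing sequence. -/

section

open Filter Topology Asymptotics DirichletAsymptotics

/-- `f n = O(n ^ (-r + δ))` for every `δ > 0`. -/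
def IsOrderAtMost (r : ℝ) (f : ℕ → ℝ) : Prop :=
  ∀ δ : ℝ, 0 < δ → f =O[atTop] fun n : ℕ ↦ (n : ℝ) ^ (-r + δ)

namespace IsOrderAtMost

variable {r s : ℝ} {f g : ℕ → ℝ}

theorem of_isBigO (h : f =O[atTop] fun n : ℕ ↦ (n : ℝ) ^ (-r)) : IsOrderAtMost r f := by
  intro δ hδ
  refine h.trans (IsBigO.of_bound 1 ?_)
  filter_upwards [eventually_ge_atTop 1] with n hn
  have hn1 : (1 : ℝ) ≤ n := by exact_mod_cast hn
  rw [one_mul, Real.norm_of_nonneg (by positivity), Real.norm_of_nonneg (by positivity)]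
  exact Real.rpow_le_rpow_of_exponent_le hn1 (by linarith)

theorem add (hf : IsOrderAtMost r f) (hg : IsOrderAtMost r g) : IsOrderAtMost r (f + g) :=
  fun δ hδ ↦ (hf δ hδ).add (hg δ hδ)

theorem sub (hf : IsOrderAtMost r f) (hg : IsOrderAtMost r g) : IsOrderAtMost r (f - g) :=
  fun δ hδ ↦ (hf δ hδ).sub (hg δ hδ)

theorem mul (hf : IsOrderAtMost r f) (hg : IsOrderAtMost s g) : IsOrderAtMost (r + s) (f * g) := by
  intro δ hδ
  refine ((hf (δ / 2) (by positivity)).mul (hg (δ / 2) (by positivity))).congr' EventuallyEq.rfl ?_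
  filter_upwards [eventually_ge_atTop 1] with n hn
  rw [← Real.rpow_add (by exact_mod_cast hn)]
  congr 1
  ring

theorem mono (hf : IsOrderAtMost r f) (h : s ≤ r) : IsOrderAtMost s f := by
  intro δ hδ
  have := hf (δ + (r - s)) (by linarith)
  rwa [show -r + (δ + (r - s)) = -s + δ by ring] at this

theorem congr' (hf : IsOrderAtMost r f) (h : f =ᶠ[atTop] g) : IsOrderAtMost r g :=
  fun δ hδ ↦ (hf δ hδ).congr' h EventuallyEq.rfl

theorem zero : IsOrderAtMost r 0 := fun _ _ ↦ isBigO_zero _ _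

theorem sum {ι : Type*} {t : Finset ι} {F : ι → ℕ → ℝ} (h : ∀ i ∈ t, IsOrderAtMost r (F i)) :
    IsOrderAtMost r (∑ i ∈ t, F i) :=
  Finset.sum_induction F (IsOrderAtMost r) (fun _ _ ↦ add) zero h

theorem of_isBigO_one (h : f =O[atTop] fun _ ↦ (1 : ℝ)) : IsOrderAtMost 0 f :=
  of_isBigO (by simpa using h)

theorem one : IsOrderAtMost 0 1 := of_isBigO_one (isBigO_refl _ _)

theorem inv_natCast : IsOrderAtMost 1 fun n : ℕ ↦ (n : ℝ)⁻¹ :=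
  of_isBigO (by simpa only [Real.rpow_neg_one] using isBigO_refl _ _)

theorem pow (hf : IsOrderAtMost r f) (k : ℕ) : IsOrderAtMost (k * r) (f ^ k) := by
  induction k with
  | zero => simpa using one
  | succ k ih =>
    rw [pow_succ]
    have := ih.mul hf
    rwa [show (k : ℝ) * r + r = ((k + 1 : ℕ) : ℝ) * r by push_cast; ring] at this

end IsOrderAtMost

theorem not_isOrderAtMost_one {r : ℝ} (hr : 0 < r) : ¬ IsOrderAtMost r 1 := by
  intro h
  have h1 := h (r / 2) (by positivity)
  have h2 : Tendsto (fun n : ℕ ↦ (n : ℝ) ^ (-r + r / 2)) atTop (𝓝 0) := by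
    rw [show -r + r / 2 = -(r / 2) by ring]
    exact (tendsto_rpow_neg_atTop (by positivity)).comp tendsto_natCast_atTop_atTop
  have h3 := h1.trans_tendsto h2
  have h4 : Tendsto (1 : ℕ → ℝ) atTop (𝓝 1) := tendsto_const_nhds
  exact zero_ne_one (tendsto_nhds_unique h3 h4)

/-- A sequence that tends to infinity more slowly than every power of `n`. -/
structure SlowlyDiverging (L : ℕ → ℝ) : Prop where
  tendsto : Tendsto L atTop atTop
  pow : ∀ k : ℕ, IsOrderAtMost 0 (L ^ k)

namespace SlowlyDiverging

variable {L : ℕ → ℝ}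

/-- A nonzero polynomial is constant or tends to infinity in norm along L. Denominators are thus
eventually bounded away from 0. -/
theorem exists_le_norm_eval (hL : SlowlyDiverging L) {p : Polynomial ℚ} (hp : p ≠ 0) :
    ∃ c > 0, ∀ᶠ n in atTop, c ≤ ‖p.eval₂ (algebraMap ℚ ℝ) (L n)‖ := by
  rcases Nat.eq_zero_or_pos p.natDegree with h | h
  · rw [Polynomial.eq_C_of_natDegree_eq_zero h] at hp ⊢
    refine ⟨‖(algebraMap ℚ ℝ) (p.coeff 0)‖, ?_, ?_⟩
    · rw [gt_iff_lt, norm_pos_iff]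
      simpa using hp
    · simp
  · refine ⟨1, one_pos, ?_⟩
    have h1 : 0 < (p.map (algebraMap ℚ ℝ)).degree := by
      rw [Polynomial.degree_map]
      exact Polynomial.natDegree_pos_iff_degree_pos.mp h
    filter_upwards [((p.map (algebraMap ℚ ℝ)).tendsto_norm_atTop h1
      (tendsto_norm_atTop_atTop.comp hL.tendsto)).eventually_ge_atTop 1] with n hn
    rwa [Polynomial.eval_map] at hn

theorem eventually_denom_ne_zero (hL : SlowlyDiverging L) (f : RatFunc ℚ) :
    ∀ᶠ n in atTop, f.denom.eval₂ (algebraMap ℚ ℝ) (L n) ≠ 0 := by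
  obtain ⟨c, hc, h⟩ := hL.exists_le_norm_eval f.denom_ne_zero
  filter_upwards [h] with n hn
  exact norm_pos_iff.mp (hc.trans_le hn)

/-- Evaluation along `L`, as a ring homomorphism into germs at infinity. -/
noncomputable def ratFuncGerm (hL : SlowlyDiverging L) :
    RatFunc ℚ →+* Germ (atTop : Filter ℕ) ℝ where
  toFun f := ((fun n ↦ f.eval (algebraMap ℚ ℝ) (L n) : ℕ → ℝ) : Germ atTop ℝ)
  map_zero' := by simp; rfl
  map_one' := by simp; rfl
  -- `RatFunc.eval` is additive and multiplicative only where the denominators do not vanish, which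
  -- holds eventually; hence germs in place of sequences.
  map_add' f g := by
    refine Germ.coe_eq.mpr ?_
    filter_upwards [hL.eventually_denom_ne_zero f, hL.eventually_denom_ne_zero g] with n h1 h2
    exact RatFunc.eval_add _ _ h1 h2
  map_mul' f g := by
    refine Germ.coe_eq.mpr ?_
    filter_upwards [hL.eventually_denom_ne_zero f, hL.eventually_denom_ne_zero g] with n h1 h2
    exact RatFunc.eval_mul _ _ h1 h2

theorem isOrderAtMost_eval (hL : SlowlyDiverging L) (f : RatFunc ℚ) :
    IsOrderAtMost 0 fun n ↦ f.eval (algebraMap ℚ ℝ) (L n) := by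
  have h1 : IsOrderAtMost 0 fun n ↦ f.num.eval₂ (algebraMap ℚ ℝ) (L n) := by
    have : (fun n ↦ f.num.eval₂ (algebraMap ℚ ℝ) (L n)) = ∑ i ∈ Finset.range (f.num.natDegree + 1),
        (fun _ ↦ algebraMap ℚ ℝ (f.num.coeff i)) * L ^ i := by
      ext n
      simp [Polynomial.eval₂_eq_sum_range, Finset.sum_apply]
    rw [this]
    refine IsOrderAtMost.sum fun i _ ↦ ?_
    simpa using (IsOrderAtMost.of_isBigO_one (isBigO_const_const _ one_ne_zero _)).mul (hL.pow i)
  have h2 : IsOrderAtMost 0 fun n ↦ (f.denom.eval₂ (algebraMap ℚ ℝ) (L n))⁻¹ := by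
    obtain ⟨c, hc, h⟩ := hL.exists_le_norm_eval f.denom_ne_zero
    refine IsOrderAtMost.of_isBigO_one (IsBigO.of_bound c⁻¹ ?_)
    filter_upwards [h] with n hn
    rw [norm_inv, norm_one, mul_one]
    exact inv_anti₀ hc hn
  simpa [RatFunc.eval, div_eq_mul_inv, Pi.mul_def] using h1.mul h2

/-- A polynomial in `1 / n` whose coefficients are rational functions of `L n`, as a germ. -/
noncomputable def expansionGerm (hL : SlowlyDiverging L) :
    Polynomial (RatFunc ℚ) →+* Germ (atTop : Filter ℕ) ℝ :=
  Polynomial.eval₂RingHom hL.ratFuncGerm ((fun n : ℕ ↦ (n : ℝ)⁻¹ : ℕ → ℝ) : Germ atTop ℝ)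

theorem eventuallyEq_of_coe_eq (hL : SlowlyDiverging L) {p : Polynomial (RatFunc ℚ)} {h : ℕ → ℝ}
    (hp : (h : Germ atTop ℝ) = hL.expansionGerm p) {M : ℕ} (hM : p.natDegree < M) :
    h =ᶠ[atTop] ∑ k ∈ Finset.range M,
      fun n : ℕ ↦ (p.coeff k).eval (algebraMap ℚ ℝ) (L n) * (n : ℝ)⁻¹ ^ k := by
  refine Germ.coe_eq.mp ?_
  rw [hp, expansionGerm, Polynomial.coe_eval₂RingHom, Polynomial.eval₂_eq_sum_range' _ hM]
  exact (map_sum (Germ.coeRingHom (R := ℝ) (atTop : Filter ℕ)) _ _).symm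

theorem isOrderAtMost_term (hL : SlowlyDiverging L) (f : RatFunc ℚ) (k : ℕ) :
    IsOrderAtMost k fun n : ℕ ↦ f.eval (algebraMap ℚ ℝ) (L n) * (n : ℝ)⁻¹ ^ k := by
  simpa [Pi.mul_def, Pi.pow_def] using (hL.isOrderAtMost_eval f).mul (IsOrderAtMost.inv_natCast.pow k)

theorem isOrderAtMost_sub_truncation (hL : SlowlyDiverging L) {p : Polynomial (RatFunc ℚ)}
    {h : ℕ → ℝ} (hp : (h : Germ atTop ℝ) = hL.expansionGerm p) (K : ℕ) :
    IsOrderAtMost K (h - ∑ k ∈ Finset.range K,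
      fun n : ℕ ↦ (p.coeff k).eval (algebraMap ℚ ℝ) (L n) * (n : ℝ)⁻¹ ^ k) := by
  have h1 := hL.eventuallyEq_of_coe_eq hp (M := K + (p.natDegree + 1)) (by omega)
  rw [Finset.sum_range_add] at h1
  have h2 : IsOrderAtMost K (∑ x ∈ Finset.range (p.natDegree + 1),
      fun n : ℕ ↦ (p.coeff (K + x)).eval (algebraMap ℚ ℝ) (L n) * (n : ℝ)⁻¹ ^ (K + x)) :=
    IsOrderAtMost.sum fun x _ ↦ (hL.isOrderAtMost_term _ _).mono (by push_cast; simp)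
  refine h2.congr' ?_
  filter_upwards [h1] with n hn
  rw [Pi.sub_apply, hn, Pi.add_apply]
  ring

theorem isOrderAtMost_of_coe_eq (hL : SlowlyDiverging L) {p : Polynomial (RatFunc ℚ)}
    {h : ℕ → ℝ} (hp : (h : Germ atTop ℝ) = hL.expansionGerm p) : IsOrderAtMost 0 h := by
  simpa using hL.isOrderAtMost_sub_truncation hp 0

/-- Since f⁻¹ has order at most 0 as well, a power decay of f ≠ 0 would make f f⁻¹ = 1 decay. -/
theorem eq_zero_of_isOrderAtMost_eval (hL : SlowlyDiverging L) {f : RatFunc ℚ} {r : ℝ} (hr : 0 < r)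
    (h : IsOrderAtMost r fun n ↦ f.eval (algebraMap ℚ ℝ) (L n)) : f = 0 := by
  by_contra hf
  have h1 := h.mul (hL.isOrderAtMost_eval f⁻¹)
  rw [add_zero] at h1
  refine not_isOrderAtMost_one hr (h1.congr' (Germ.coe_eq.mp ?_))
  have h2 := map_mul hL.ratFuncGerm f f⁻¹
  rw [mul_inv_cancel₀ hf, map_one] at h2
  exact h2.symm

/-- Once the coefficients below k vanish, multiplication by n^k isolates coefficient k up to a term
that decays like a power of n, and such a rational function of L is 0. -/
theorem coeff_eq_zero_of_isOrderAtMost (hL : SlowlyDiverging L) {p : Polynomial (RatFunc ℚ)}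
    {h : ℕ → ℝ} (hp : (h : Germ atTop ℝ) = hL.expansionGerm p) {r : ℝ} (hr : IsOrderAtMost r h)
    (k : ℕ) (hk : (k : ℝ) < r) : p.coeff k = 0 := by
  induction k using Nat.strong_induction_on with
  | _ k ih =>
    have h1 := hL.isOrderAtMost_sub_truncation hp (k + 1)
    rw [Finset.sum_range_succ, Finset.sum_eq_zero, zero_add] at h1
    · set s := min r (k + 1) with hs
      have h2 := (hr.mono (min_le_left r ((k : ℝ) + 1))).sub
        (h1.mono (s := min r ((k : ℝ) + 1)) (by push_cast; exact min_le_right _ _))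
      rw [sub_sub_cancel] at h2
      have hpow : IsOrderAtMost (-k) fun n : ℕ ↦ (n : ℝ) ^ k :=
        IsOrderAtMost.of_isBigO (by simpa using isBigO_refl _ _)
      refine hL.eq_zero_of_isOrderAtMost_eval (r := s - k) ?_ ((h2.mul hpow).congr' ?_)
      · rw [sub_pos, hs, lt_min_iff]
        exact ⟨hk, by linarith⟩
      · filter_upwards [eventually_ge_atTop 1] with n hn
        have : (n : ℝ) ≠ 0 := by exact_mod_cast (by omega : n ≠ 0)
        rw [Pi.mul_apply, mul_assoc, ← mul_pow, inv_mul_cancel₀ this, one_pow, mul_one]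
    · intro i hi
      rw [Finset.mem_range] at hi
      ext n
      rw [ih i hi (lt_trans (by exact_mod_cast hi) hk)]
      simp

/-- `f` agrees with the polynomial `p` in `1 / n` up to a sequence of order at most `r`. -/
def HasExpansion (hL : SlowlyDiverging L) (r : ℝ) (f : ℕ → ℝ) (p : Polynomial (RatFunc ℚ)) : Prop :=
  ∃ h : ℕ → ℝ, (h : Germ atTop ℝ) = hL.expansionGerm p ∧ IsOrderAtMost r (f - h)

namespace HasExpansion

variable {hL : SlowlyDiverging L} {r : ℝ} {f g : ℕ → ℝ} {p p' : Polynomial (RatFunc ℚ)}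

theorem isOrderAtMost (h : HasExpansion hL r f p) (hr : 0 ≤ r) : IsOrderAtMost 0 f := by
  obtain ⟨h, h1, h2⟩ := h
  simpa using (h2.mono hr).add (hL.isOrderAtMost_of_coe_eq h1)

theorem congr' (h : HasExpansion hL r f p) (hfg : f =ᶠ[atTop] g) : HasExpansion hL r g p := by
  obtain ⟨h, h1, h2⟩ := h
  exact ⟨h, h1, h2.congr' (hfg.sub EventuallyEq.rfl)⟩

theorem of_sub (h : HasExpansion hL r f p) (hfg : IsOrderAtMost r (g - f)) :
    HasExpansion hL r g p := by
  obtain ⟨h, h1, h2⟩ := h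
  exact ⟨h, h1, by simpa using hfg.add h2⟩

theorem add (hf : HasExpansion hL r f p) (hg : HasExpansion hL r g p') :
    HasExpansion hL r (f + g) (p + p') := by
  obtain ⟨h, h1, h2⟩ := hf
  obtain ⟨k, k1, k2⟩ := hg
  refine ⟨h + k, ?_, ?_⟩
  · rw [map_add, ← h1, ← k1, Germ.coe_add]
  · rw [add_sub_add_comm]
    exact h2.add k2

theorem mul (hr : 0 ≤ r) (hf : HasExpansion hL r f p) (hg : HasExpansion hL r g p') :
    HasExpansion hL r (f * g) (p * p') := by
  have hg0 := hg.isOrderAtMost hr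
  obtain ⟨h, h1, h2⟩ := hf
  obtain ⟨k, k1, k2⟩ := hg
  refine ⟨h * k, ?_, ?_⟩
  · rw [map_mul, ← h1, ← k1, Germ.coe_mul]
  · rw [show f * g - h * k = (f - h) * g + h * (g - k) by ring]
    have e1 := h2.mul hg0
    have e2 := (hL.isOrderAtMost_of_coe_eq h1).mul k2
    rw [add_zero] at e1
    rw [zero_add] at e2
    exact e1.add e2

theorem pow (hr : 0 ≤ r) (hf : HasExpansion hL r f p) (k : ℕ) :
    HasExpansion hL r (f ^ k) (p ^ k) := by
  induction k with
  | zero => exact ⟨1, by rw [pow_zero, map_one]; rfl, by simpa using IsOrderAtMost.zero⟩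
  | succ k ih =>
    rw [pow_succ, pow_succ]
    exact ih.mul hr hf

theorem eval (φ : RatFunc ℚ) :
    HasExpansion hL r (fun n ↦ φ.eval (algebraMap ℚ ℝ) (L n)) (Polynomial.C φ) :=
  ⟨_, by rw [expansionGerm, Polynomial.coe_eval₂RingHom, Polynomial.eval₂_C]; rfl,
    by rw [sub_self]; exact IsOrderAtMost.zero⟩

theorem const (a : ℚ) : HasExpansion hL r (fun _ ↦ (a : ℝ)) (Polynomial.C (RatFunc.C a)) := by
  refine (eval (hL := hL) (r := r) (RatFunc.C a)).congr' (.of_eq ?_)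
  ext n
  rw [RatFunc.eval_C, eq_ratCast]

theorem inv_natCast : HasExpansion hL r (fun n : ℕ ↦ (n : ℝ)⁻¹) Polynomial.X :=
  ⟨_, by rw [expansionGerm, Polynomial.coe_eval₂RingHom, Polynomial.eval₂_X],
    by rw [sub_self]; exact IsOrderAtMost.zero⟩

theorem of_isOrderAtMost (h : IsOrderAtMost r f) : HasExpansion hL r f 0 :=
  ⟨0, by rw [map_zero]; rfl, by rwa [sub_zero]⟩

theorem isOrderAtMost_sub_truncation (h : HasExpansion hL r f p) {K : ℕ} (hK : K ≤ r) :
    IsOrderAtMost K (f - ∑ k ∈ Finset.range K,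
      fun n : ℕ ↦ (p.coeff k).eval (algebraMap ℚ ℝ) (L n) * (n : ℝ)⁻¹ ^ k) := by
  obtain ⟨h, h1, h2⟩ := h
  simpa using (h2.mono hK).add (hL.isOrderAtMost_sub_truncation h1 K)

theorem coeff_eq (hp : HasExpansion hL r f p) {s : ℝ} (hq : HasExpansion hL s f p') {k : ℕ}
    (hr : k < r) (hs : k < s) : p.coeff k = p'.coeff k := by
  obtain ⟨h, h1, h2⟩ := hp
  obtain ⟨h', h1', h2'⟩ := hq
  have e : ((h' - h : ℕ → ℝ) : Germ atTop ℝ) = hL.expansionGerm (p' - p) := by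
    rw [map_sub, ← h1, ← h1', Germ.coe_sub]
  have o : IsOrderAtMost (min r s) (h' - h) := by
    simpa using (h2.mono (min_le_left r s)).sub (h2'.mono (min_le_right r s))
  have := hL.coeff_eq_zero_of_isOrderAtMost e o k (lt_min hr hs)
  rw [Polynomial.coeff_sub, sub_eq_zero] at this
  exact this.symm

end HasExpansion

end SlowlyDiverging

end

/-! ### Gaussian means of polynomials and their expansions. -/

section

open Filter Topology Asymptotics DirichletAsymptotics MeasureTheory

/-- The mean of `f` for the centred Gaussian law of variance `1 / A`. -/
noncomputable def gaussMean (A : ℝ) (f : ℝ → ℝ) : ℝ :=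
  √(A / (2 * Real.pi)) * ∫ u, f u * Real.exp (-A * u ^ 2 / 2)

theorem integrable_pow_mul_gauss {A : ℝ} (hA : 0 < A) (m : ℕ) :
    Integrable fun u : ℝ ↦ u ^ m * Real.exp (-A * u ^ 2 / 2) := by
  have := integrable_rpow_mul_exp_neg_mul_sq (b := A / 2) (by positivity) (s := m)
    (by have : (0 : ℝ) ≤ m := m.cast_nonneg
        linarith)
  refine this.congr (Eventually.of_forall fun u ↦ ?_)
  simp only [Real.rpow_natCast]
  congr 2
  ring

theorem gaussMean_of_odd (A : ℝ) {f : ℝ → ℝ} (hf : ∀ u, f (-u) = -f u) : gaussMean A f = 0 := by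
  have h := integral_neg_eq_self (fun u : ℝ ↦ f u * Real.exp (-A * u ^ 2 / 2)) volume
  simp only [hf, neg_mul, even_two.neg_pow, integral_neg] at h
  unfold gaussMean
  rw [mul_eq_zero]
  right
  simp only [neg_mul]
  linarith

theorem gaussMean_pow_odd (A : ℝ) {m : ℕ} (hm : Odd m) : gaussMean A (fun u ↦ u ^ m) = 0 :=
  gaussMean_of_odd A fun u ↦ hm.neg_pow u

open scoped Nat in
-- For k = 0 the truncated subtraction gives 0‼ = 1, as it should.
theorem gaussMean_pow_even {A : ℝ} (hA : 0 < A) (k : ℕ) :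
    gaussMean A (fun u ↦ u ^ (2 * k)) = (2 * k - 1 : ℕ)‼ * A⁻¹ ^ k := by
  have h1 : ∫ u : ℝ, u ^ (2 * k) * Real.exp (-A * u ^ 2 / 2) =
      (A / 2) ^ (-((k : ℝ) + 1 / 2)) * Real.Gamma (k + 1 / 2) := by
    have e := integral_comp_abs (f := fun u : ℝ ↦ u ^ (2 * k) * Real.exp (-A * u ^ 2 / 2))
    simp only [pow_mul, sq_abs] at e ⊢
    rw [e]
    have h := integral_rpow_mul_exp_neg_mul_rpow (p := 2) (q := 2 * k) (b := A / 2) two_pos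
      (by have : (0 : ℝ) ≤ k := k.cast_nonneg
          linarith) (by positivity)
    rw [show -(2 * (k : ℝ) + 1) / 2 = -((k : ℝ) + 1 / 2) by ring,
      show (2 * (k : ℝ) + 1) / 2 = (k : ℝ) + 1 / 2 by ring] at h
    have h' : ∫ x in Set.Ioi (0 : ℝ), x ^ (2 * (k : ℝ)) * Real.exp (-(A / 2) * x ^ (2 : ℝ)) =
        ∫ x in Set.Ioi (0 : ℝ), (x ^ 2) ^ k * Real.exp (-A * x ^ 2 / 2) := by
      refine setIntegral_congr_fun measurableSet_Ioi fun x hx ↦ ?_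
      have e1 : x ^ (2 : ℝ) = x ^ 2 := by exact_mod_cast Real.rpow_natCast x 2
      rw [Real.rpow_mul (le_of_lt hx), e1, Real.rpow_natCast]
      congr 2
      ring
    rw [← h', h]
    ring
  unfold gaussMean
  rw [h1, Real.Gamma_nat_add_half, neg_add, Real.rpow_add (by positivity), Real.rpow_neg (by positivity),
    Real.rpow_neg (by positivity), ← Real.sqrt_eq_rpow, Real.rpow_natCast,
    show A / (2 * Real.pi) = A / 2 / Real.pi by field_simp, Real.sqrt_div (by positivity)]
  have : √(A / 2) ≠ 0 := by positivity
  have : √Real.pi ≠ 0 := by positivity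
  field_simp
  rw [div_pow, div_pow, one_pow]
  field_simp

theorem gaussMean_const_mul (A a : ℝ) (f : ℝ → ℝ) :
    gaussMean A (fun u ↦ a * f u) = a * gaussMean A f := by
  unfold gaussMean
  simp only [mul_assoc, integral_const_mul]
  ring

theorem gaussMean_add {A : ℝ} {f g : ℝ → ℝ}
    (hf : Integrable fun u ↦ f u * Real.exp (-A * u ^ 2 / 2))
    (hg : Integrable fun u ↦ g u * Real.exp (-A * u ^ 2 / 2)) :
    gaussMean A (fun u ↦ f u + g u) = gaussMean A f + gaussMean A g := by
  unfold gaussMean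
  simp only [add_mul]
  rw [integral_add hf hg, mul_add]

namespace SlowlyDiverging

variable {L : ℕ → ℝ} {hL : SlowlyDiverging L} {r : ℝ}

theorem HasExpansion.inv_eval {φ : RatFunc ℚ} (hφ : φ ≠ 0) :
    HasExpansion hL r (fun n ↦ (φ.eval (algebraMap ℚ ℝ) (L n))⁻¹) (Polynomial.C φ⁻¹) := by
  refine (HasExpansion.eval φ⁻¹).congr' ?_
  have h := map_mul hL.ratFuncGerm φ φ⁻¹
  rw [mul_inv_cancel₀ hφ, map_one] at h
  filter_upwards [Germ.coe_eq.mp h] with n hn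
  exact (inv_eq_of_mul_eq_one_right hn.symm).symm

theorem HasExpansion.inv_self : HasExpansion hL r (fun n ↦ (L n)⁻¹) (Polynomial.C RatFunc.X⁻¹) :=
  (HasExpansion.inv_eval RatFunc.X_ne_zero).congr' (.of_eq (by ext; simp))

theorem HasExpansion.sum {ι : Type*} {t : Finset ι} {F : ι → ℕ → ℝ}
    {p : ι → Polynomial (RatFunc ℚ)} (h : ∀ i ∈ t, HasExpansion hL r (F i) (p i)) :
    HasExpansion hL r (∑ i ∈ t, F i) (∑ i ∈ t, p i) := by
  classical
  induction t using Finset.induction_on with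
  | empty => exact HasExpansion.of_isOrderAtMost IsOrderAtMost.zero
  | insert a s ha ih =>
    rw [Finset.sum_insert ha, Finset.sum_insert ha]
    exact (h a (Finset.mem_insert_self a s)).add
      (ih fun i hi ↦ h i (Finset.mem_insert_of_mem hi))

variable (hL r) in
/-- Polynomials in `u` and `n * u ^ 2` whose coefficients have expansions. -/
inductive IsGaussPoly : (ℕ → ℝ → ℝ) → Prop
  | monomial {e : ℕ → ℝ} {p : Polynomial (RatFunc ℚ)} (he : HasExpansion hL r e p) (a b : ℕ) :
      IsGaussPoly fun n u ↦ e n * (u ^ a * (n * u ^ 2) ^ b)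
  | add {f g : ℕ → ℝ → ℝ} : IsGaussPoly f → IsGaussPoly g → IsGaussPoly fun n u ↦ f n u + g n u

namespace IsGaussPoly

theorem mul (hr : 0 ≤ r) {f g : ℕ → ℝ → ℝ} (hf : IsGaussPoly hL r f) (hg : IsGaussPoly hL r g) :
    IsGaussPoly hL r fun n u ↦ f n u * g n u := by
  induction hf with
  | monomial he a b =>
    induction hg with
    | monomial he' a' b' =>
      convert monomial (he.mul hr he') (a + a') (b + b') using 3
      simp only [Pi.mul_apply]
      ring
    | add _ _ ih1 ih2 =>
      simp only [mul_add]
      exact ih1.add ih2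
  | add _ _ ih1 ih2 =>
    simp only [add_mul]
    exact ih1.add ih2

theorem const {e : ℕ → ℝ} {p : Polynomial (RatFunc ℚ)} (he : HasExpansion hL r e p) :
    IsGaussPoly hL r fun n _ ↦ e n := by
  simpa using monomial he 0 0

theorem pow (hr : 0 ≤ r) {f : ℕ → ℝ → ℝ} (hf : IsGaussPoly hL r f) (k : ℕ) :
    IsGaussPoly hL r fun n u ↦ f n u ^ k := by
  induction k with
  | zero => simpa using const (HasExpansion.const (hL := hL) 1)
  | succ k ih =>
    simp only [pow_succ]
    exact ih.mul hr hf

theorem sum {ι : Type*} {t : Finset ι} {F : ι → ℕ → ℝ → ℝ}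
    (h : ∀ i ∈ t, IsGaussPoly hL r (F i)) : IsGaussPoly hL r fun n u ↦ ∑ i ∈ t, F i n u := by
  classical
  induction t using Finset.induction_on with
  | empty => simpa using const (HasExpansion.const (hL := hL) 0)
  | insert a s ha ih =>
    simp only [Finset.sum_insert ha]
    exact (h a (Finset.mem_insert_self a s)).add
      (ih fun i hi ↦ h i (Finset.mem_insert_of_mem hi))

theorem integrable {f : ℕ → ℝ → ℝ} (hf : IsGaussPoly hL r f) {A : ℝ} (hA : 0 < A) (n : ℕ) :
    Integrable fun u ↦ f n u * Real.exp (-A * u ^ 2 / 2) := by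
  induction hf with
  | @monomial e p he a b =>
    refine ((integrable_pow_mul_gauss hA (a + 2 * b)).const_mul (e n * (n : ℝ) ^ b)).congr
      (.of_forall fun u ↦ ?_)
    simp only
    ring
  | add _ _ ih1 ih2 =>
    simp only [add_mul]
    exact ih1.add ih2

/-- Odd moments vanish. For a = 2k the moment is a constant times (n/A)^b (n⁻¹ · n/A)^k, so an
expansion of n/A suffices and no positive power of n occurs. -/
theorem exists_hasExpansion_gaussMean (hr : 0 ≤ r) {f : ℕ → ℝ → ℝ} (hf : IsGaussPoly hL r f)
    {A : ℕ → ℝ} (hA : ∀ᶠ n in atTop, 0 < A n) {w : Polynomial (RatFunc ℚ)}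
    (hw : HasExpansion hL r (fun n ↦ n * (A n)⁻¹) w) :
    ∃ p, HasExpansion hL r (fun n ↦ gaussMean (A n) (f n)) p := by
  induction hf with
  | @monomial e p he a b =>
    rcases a.even_or_odd' with ⟨k, rfl | rfl⟩
    · refine ⟨_, (((he.mul hr (HasExpansion.const (hL := hL) (r := r)
        ((2 * (k + b) - 1 : ℕ).doubleFactorial : ℚ))).mul hr (hw.pow hr b)).mul hr
        (((HasExpansion.inv_natCast (hL := hL)).mul hr hw).pow hr k)).congr' ?_⟩
      filter_upwards [hA, eventually_ge_atTop 1] with n hn hn1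
      have hn0 : (n : ℝ) ≠ 0 := by exact_mod_cast (by omega : n ≠ 0)
      have h : (fun u : ℝ ↦ e n * (u ^ (2 * k) * (n * u ^ 2) ^ b)) =
          fun u ↦ (e n * n ^ b) * u ^ (2 * (k + b)) := by
        ext u
        ring
      rw [h, gaussMean_const_mul, gaussMean_pow_even hn]
      simp only [Pi.mul_apply, Pi.pow_apply, Rat.cast_natCast]
      rw [← mul_assoc (n : ℝ)⁻¹, inv_mul_cancel₀ hn0]
      ring
    · refine ⟨0, (HasExpansion.of_isOrderAtMost IsOrderAtMost.zero).congr' (.of_eq ?_)⟩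
      ext n
      have h : (fun u : ℝ ↦ e n * (u ^ (2 * k + 1) * (n * u ^ 2) ^ b)) =
          fun u ↦ (e n * n ^ b) * u ^ (2 * (k + b) + 1) := by
        ext u
        ring
      simp only
      rw [h, gaussMean_const_mul, gaussMean_pow_odd _ (odd_two_mul_add_one _), mul_zero]
      rfl
  | @add f g hf hg ih1 ih2 =>
    obtain ⟨p1, h1⟩ := ih1
    obtain ⟨p2, h2⟩ := ih2
    refine ⟨p1 + p2, (h1.add h2).congr' ?_⟩
    filter_upwards [hA] with n hn
    rw [gaussMean_add (hf.integrable hn n) (hg.integrable hn n)]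
    rfl

end IsGaussPoly

end SlowlyDiverging

/-- The Taylor polynomial, without its quadratic term, of the phase at the saddle point. -/
noncomputable def phasePoly (c : ℝ) (J : ℕ) (t y u : ℝ) : ℝ :=
  u + ∑ j ∈ Finset.Ico 3 J,
    (t * ((-1) ^ (j + 1) / (j * y ^ j)) - (t / y - c) / (j.factorial : ℝ)) * u ^ j

/-- The Taylor polynomial of the exponential function. -/
noncomputable def expPoly (I : ℕ) (x : ℝ) : ℝ :=
  ∑ i ∈ Finset.range I, x ^ i / (i.factorial : ℝ)

/-- The curvature of the phase at the saddle point. -/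
noncomputable def curvature (c t y : ℝ) : ℝ :=
  t / y + t / y ^ 2 - c

theorem RatFunc.X_add_two_ne_zero : (RatFunc.X + 2 : RatFunc ℚ) ≠ 0 := by
  have h : (RatFunc.X + 2 : RatFunc ℚ) = algebraMap (Polynomial ℚ) _ (Polynomial.X + Polynomial.C 2) := by
    simp [RatFunc.algebraMap_X]
  rw [h]
  exact RatFunc.algebraMap_ne_zero (Polynomial.X_add_C_ne_zero 2)

namespace SlowlyDiverging

variable {L : ℕ → ℝ} {hL : SlowlyDiverging L} {r : ℝ}

/-- The coefficient of u^j is n times a polynomial in 1/L plus the constant c/j!. Since j ≥ 3, the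
first part can be written with u^(j-2) (n u²). -/
theorem isGaussPoly_phasePoly (hr : 0 ≤ r) (c : ℚ) (J : ℕ) :
    IsGaussPoly hL r fun n u ↦ phasePoly c J n (L n / 2) u := by
  unfold phasePoly
  refine IsGaussPoly.add ?_ (IsGaussPoly.sum fun j hj ↦ ?_)
  · simpa using IsGaussPoly.monomial (HasExpansion.const (hL := hL) (r := r) 1) 1 0
  · rw [Finset.mem_Ico] at hj
    obtain ⟨i, rfl⟩ : ∃ i, j = i + 3 := ⟨j - 3, by omega⟩
    have e1 := (((HasExpansion.const (hL := hL) (r := r) ((-1) ^ (i + 4) / (i + 3) * 2 ^ (i + 3))).mul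
      hr (HasExpansion.inv_self.pow hr (i + 3))).add
      ((HasExpansion.const (-2 / ((i + 3).factorial : ℚ))).mul hr HasExpansion.inv_self))
    have e2 := HasExpansion.const (hL := hL) (r := r) (c / ((i + 3).factorial : ℚ))
    convert (IsGaussPoly.monomial e1 (i + 1) 1).add (IsGaussPoly.monomial e2 (i + 3) 0) using 3
    simp only [Pi.add_apply, Pi.mul_apply, Pi.pow_apply]
    push_cast
    rw [div_pow, inv_pow]
    generalize ((i + 3).factorial : ℝ) = F
    simp only [div_eq_mul_inv, mul_inv, inv_inv]
    ring

theorem isGaussPoly_expPoly_phasePoly (hr : 0 ≤ r) (c : ℚ) (I J : ℕ) :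
    IsGaussPoly hL r fun n u ↦ expPoly I (phasePoly c J n (L n / 2) u) := by
  unfold expPoly
  refine IsGaussPoly.sum fun i _ ↦ ?_
  convert ((isGaussPoly_phasePoly hr c J).pow hr i).mul hr (IsGaussPoly.const
    (HasExpansion.const (hL := hL) ((i.factorial : ℚ)⁻¹))) using 3
  push_cast
  rfl

/-- With y = L/2 this is n/A for c = 0, namely 1 / (1/y + 1/y²). -/
theorem hasExpansion_self_div :
    HasExpansion hL r (fun n ↦ L n ^ 2 / (2 * (L n + 2)))
      (Polynomial.C (RatFunc.X ^ 2 / (2 * (RatFunc.X + 2)))) := by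
  have hX : hL.ratFuncGerm RatFunc.X = (L : Germ atTop ℝ) := by
    refine Germ.coe_eq.mpr (.of_eq ?_)
    ext
    simp
  have h : hL.ratFuncGerm (RatFunc.X ^ 2 / (2 * (RatFunc.X + 2))) *
      ((fun n ↦ 2 * (L n + 2) : ℕ → ℝ) : Germ atTop ℝ) = ((fun n ↦ L n ^ 2 : ℕ → ℝ) : Germ atTop ℝ) := by
    have e1 : ((fun n ↦ 2 * (L n + 2) : ℕ → ℝ) : Germ atTop ℝ) =
        hL.ratFuncGerm (2 * (RatFunc.X + 2)) := by
      rw [map_mul, map_add, hX, map_ofNat]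
      rfl
    have e2 : ((fun n ↦ L n ^ 2 : ℕ → ℝ) : Germ atTop ℝ) = hL.ratFuncGerm (RatFunc.X ^ 2) := by
      rw [map_pow, hX]
      rfl
    rw [e1, e2, ← map_mul, div_mul_cancel₀]
    exact mul_ne_zero two_ne_zero RatFunc.X_add_two_ne_zero
  refine (HasExpansion.eval _).congr' ?_
  filter_upwards [Germ.coe_eq.mp h, hL.tendsto.eventually_gt_atTop 0] with n hn h0
  rw [eq_div_iff (by positivity)]
  exact hn

/-- With v = L²/(2(L+2)) the curvature is A = n/v - c, so n/A = v / (1 - c v / n) is a geometric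
series in c v / n, cut after the power K. -/
theorem exists_hasExpansion_inv_curvature (c : ℚ) (K : ℕ) :
    ∃ w, HasExpansion hL K (fun n ↦ n * (curvature c n (L n / 2))⁻¹) w ∧
      w.coeff 0 = RatFunc.X ^ 2 / (2 * (RatFunc.X + 2)) := by
  have hK : (0 : ℝ) ≤ K := K.cast_nonneg
  set v : ℕ → ℝ := fun n ↦ L n ^ 2 / (2 * (L n + 2)) with hv
  have hve : HasExpansion hL K v _ := hasExpansion_self_div
  set t : ℕ → ℝ := (fun _ ↦ (c : ℝ)) * v * fun n : ℕ ↦ (n : ℝ)⁻¹ with ht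
  have hte := ((HasExpansion.const (hL := hL) (r := K) c).mul hK hve).mul hK HasExpansion.inv_natCast
  have ht1 : IsOrderAtMost 1 t := by
    have := (((HasExpansion.const (hL := hL) (r := K) c).mul hK hve).isOrderAtMost hK).mul
      IsOrderAtMost.inv_natCast
    rwa [zero_add] at this
  have hlim : Tendsto t atTop (𝓝 0) := by
    refine (ht1 (1 / 2) (by norm_num)).trans_tendsto ?_
    rw [show -(1 : ℝ) + 1 / 2 = -(1 / 2) by norm_num]
    exact (tendsto_rpow_neg_atTop (by positivity)).comp tendsto_natCast_atTop_atTop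
  have hinv : IsOrderAtMost 0 fun n ↦ (1 - t n)⁻¹ := by
    have h1 : Tendsto (fun n ↦ (1 - t n)⁻¹) atTop (𝓝 (1 - 0)⁻¹) :=
      (tendsto_const_nhds.sub hlim).inv₀ (by norm_num)
    exact .of_isBigO_one (h1.isBigO_one ℝ)
  have hsum := hve.mul hK (HasExpansion.sum (t := Finset.range (K + 1)) fun m _ ↦ hte.pow hK m)
  refine ⟨_, hsum.of_sub ?_, ?_⟩
  · have h2 := ((hve.isOrderAtMost hK).mul (ht1.pow (K + 1))).mul hinv
    refine (h2.mono (by push_cast; linarith)).congr' ?_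
    filter_upwards [hL.tendsto.eventually_gt_atTop 0, eventually_ge_atTop 1,
      hlim.eventually_lt_const one_pos] with n h0 hn htn
    have hn0 : (n : ℝ) ≠ 0 := by exact_mod_cast (by omega : n ≠ 0)
    have hgeom : (∑ m ∈ Finset.range (K + 1), t n ^ m) = (1 - t n ^ (K + 1)) * (1 - t n)⁻¹ := by
      rw [eq_mul_inv_iff_mul_eq₀ (by linarith), mul_comm]
      exact mul_neg_geom_sum _ _
    have hA : (n : ℝ) * (curvature c n (L n / 2))⁻¹ = v n * (1 - t n)⁻¹ := by
      have e : (1 - t n) * n = curvature c n (L n / 2) * v n := by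
        simp only [ht, hv, Pi.mul_apply, curvature]
        field_simp
      have hv0 : v n ≠ 0 := by
        simp only [hv]
        positivity
      have ht0 : 1 - t n ≠ 0 := by linarith
      have hc0 : curvature c n (L n / 2) ≠ 0 := by
        intro h
        rw [h, zero_mul] at e
        exact mul_ne_zero ht0 hn0 e
      field_simp
      linear_combination e
    simp only [Pi.sub_apply, Finset.sum_apply, Pi.mul_apply v, Pi.mul_apply (v * _), Pi.pow_apply]
    rw [hA, hgeom]
    ring
  · simp [Polynomial.coeff_zero_eq_eval_zero, Polynomial.eval_finsetSum, Finset.sum_range_succ']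

end SlowlyDiverging

end

/-! ### The first coefficient. -/

section

open Filter Topology Asymptotics DirichletAsymptotics MeasureTheory

theorem integrable_sum_pow_mul_gauss {A : ℝ} (hA : 0 < A) (e : ℕ → ℝ) (m : ℕ → ℕ) (M : ℕ) :
    Integrable fun u : ℝ ↦ (∑ k ∈ Finset.range M, e k * u ^ m k) * Real.exp (-A * u ^ 2 / 2) := by
  simp only [Finset.sum_mul, mul_assoc]
  exact integrable_finsetSum _ fun k _ ↦ (integrable_pow_mul_gauss hA (m k)).const_mul (e k)

theorem gaussMean_sum_even {A : ℝ} (hA : 0 < A) (e : ℕ → ℝ) (M : ℕ) :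
    gaussMean A (fun u ↦ ∑ k ∈ Finset.range M, e k * u ^ (2 * k)) =
      ∑ k ∈ Finset.range M, e k * ((2 * k - 1 : ℕ).doubleFactorial * A⁻¹ ^ k) := by
  induction M with
  | zero => simp [gaussMean]
  | succ M ih =>
    simp only [Finset.sum_range_succ]
    rw [gaussMean_add (integrable_sum_pow_mul_gauss hA e _ M), ih, gaussMean_const_mul,
      gaussMean_pow_even hA]
    simp only [mul_assoc]
    exact (integrable_pow_mul_gauss hA (2 * M)).const_mul (e M)

/-- Only even powers of u in 1 + P + P²/2 count, with P = u + h3 u³ + h4 u⁴ and moments 1, 1, 3, 15,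
105. As h3, h4 and A are of order n up to powers of L, the last summand is of order n^(-2). -/
theorem gaussMean_expPoly_phasePoly {A : ℝ} (hA : 0 < A) (c t y : ℝ) {h3 h4 : ℝ}
    (e3 : h3 = t / (3 * y ^ 3) - (t / y - c) / 6) (e4 : h4 = -t / (4 * y ^ 4) - (t / y - c) / 24) :
    gaussMean A (fun u ↦ expPoly 3 (phasePoly c 5 t y u)) =
      1 + A⁻¹ / 2 + 3 * (h3 + h4) * A⁻¹ ^ 2 + 15 / 2 * h3 ^ 2 * A⁻¹ ^ 3 +
        105 / 2 * h4 ^ 2 * A⁻¹ ^ 4 := by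
  have hP : ∀ u, phasePoly c 5 t y u = u + h3 * u ^ 3 + h4 * u ^ 4 := by
    intro u
    rw [phasePoly, show Finset.Ico 3 5 = {3, 4} by rfl, Finset.sum_pair (by norm_num), e3, e4]
    norm_num [Nat.factorial]
    ring
  set e : ℕ → ℝ := fun k ↦ ([1, 1 / 2, h3 + h4, h3 ^ 2 / 2, h4 ^ 2 / 2] : List ℝ).getD k 0 with he
  set o : ℕ → ℝ := fun k ↦ ([1, h3, h4, h3 * h4] : List ℝ).getD k 0 with ho
  have hsplit : (fun u ↦ expPoly 3 (phasePoly c 5 t y u)) = fun u ↦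
      (∑ k ∈ Finset.range 5, e k * u ^ (2 * k)) + ∑ k ∈ Finset.range 4, o k * u ^ (2 * k + 1) := by
    ext u
    rw [hP]
    simp [expPoly, Finset.sum_range_succ, he, ho, Nat.factorial]
    ring
  rw [hsplit, gaussMean_add (integrable_sum_pow_mul_gauss hA e _ 5)
    (integrable_sum_pow_mul_gauss hA o _ 4), gaussMean_sum_even hA, gaussMean_of_odd]
  · simp [Finset.sum_range_succ, he, Nat.doubleFactorial]
    ring
  · intro u
    rw [← Finset.sum_neg_distrib]
    refine Finset.sum_congr rfl fun k _ ↦ ?_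
    rw [(odd_two_mul_add_one k).neg_pow]
    ring

namespace SlowlyDiverging

variable {L : ℕ → ℝ} {hL : SlowlyDiverging L}

theorem eventually_curvature_pos (hL : SlowlyDiverging L) (c : ℚ) :
    ∀ᶠ n : ℕ in atTop, 0 < curvature c n (L n / 2) := by
  have h := (hL.pow 1) (1 / 2) (by norm_num)
  simp only [pow_one, neg_zero, zero_add] at h
  obtain ⟨C, hC⟩ := h.bound
  have hlim : Tendsto (fun n : ℕ ↦ (n : ℝ) ^ (1 / 2 : ℝ)) atTop atTop :=
    (tendsto_rpow_atTop (by norm_num)).comp tendsto_natCast_atTop_atTop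
  filter_upwards [hC, hL.tendsto.eventually_gt_atTop 0, eventually_ge_atTop 1,
    hlim.eventually_ge_atTop (|C| * |(c : ℝ)|)] with n h1 h0 hn h2
  have hn0 : (0 : ℝ) < n := by exact_mod_cast hn
  set s := (n : ℝ) ^ (1 / 2 : ℝ) with hs
  have hs0 : 0 < s := by positivity
  have hss : s * s = n := by
    rw [hs, ← Real.rpow_add hn0]
    norm_num
  rw [Real.norm_of_nonneg h0.le, Real.norm_of_nonneg hs0.le] at h1
  have h3 : (c : ℝ) * (L n / 2) < n := by
    have e1 : (c : ℝ) * L n ≤ |(c : ℝ)| * (|C| * s) :=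
      mul_le_mul (le_abs_self _) (h1.trans (mul_le_mul_of_nonneg_right (le_abs_self C) hs0.le)) h0.le
        (abs_nonneg _)
    nlinarith
  have h4 : (c : ℝ) < n / (L n / 2) := by rwa [lt_div_iff₀ (by positivity)]
  have h5 : 0 < (n : ℝ) / (L n / 2) ^ 2 := by positivity
  unfold curvature
  linarith

theorem hasExpansion_gaussMean_sub_one (c : ℚ) :
    HasExpansion hL 1 (fun n ↦ n * (gaussMean (curvature c n (L n / 2))
        (fun u ↦ expPoly 3 (phasePoly c 5 n (L n / 2) u)) - 1))
      (Polynomial.C ((RatFunc.X ^ 4 + 9 * RatFunc.X ^ 3 + 32 * RatFunc.X ^ 2 + 24 * RatFunc.X + 16) /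
          (24 * (RatFunc.X + 2) ^ 3))) := by
  have h1 : (0 : ℝ) ≤ 1 := zero_le_one
  obtain ⟨w, hw, hw0⟩ := exists_hasExpansion_inv_curvature (hL := hL) c 1
  rw [Nat.cast_one] at hw
  have hw' := hw.isOrderAtMost_sub_truncation (K := 1) (by simp)
  rw [Nat.cast_one] at hw'
  have hwe : HasExpansion hL 1 (fun n ↦ n * (curvature c n (L n / 2))⁻¹)
      (Polynomial.C (RatFunc.X ^ 2 / (2 * (RatFunc.X + 2)))) := by
    refine (HasExpansion.eval _).of_sub (hw'.congr' (.of_eq ?_))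
    simp [hw0]
  -- At precision 1 a multiple of 1/n counts as 0. All occurrences of c disappear through this.
  have hx (a : ℚ) : HasExpansion hL 1 (fun n : ℕ ↦ (a : ℝ) * (n : ℝ)⁻¹) 0 := by
    refine .of_isOrderAtMost ?_
    simpa [Pi.mul_def] using ((HasExpansion.const (hL := hL) (r := 1) a).isOrderAtMost h1).mul
      IsOrderAtMost.inv_natCast
  have hi := HasExpansion.inv_self (hL := hL) (r := 1)
  have hc (a : ℚ) := HasExpansion.const (hL := hL) (r := 1) a
  -- `k3` and `k4` expand h3/n and h4/n at y = L/2.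
  have k3 := (((hc (8 / 3)).mul h1 (hi.pow h1 3)).add ((hc (-1 / 3)).mul h1 hi)).add (hx (c / 6))
  have k4 := (((hc (-4)).mul h1 (hi.pow h1 4)).add ((hc (-1 / 12)).mul h1 hi)).add (hx (c / 24))
  have key := ((((hc (1 / 2)).mul h1 hwe).add (((hc 3).mul h1 (k3.add k4)).mul h1 (hwe.pow h1 2))).add
    (((hc (15 / 2)).mul h1 (k3.pow h1 2)).mul h1 (hwe.pow h1 3))).add
    (((k4.pow h1 2).mul h1 (hwe.pow h1 4)).mul h1 (hx (105 / 2)))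
  convert key.congr' ?_ using 1
  · have hX : (RatFunc.X : RatFunc ℚ) ≠ 0 := RatFunc.X_ne_zero
    have hX2 := RatFunc.X_add_two_ne_zero
    simp only [add_zero, mul_zero, ← Polynomial.C_mul, ← Polynomial.C_add, ← Polynomial.C_pow]
    congr 1
    have e (a : ℚ) : (RatFunc.C a : RatFunc ℚ) = (a : RatFunc ℚ) := by simp
    simp only [e]
    push_cast
    field_simp
    ring
  · filter_upwards [hL.eventually_curvature_pos c, hL.tendsto.eventually_gt_atTop 0,
      eventually_ge_atTop 1] with n hA h0 hn
    have hn0 : (n : ℝ) ≠ 0 := by exact_mod_cast (by omega : n ≠ 0)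
    rw [gaussMean_expPoly_phasePoly hA c n (L n / 2) rfl rfl]
    simp only [Pi.add_apply, Pi.mul_apply, Pi.pow_apply]
    generalize curvature c n (L n / 2) = A at *
    have e3 : (n : ℝ) / (3 * (L n / 2) ^ 3) - (n / (L n / 2) - c) / 6 =
        n * (8 / 3 * (L n)⁻¹ ^ 3 - 1 / 3 * (L n)⁻¹ + c / 6 * (n : ℝ)⁻¹) := by
      field_simp
      ring
    have e4 : -(n : ℝ) / (4 * (L n / 2) ^ 4) - (n / (L n / 2) - c) / 24 =
        n * (-4 * (L n)⁻¹ ^ 4 - 1 / 12 * (L n)⁻¹ + c / 24 * (n : ℝ)⁻¹) := by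
      field_simp
      ring
    rw [e3, e4]
    push_cast
    field_simp
    ring

end SlowlyDiverging

end

/-! ### Estimates for the phase near and away from the saddle. -/

section

open Filter Topology Asymptotics DirichletAsymptotics MeasureTheory

/-- The logarithm of the integrand, relative to its value at the saddle point. -/
noncomputable def phase (c t y u : ℝ) : ℝ :=
  t * (Real.log (1 + u / y) - u / y) - (t / y - c) * (Real.exp u - 1 - u) + u

theorem Real.log_one_sub_le {w : ℝ} (h0 : 0 ≤ w) (h1 : w < 1) :
    Real.log (1 - w) ≤ -w - w ^ 2 / 2 := by
  have h := Real.hasSum_pow_div_log_of_abs_lt_one (x := w) (by rwa [abs_of_nonneg h0])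
  have h2 := sum_le_hasSum (Finset.range 2) (fun i _ ↦ by positivity) h
  norm_num [Finset.sum_range_succ] at h2
  linarith

/-- To the right of the saddle the exponential term gives the decay, where 2 c y ≤ t ensures t/y - c
≥ t/(2y); to the left the logarithm does. The term -|u| is kept for integrability. -/
theorem phase_le_of_le_abs {c t y η u : ℝ} (hy : 1 ≤ y) (hc : 0 < c) (hcy : 2 * c * y ≤ t)
    (hη : 0 < η) (hη' : 16 * y ≤ t * η) (hu : -y < u) (hηu : η ≤ |u|) :
    phase c t y u ≤ -(t * η ^ 2 / (8 * y ^ 2)) - |u| := by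
  have hy0 : 0 < y := by linarith
  have ht : 0 < t := by nlinarith
  have hD : t / (2 * y) ≤ t / y - c := by
    have e : t / y = t / (2 * y) + t / (2 * y) := by field_simp; ring
    have : c ≤ t / (2 * y) := by rw [le_div_iff₀ (by positivity)]; linarith
    linarith
  have hD0 : 0 < t / (2 * y) := by positivity
  rcases le_or_gt 0 u with h0 | h0
  · rw [abs_of_nonneg h0] at hηu ⊢
    have h1 : Real.log (1 + u / y) - u / y ≤ 0 := by
      have : 0 ≤ u / y := by positivity
      have := Real.log_le_sub_one_of_pos (show 0 < 1 + u / y by positivity)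
      linarith
    have h2 : u ^ 2 / 2 ≤ Real.exp u - 1 - u := by
      linarith [Real.quadratic_le_exp_of_nonneg h0]
    have h3 : t / (2 * y) * (u ^ 2 / 2) ≤ (t / y - c) * (Real.exp u - 1 - u) :=
      mul_le_mul hD h2 (by positivity) (by linarith)
    have h4 : t * (Real.log (1 + u / y) - u / y) ≤ 0 := mul_nonpos_of_nonneg_of_nonpos ht.le h1
    -- One half pays for 2u, that is the linear term of the phase and the extra -|u|; the other half
    -- gives the Gaussian gain.
    have e : t / (2 * y) * (u ^ 2 / 2) = t * u ^ 2 / (8 * y) + t * u ^ 2 / (8 * y) := by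
      field_simp; ring
    have h5 : 2 * u ≤ t * u ^ 2 / (8 * y) := by
      rw [le_div_iff₀ (by positivity)]
      nlinarith [mul_le_mul_of_nonneg_left hηu ht.le]
    have h6 : t * η ^ 2 / (8 * y ^ 2) ≤ t * u ^ 2 / (8 * y) := by
      have h7 : η ^ 2 ≤ u ^ 2 := pow_le_pow_left₀ hη.le hηu 2
      apply div_le_div₀ (by positivity) (by gcongr) (by positivity)
      nlinarith
    unfold phase
    linarith
  · rw [abs_of_neg h0] at hηu ⊢
    have h1 : Real.log (1 + u / y) - u / y ≤ -(u / y) ^ 2 / 2 := by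
      have := Real.log_one_sub_le (w := -u / y) (by have : 0 < -u := by linarith
                                                    positivity)
        (by rw [div_lt_one hy0]; linarith)
      rw [neg_div, sub_neg_eq_add] at this
      nlinarith
    have h2 : 0 ≤ Real.exp u - 1 - u := by linarith [Real.add_one_le_exp u]
    have h3 : 0 ≤ (t / y - c) * (Real.exp u - 1 - u) := mul_nonneg (by linarith) h2
    have h4 := mul_le_mul_of_nonneg_left h1 ht.le
    have h5 : t * η ^ 2 / (8 * y ^ 2) ≤ t * ((u / y) ^ 2 / 2) := by
      rw [div_pow, div_div, mul_div_assoc']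
      have h7 : η ^ 2 ≤ u ^ 2 := by
        rw [← neg_sq u]
        exact pow_le_pow_left₀ hη.le hηu 2
      apply div_le_div₀ (by positivity) (by gcongr) (by positivity)
      nlinarith
    unfold phase
    linarith

/-- The Taylor remainders of the logarithm and of the exponential contribute at most 2 t η^J each; y
≥ 2 keeps |u/y| ≤ 1/2. -/
theorem abs_phase_sub_phasePoly_le {c t y η u : ℝ} (hy : 2 ≤ y) (hc : 0 < c) (hcy : 2 * c * y ≤ t)
    (hη : η ≤ 1) (hu : |u| ≤ η) {J : ℕ} (hJ : 3 ≤ J) :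
    |phase c t y u + curvature c t y * u ^ 2 / 2 - phasePoly c J t y u| ≤ 4 * t * η ^ J := by
  have hy0 : 0 < y := by linarith
  have ht : 0 < t := by nlinarith
  have hη0 : 0 ≤ η := (abs_nonneg u).trans hu
  have hD0 : 0 ≤ t / y - c := by
    rw [sub_nonneg, le_div_iff₀ hy0]; nlinarith
  have hD1 : t / y - c ≤ t := by
    have : t / y ≤ t := div_le_self ht.le (by linarith)
    linarith
  have hIco (f : ℕ → ℝ) : ∑ j ∈ Finset.range J, f j = f 0 + f 1 + f 2 + ∑ j ∈ Finset.Ico 3 J, f j := by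
    rw [Finset.range_eq_Ico, ← Finset.sum_Ico_consecutive _ (Nat.zero_le 3) hJ]
    simp [Finset.sum_range_succ]
  have hw : |u / y| ≤ 1 / 2 := by
    rw [abs_div, abs_of_pos hy0, div_le_iff₀ hy0]
    linarith
  have hlog : |Real.log (1 + u / y) - u / y + (u / y) ^ 2 / 2 -
      ∑ j ∈ Finset.Ico 3 J, (-1) ^ (j + 1) / (j * y ^ j) * u ^ j| ≤ 2 * η ^ J := by
    have h := Real.abs_log_sub_add_sum_range_le (x := -(u / y)) (by rw [abs_neg]; linarith) (J - 1)
    rw [show J - 1 + 1 = J by omega, abs_neg, sub_neg_eq_add] at h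
    -- The added term j = 0 is 1/0, which is 0 by convention.
    have e : (∑ i ∈ Finset.range (J - 1), (-(u / y)) ^ (i + 1) / ((i : ℝ) + 1)) =
        ∑ j ∈ Finset.range J, (-(u / y)) ^ j / (j : ℝ) := by
      conv_rhs => rw [show J = J - 1 + 1 by omega, Finset.sum_range_succ']
      simp
    rw [e, hIco] at h
    have e2 : Real.log (1 + u / y) - u / y + (u / y) ^ 2 / 2 -
        ∑ j ∈ Finset.Ico 3 J, (-1) ^ (j + 1) / (j * y ^ j) * u ^ j =
        (-(u / y)) ^ 0 / ((0 : ℕ) : ℝ) + (-(u / y)) ^ 1 / ((1 : ℕ) : ℝ) +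
          (-(u / y)) ^ 2 / ((2 : ℕ) : ℝ) + ∑ j ∈ Finset.Ico 3 J, (-(u / y)) ^ j / (j : ℝ) +
          Real.log (1 + u / y) := by
      have : ∑ j ∈ Finset.Ico 3 J, (-(u / y)) ^ j / (j : ℝ) =
          -∑ j ∈ Finset.Ico 3 J, (-1) ^ (j + 1) / (j * y ^ j) * u ^ j := by
        rw [← Finset.sum_neg_distrib]
        refine Finset.sum_congr rfl fun j _ ↦ ?_
        rw [neg_pow, div_pow, pow_succ]
        field_simp
      rw [this]
      push_cast
      ring
    rw [e2]
    refine h.trans ?_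
    rw [div_le_iff₀ (by linarith)]
    have h1 : |u / y| ≤ η := by
      rw [abs_div, abs_of_pos hy0]
      exact (div_le_self (abs_nonneg u) (by linarith)).trans hu
    have h2 : |u / y| ^ J ≤ η ^ J := by gcongr
    have h3 : 0 ≤ η ^ J := by positivity
    nlinarith
  have hexp : |Real.exp u - 1 - u - u ^ 2 / 2 - ∑ j ∈ Finset.Ico 3 J, u ^ j / (j.factorial : ℝ)| ≤
      2 * η ^ J := by
    have h := Real.exp_bound (hu.trans hη) (n := J) (by omega)
    rw [hIco] at h
    norm_num [Nat.factorial] at h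
    rw [show Real.exp u - 1 - u - u ^ 2 / 2 - ∑ j ∈ Finset.Ico 3 J, u ^ j / (j.factorial : ℝ) =
      Real.exp u - (1 + u + u ^ 2 / 2 + ∑ j ∈ Finset.Ico 3 J, u ^ j / (j.factorial : ℝ)) by ring]
    refine h.trans ?_
    rw [mul_comm]
    refine mul_le_mul ?_ (by gcongr) (by positivity) (by norm_num)
    have hJ' : (3 : ℝ) ≤ J := by exact_mod_cast hJ
    have hf : (1 : ℝ) ≤ J.factorial := by exact_mod_cast J.factorial_pos
    rw [div_le_iff₀ (by positivity)]
    nlinarith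
  have key : phase c t y u + curvature c t y * u ^ 2 / 2 - phasePoly c J t y u =
      t * (Real.log (1 + u / y) - u / y + (u / y) ^ 2 / 2 -
        ∑ j ∈ Finset.Ico 3 J, (-1) ^ (j + 1) / (j * y ^ j) * u ^ j) -
      (t / y - c) * (Real.exp u - 1 - u - u ^ 2 / 2 -
        ∑ j ∈ Finset.Ico 3 J, u ^ j / (j.factorial : ℝ)) := by
    have : (∑ j ∈ Finset.Ico 3 J,
        (t * ((-1) ^ (j + 1) / (j * y ^ j)) - (t / y - c) / (j.factorial : ℝ)) * u ^ j) =
        t * (∑ j ∈ Finset.Ico 3 J, (-1) ^ (j + 1) / (j * y ^ j) * u ^ j) -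
          (t / y - c) * ∑ j ∈ Finset.Ico 3 J, u ^ j / (j.factorial : ℝ) := by
      rw [Finset.mul_sum, Finset.mul_sum, ← Finset.sum_sub_distrib]
      refine Finset.sum_congr rfl fun j _ ↦ ?_
      ring
    unfold phase curvature phasePoly
    rw [this]
    ring
  rw [key]
  refine (abs_sub _ _).trans ?_
  rw [abs_mul, abs_mul, abs_of_pos ht, abs_of_nonneg hD0]
  have h1 := mul_le_mul_of_nonneg_left hlog ht.le
  have h2 := mul_le_mul hD1 hexp (abs_nonneg _) ht.le
  linarith

/-- The parameter s covers two regimes: η³ on the window, and (1 + |u|)^J on the tails. -/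
theorem abs_phasePoly_le {c t y u s : ℝ} (hy : 1 ≤ y) (hc : 0 < c) (hcy : 2 * c * y ≤ t) (J : ℕ)
    (hs : |u| ≤ t * s) (hs' : ∀ j ∈ Finset.Ico 3 J, |u| ^ j ≤ s) :
    |phasePoly c J t y u| ≤ (2 * J + 1) * (t * s) := by
  have hy0 : 0 < y := by linarith
  have ht : 0 < t := by nlinarith
  have hs0 : 0 ≤ s := by
    have := (abs_nonneg u).trans hs
    exact nonneg_of_mul_nonneg_right this ht
  have hD0 : 0 ≤ t / y - c := by
    rw [sub_nonneg, le_div_iff₀ hy0]; nlinarith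
  have hD1 : t / y - c ≤ t := by
    have : t / y ≤ t := div_le_self ht.le (by linarith)
    linarith
  have hterm : ∀ j ∈ Finset.Ico 3 J,
      |(t * ((-1) ^ (j + 1) / (j * y ^ j)) - (t / y - c) / (j.factorial : ℝ)) * u ^ j| ≤
        2 * (t * s) := by
    intro j hj
    have hj3 : 3 ≤ j := (Finset.mem_Ico.mp hj).1
    rw [abs_mul, abs_pow]
    have h1 : |t * ((-1) ^ (j + 1) / (j * y ^ j))| ≤ t := by
      rw [abs_mul, abs_of_pos ht, abs_div, abs_pow, abs_neg, abs_one, one_pow]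
      refine mul_le_of_le_one_right ht.le ?_
      have h2 : (1 : ℝ) ≤ j := by exact_mod_cast (by omega : 1 ≤ j)
      have h3 : 1 ≤ y ^ j := one_le_pow₀ hy
      rw [abs_of_pos (by positivity)]
      exact div_le_one_of_le₀ (by nlinarith) (by positivity)
    have h2 : |(t / y - c) / (j.factorial : ℝ)| ≤ t := by
      rw [abs_of_nonneg (by positivity)]
      exact (div_le_self hD0 (by exact_mod_cast j.factorial_pos)).trans hD1
    calc _ ≤ (2 * t) * s := mul_le_mul ((abs_sub _ _).trans (by linarith)) (hs' j hj) (by positivity)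
            (by positivity)
      _ = _ := by ring
  unfold phasePoly
  have h1 := (Finset.abs_sum_le_sum_abs _ _).trans (Finset.sum_le_sum hterm)
  rw [Finset.sum_const, Nat.card_Ico, nsmul_eq_mul] at h1
  have h2 : ((J - 3 : ℕ) : ℝ) * (2 * (t * s)) ≤ J * (2 * (t * s)) := by
    gcongr
    omega
  refine (abs_add_le _ _).trans ?_
  linarith

theorem abs_exp_sub_expPoly_le {T P : ℝ} (hTP : |T - P| ≤ 1) (hP : |P| ≤ 1) {I : ℕ} (hI : 0 < I) :
    |Real.exp T - expPoly I P| ≤ 6 * |T - P| + 2 * |P| ^ I := by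
  have h1 : |Real.exp T - Real.exp P| ≤ 6 * |T - P| := by
    have e : Real.exp T - Real.exp P = Real.exp P * (Real.exp (T - P) - 1) := by
      rw [mul_sub, ← Real.exp_add]
      ring_nf
    rw [e, abs_mul, abs_of_pos (Real.exp_pos P)]
    have h3 : Real.exp P ≤ 3 :=
      (Real.exp_le_exp.mpr ((le_abs_self P).trans hP)).trans (by linarith [Real.exp_one_lt_d9])
    have h4 := mul_le_mul h3 (Real.abs_exp_sub_one_le hTP) (abs_nonneg _) (by norm_num)
    linarith
  have h2 : |Real.exp P - expPoly I P| ≤ 2 * |P| ^ I := by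
    refine (Real.exp_bound hP hI).trans ?_
    rw [mul_comm]
    refine mul_le_mul_of_nonneg_right ?_ (by positivity)
    have hJ' : (1 : ℝ) ≤ I := by exact_mod_cast hI
    have hf : (1 : ℝ) ≤ I.factorial := by exact_mod_cast I.factorial_pos
    push_cast
    rw [div_le_iff₀ (by positivity)]
    nlinarith
  calc |Real.exp T - expPoly I P| = |(Real.exp T - Real.exp P) + (Real.exp P - expPoly I P)| := by
        ring_nf
    _ ≤ _ := (abs_add_le _ _).trans (add_le_add h1 h2)

theorem abs_expPoly_le {x Z : ℝ} (hx : |x| ≤ Z) (hZ : 1 ≤ Z) (I : ℕ) : |expPoly I x| ≤ I * Z ^ I := by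
  unfold expPoly
  refine (Finset.abs_sum_le_sum_abs _ _).trans ?_
  have h : ∀ i ∈ Finset.range I, |x ^ i / (i.factorial : ℝ)| ≤ Z ^ I := by
    intro i hi
    rw [abs_div, abs_pow, Nat.abs_cast]
    refine (div_le_self (by positivity) (by exact_mod_cast i.factorial_pos)).trans ?_
    exact (pow_le_pow_left₀ (abs_nonneg x) hx i).trans
      (pow_le_pow_right₀ hZ (Finset.mem_range.mp hi).le)
  refine (Finset.sum_le_sum h).trans (le_of_eq ?_)
  rw [Finset.sum_const, Finset.card_range, nsmul_eq_mul]

/-- (1 + |u|)^m ≤ m! e^(1+|u|), and 1 + |u| - u² ≤ 2 - |u| because (|u| - 1)² ≥ 0; then e² ≤ 9. -/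
theorem pow_one_add_abs_mul_exp_neg_sq_le (m : ℕ) (u : ℝ) :
    (1 + |u|) ^ m * Real.exp (-u ^ 2) ≤ 9 * m.factorial * Real.exp (-|u|) := by
  have h0 : 0 ≤ 1 + |u| := by positivity
  have h1 := Real.pow_div_factorial_le_exp (1 + |u|) h0 m
  rw [div_le_iff₀ (by positivity)] at h1
  have h2 : Real.exp (1 + |u|) * Real.exp (-u ^ 2) ≤ 9 * Real.exp (-|u|) := by
    have h3 : Real.exp 2 ≤ 9 := by
      have := Real.exp_one_lt_d9
      have e : Real.exp 2 = Real.exp 1 * Real.exp 1 := by rw [← Real.exp_add]; norm_num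
      rw [e]
      nlinarith [Real.exp_pos 1]
    rw [← Real.exp_add]
    refine le_trans (Real.exp_le_exp.mpr (?_ : _ ≤ 2 + -|u|)) ?_
    · nlinarith [sq_nonneg (|u| - 1), sq_abs u]
    · rw [Real.exp_add]
      gcongr
  calc _ ≤ Real.exp (1 + |u|) * m.factorial * Real.exp (-u ^ 2) := by gcongr
    _ = m.factorial * (Real.exp (1 + |u|) * Real.exp (-u ^ 2)) := by ring
    _ ≤ m.factorial * (9 * Real.exp (-|u|)) := by gcongr
    _ = _ := by ring

end

/-! ### Laplace's method with explicit error terms. -/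

section

open Filter Topology Asymptotics DirichletAsymptotics MeasureTheory

theorem integral_exp_neg_abs_eq_two : ∫ u : ℝ, Real.exp (-|u|) = 2 := by
  rw [integral_comp_abs (f := fun u ↦ Real.exp (-u)), integral_exp_neg_Ioi_zero, mul_one]

theorem integrable_exp_neg_abs : Integrable fun u : ℝ ↦ Real.exp (-|u|) :=
  .of_integral_ne_zero (by rw [integral_exp_neg_abs_eq_two]; norm_num)

/-- The saddle equation gives q e^y = t/y - c. All first-order terms cancel except u, because y is
critical for the exponent with -c u and not (1 - c) u. -/
theorem phase_eq {q c t y u : ℝ} (hy : 0 < y) (hsad : t = y * (q * Real.exp y + c)) :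
    t * Real.log (1 + u / y) + (1 - c) * u - q * Real.exp y * (Real.exp u - 1) = phase c t y u := by
  have h : q * Real.exp y = t / y - c := by
    rw [hsad]
    field_simp
    ring
  unfold phase
  rw [h]
  field_simp
  ring

theorem rpow_mul_exp_eq_mul_exp_phase {q c y u : ℝ} {n : ℕ} (hy : 0 < y)
    (hsad : (n : ℝ) = y * (q * Real.exp y + c)) (hu : 0 < y + u) :
    (y + u) ^ n * (Real.exp ((1 - c) * (y + u)) * Real.exp (-(q * Real.exp (y + u)))) =
      y ^ n * Real.exp (-(q * Real.exp y) + (1 - c) * y) * Real.exp (phase c n y u) := by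
  have h1 : 0 < 1 + u / y := by
    rw [show 1 + u / y = (y + u) / y by field_simp]
    positivity
  have h2 : y + u = y * (1 + u / y) := by field_simp
  have h3 : (1 + u / y) ^ n = Real.exp (n * Real.log (1 + u / y)) := by
    rw [mul_comm, Real.exp_mul, Real.exp_log h1, Real.rpow_natCast]
  rw [← phase_eq hy hsad]
  conv_lhs => enter [1]; rw [h2, mul_pow, h3]
  simp only [mul_assoc, ← Real.exp_add]
  rw [Real.exp_add y u]
  ring_nf

section

variable {q c C y η : ℝ} {n I J : ℕ} {θ : ℝ → ℝ}

/-- R stands for θ(e^v) exp(q e^v), which is close to 1. With the Gaussian factored out and T =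
phase + A u²/2, the difference is e^T (R - 1) + (e^T - expPoly P), and both T and P are bounded on
the window. -/
theorem abs_integrand_sub_le_inner (hc : 0 < c) (hC : 0 ≤ C) (hy : 2 ≤ y)
    (hsad : (n : ℝ) = y * (q * Real.exp y + c)) (hcy : 2 * c * y ≤ n) (hη1 : η ≤ 1)
    (hη2 : 1 ≤ n * η ^ 2) (hI : 0 < I) (hJ : 3 ≤ J) (hP : (2 * J + 1) * (n * η ^ 3) ≤ 1)
    (hTP : 4 * n * η ^ J ≤ 1) {u R : ℝ} (hu : |u| ≤ η)
    (hR : |R - 1| ≤ C * Real.exp (-(3 * q * Real.exp (y + u)))) :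
    |Real.exp (phase c n y u) * R - expPoly I (phasePoly c J n y u) *
        Real.exp (-curvature c n y * u ^ 2 / 2)| ≤
      (9 * C * Real.exp (-(n * η ^ 2 / (8 * y ^ 2))) + 24 * (n * η ^ J) +
        2 * ((2 * J + 1) * (n * η ^ 3)) ^ I) * Real.exp (-curvature c n y * u ^ 2 / 2) := by
  have hy0 : 0 < y := by linarith
  have hη0 : 0 ≤ η := (abs_nonneg u).trans hu
  have hn0 : (0 : ℝ) < n := by nlinarith
  set T := phase c n y u + curvature c n y * u ^ 2 / 2 with hT
  set P := phasePoly c J n y u with hPdef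
  have h1 : |T - P| ≤ 4 * n * η ^ J := abs_phase_sub_phasePoly_le hy hc hcy hη1 hu hJ
  have h2 : |P| ≤ (2 * J + 1) * (n * η ^ 3) := by
    refine abs_phasePoly_le (by linarith) hc hcy J ?_ ?_
    · refine hu.trans ?_
      nlinarith [mul_le_mul_of_nonneg_left hη2 hη0]
    · intro j hj
      exact (pow_le_pow_left₀ (abs_nonneg u) hu j).trans
        (pow_le_pow_of_le_one hη0 hη1 (Finset.mem_Ico.mp hj).1)
  have h3 := abs_exp_sub_expPoly_le (h1.trans hTP) (h2.trans hP) hI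
  have hT2 : T ≤ 2 := by
    have e1 := (abs_le.mp (h1.trans hTP)).2
    have e2 := (abs_le.mp (h2.trans hP)).2
    linarith
  have hexpT : Real.exp T ≤ 9 := by
    have := Real.exp_one_lt_d9
    have e : Real.exp 2 = Real.exp 1 * Real.exp 1 := by rw [← Real.exp_add]; norm_num
    refine (Real.exp_le_exp.mpr hT2).trans ?_
    rw [e]
    nlinarith [Real.exp_pos 1]
  -- q e^y ≥ n/(2y) and e^u ≥ 1/3 make 3 q e^(y+u) at least n/(2y), more than the exponent required.
  have hR' : |R - 1| ≤ C * Real.exp (-(n * η ^ 2 / (8 * y ^ 2))) := by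
    refine hR.trans (mul_le_mul_of_nonneg_left (Real.exp_le_exp.mpr (neg_le_neg ?_)) hC)
    have e1 : q * Real.exp y = n / y - c := by
      rw [hsad]
      field_simp
      ring
    have e2 : (n : ℝ) / (2 * y) ≤ q * Real.exp y := by
      have e : (n : ℝ) / y = n / (2 * y) + n / (2 * y) := by field_simp; ring
      have : c ≤ n / (2 * y) := by rw [le_div_iff₀ (by positivity)]; linarith
      linarith
    have e3 : Real.exp (-1) ≤ Real.exp u :=
      Real.exp_le_exp.mpr (by linarith [(abs_le.mp (hu.trans hη1)).1])
    have e4 : 1 / 3 ≤ Real.exp (-1) := by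
      rw [Real.exp_neg, one_div]
      exact inv_anti₀ (Real.exp_pos 1) (by linarith [Real.exp_one_lt_d9])
    have e5 : (n : ℝ) / (2 * y) * (1 / 3) ≤ q * Real.exp y * Real.exp u :=
      mul_le_mul e2 (e4.trans e3) (by norm_num) (le_trans (by positivity) e2)
    have e6 : (n : ℝ) * η ^ 2 / (8 * y ^ 2) ≤ n / (2 * y) := by
      apply div_le_div₀ hn0.le _ (by positivity) (by nlinarith)
      exact mul_le_of_le_one_right hn0.le (pow_le_one₀ hη0 hη1)
    rw [Real.exp_add]
    nlinarith
  have key : Real.exp (phase c n y u) * R - expPoly I P * Real.exp (-curvature c n y * u ^ 2 / 2) =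
      (Real.exp T * (R - 1) + (Real.exp T - expPoly I P)) *
        Real.exp (-curvature c n y * u ^ 2 / 2) := by
    have : Real.exp (phase c n y u) = Real.exp T * Real.exp (-curvature c n y * u ^ 2 / 2) := by
      rw [← Real.exp_add, hT]
      ring_nf
    rw [this]
    ring
  rw [key, abs_mul, abs_of_pos (Real.exp_pos (-curvature c n y * u ^ 2 / 2))]
  refine mul_le_mul_of_nonneg_right ?_ (Real.exp_pos _).le
  have h4 : |Real.exp T * (R - 1)| ≤ 9 * (C * Real.exp (-(n * η ^ 2 / (8 * y ^ 2)))) := by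
    rw [abs_mul, abs_of_pos (Real.exp_pos T)]
    exact mul_le_mul hexpT hR' (abs_nonneg _) (by norm_num)
  have h5 : |P| ^ I ≤ ((2 * J + 1) * (n * η ^ 3)) ^ I := pow_le_pow_left₀ (abs_nonneg P) h2 I
  refine (abs_add_le _ _).trans ?_
  linarith

/-- A ≥ n/y² ≥ 4, so a quarter of A u²/2 gives the factor exp(-n η²/(8y²)), and the rest is at least
u², which beats the polynomial growth. -/
theorem abs_gauss_tail_le (hc : 0 < c) (hy : 2 ≤ y) (hcy : 2 * c * y ≤ n) (hη0 : 0 < η)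
    (hny : 4 * y ^ 2 ≤ n) (hJ : 3 ≤ J) {u : ℝ} (hu : η ≤ |u|) :
    |expPoly I (phasePoly c J n y u) * Real.exp (-curvature c n y * u ^ 2 / 2)| ≤
      I * ((2 * J + 1) * n) ^ I * (9 * (J * I).factorial) *
        Real.exp (-(n * η ^ 2 / (8 * y ^ 2))) * Real.exp (-|u|) := by
  have hy0 : 0 < y := by linarith
  have hn1 : (1 : ℝ) ≤ n := by nlinarith
  have hn0 : (0 : ℝ) < n := by linarith
  have h1u : (1 : ℝ) ≤ 1 + |u| := by linarith [abs_nonneg u]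
  have hP : |phasePoly c J n y u| ≤ (2 * J + 1) * (n * (1 + |u|) ^ J) := by
    refine abs_phasePoly_le (by linarith) hc hcy J ?_ ?_
    · have e1 : 1 + |u| ≤ (1 + |u|) ^ J := le_self_pow₀ h1u (by omega)
      nlinarith
    · intro j hj
      refine (pow_le_pow_left₀ (abs_nonneg u) (by linarith : |u| ≤ 1 + |u|) j).trans ?_
      exact pow_le_pow_right₀ h1u (Finset.mem_Ico.mp hj).2.le
  have hZ : 1 ≤ (2 * J + 1) * (n * (1 + |u|) ^ J) := by
    have e1 : 1 ≤ (1 + |u|) ^ J := one_le_pow₀ h1u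
    have e2 : (1 : ℝ) ≤ 2 * J + 1 := by
      have : (0 : ℝ) ≤ J := J.cast_nonneg
      linarith
    exact one_le_mul_of_one_le_of_one_le e2 (one_le_mul_of_one_le_of_one_le hn1 e1)
  have h1 := abs_expPoly_le hP hZ I
  have h2 : Real.exp (-curvature c n y * u ^ 2 / 2) ≤
      Real.exp (-(n * η ^ 2 / (8 * y ^ 2))) * Real.exp (-u ^ 2) := by
    rw [← Real.exp_add]
    refine Real.exp_le_exp.mpr ?_
    have hA : (n : ℝ) / y ^ 2 ≤ curvature c n y := by
      have : c ≤ n / y := by rw [le_div_iff₀ hy0]; nlinarith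
      unfold curvature
      linarith
    have e1 := mul_le_mul_of_nonneg_right hA (sq_nonneg u)
    have e2 : (4 : ℝ) ≤ n / y ^ 2 := by rwa [le_div_iff₀ (by positivity)]
    have e3 := mul_le_mul_of_nonneg_right e2 (sq_nonneg u)
    have e4 : (n : ℝ) * η ^ 2 / (8 * y ^ 2) ≤ n / y ^ 2 * u ^ 2 / 8 := by
      rw [← sq_abs u, show (n : ℝ) / y ^ 2 * |u| ^ 2 / 8 = n * |u| ^ 2 / (8 * y ^ 2) by
        field_simp]
      gcongr
    have e5 := sq_nonneg u
    linarith
  rw [abs_mul, abs_of_pos (Real.exp_pos (-curvature c n y * u ^ 2 / 2))]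
  calc _ ≤ I * ((2 * J + 1) * (n * (1 + |u|) ^ J)) ^ I *
        (Real.exp (-(n * η ^ 2 / (8 * y ^ 2))) * Real.exp (-u ^ 2)) :=
      mul_le_mul h1 h2 (by positivity) (by positivity)
    _ = I * ((2 * J + 1) * n) ^ I * Real.exp (-(n * η ^ 2 / (8 * y ^ 2))) *
        ((1 + |u|) ^ (J * I) * Real.exp (-u ^ 2)) := by
      rw [pow_mul, ← mul_assoc (2 * (J : ℝ) + 1), mul_pow _ ((1 + |u|) ^ J)]
      ring
    _ ≤ I * ((2 * J + 1) * n) ^ I * Real.exp (-(n * η ^ 2 / (8 * y ^ 2))) *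
        (9 * (J * I).factorial * Real.exp (-|u|)) :=
      mul_le_mul_of_nonneg_left (pow_one_add_abs_mul_exp_neg_sq_le _ _) (by positivity)
    _ = _ := by ring

/-- Both integrands are compared pointwise on the whole line, with error at most err times the
Gaussian plus M e^(-|u|). Integration turns the first into err, and the second costs 2 √(A/(2π)) ≤
2n. For v ≤ 0 the integrand is extended by 0, and there only the Gaussian tail is left. -/
theorem abs_laplace_sub_gaussMean_le (hq : 0 < q) (hc : 0 < c) (hC : 0 ≤ C) (hy : 2 ≤ y)
    (hθ : ContinuousOn θ (Set.Ioi 0))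
    (hθC : ∀ x ≥ 1, |θ x - Real.exp (-q * x)| ≤ C * Real.exp (-q * (4 * x)))
    (hsad : (n : ℝ) = y * (q * Real.exp y + c)) (hcy : 2 * c * y ≤ n) (hη0 : 0 < η) (hη1 : η ≤ 1)
    (hη2 : 1 ≤ n * η ^ 2) (hηy : 16 * y ≤ n * η) (hny : 4 * y ^ 2 ≤ n) (hI : 0 < I) (hJ : 3 ≤ J)
    (hP : (2 * J + 1) * (n * η ^ 3) ≤ 1) (hTP : 4 * n * η ^ J ≤ 1) :
    |√(curvature c n y / (2 * Real.pi)) *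
        ((∫ v in Set.Ioi (0 : ℝ), v ^ n * (Real.exp ((1 - c) * v) * θ (Real.exp v))) /
          (y ^ n * Real.exp (-(q * Real.exp y) + (1 - c) * y))) -
      gaussMean (curvature c n y) (fun u ↦ expPoly I (phasePoly c J n y u))| ≤
    9 * C * Real.exp (-(n * η ^ 2 / (8 * y ^ 2))) + 24 * (n * η ^ J) +
        2 * ((2 * J + 1) * (n * η ^ 3)) ^ I +
      2 * n * ((1 + C + I * ((2 * J + 1) * n) ^ I * (9 * (J * I).factorial)) *
        Real.exp (-(n * η ^ 2 / (8 * y ^ 2)))) := by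
  have hy0 : 0 < y := by linarith
  have hn1 : (1 : ℝ) ≤ n := by nlinarith
  have hn0 : (0 : ℝ) < n := by linarith
  set A := curvature c n y with hA
  set E := y ^ n * Real.exp (-(q * Real.exp y) + (1 - c) * y) with hE
  have hE0 : 0 < E := by positivity
  set τ := Real.exp (-(n * η ^ 2 / (8 * y ^ 2))) with hτ
  set err := 9 * C * τ + 24 * (n * η ^ J) + 2 * ((2 * J + 1) * (n * η ^ 3)) ^ I with herr
  set M := (1 + C + I * ((2 * J + 1) * n) ^ I * (9 * (J * I).factorial)) * τ with hM
  set F : ℝ → ℝ := (Set.Ioi (0 : ℝ)).indicator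
    (fun v ↦ v ^ n * (Real.exp ((1 - c) * v) * θ (Real.exp v))) with hF
  set S : ℝ → ℝ := fun u ↦ expPoly I (phasePoly c J n y u) * Real.exp (-A * u ^ 2 / 2) with hS
  have hA1 : (n : ℝ) / y ^ 2 ≤ A := by
    have : c ≤ n / y := by rw [le_div_iff₀ hy0]; nlinarith
    rw [hA, curvature]
    linarith
  have hA0 : 0 < A := lt_of_lt_of_le (by positivity) hA1
  have herr0 : 0 ≤ err := by positivity
  have hM0 : 0 ≤ M := by positivity
  have hFu (u : ℝ) (hu : -y < u) : F (y + u) / E =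
      Real.exp (phase c n y u) * (θ (Real.exp (y + u)) * Real.exp (q * Real.exp (y + u))) := by
    have h0 : 0 < y + u := by linarith
    have h := rpow_mul_exp_eq_mul_exp_phase (q := q) hy0 hsad h0
    rw [hF, Set.indicator_of_mem (Set.mem_Ioi.mpr h0), div_eq_iff hE0.ne']
    have e : Real.exp (-(q * Real.exp (y + u))) * Real.exp (q * Real.exp (y + u)) = 1 := by
      rw [← Real.exp_add, neg_add_cancel, Real.exp_zero]
    calc _ = (y + u) ^ n * (Real.exp ((1 - c) * (y + u)) * Real.exp (-(q * Real.exp (y + u)))) *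
          (θ (Real.exp (y + u)) * Real.exp (q * Real.exp (y + u))) := by
          linear_combination (-((y + u) ^ n * (Real.exp ((1 - c) * (y + u)) *
            θ (Real.exp (y + u))))) * e
      _ = _ := by rw [h]; ring
  have hR (u : ℝ) (hu : -y < u) :
      |θ (Real.exp (y + u)) * Real.exp (q * Real.exp (y + u)) - 1| ≤
        C * Real.exp (-(3 * q * Real.exp (y + u))) := by
    have h0 : 0 < y + u := by linarith
    have h := hθC (Real.exp (y + u)) (Real.one_le_exp h0.le)
    set x := Real.exp (y + u)
    have e : θ x * Real.exp (q * x) - 1 = (θ x - Real.exp (-q * x)) * Real.exp (q * x) := by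
      rw [sub_mul, ← Real.exp_add]
      simp
    rw [e, abs_mul, abs_of_pos (Real.exp_pos (q * x))]
    refine (mul_le_mul_of_nonneg_right h (Real.exp_pos _).le).trans (le_of_eq ?_)
    rw [mul_assoc, ← Real.exp_add]
    ring_nf
  have hτ0 : 0 < τ := Real.exp_pos _
  have hbound (u : ℝ) : |F (y + u) / E - S u| ≤
      err * Real.exp (-A * u ^ 2 / 2) + M * Real.exp (-|u|) := by
    have hnn1 : 0 ≤ err * Real.exp (-A * u ^ 2 / 2) := by positivity
    have hnn2 : 0 ≤ M * Real.exp (-|u|) := by positivity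
    rcases le_or_gt |u| η with hu | hu
    · have hu' : -y < u := by linarith [(abs_le.mp hu).1]
      rw [hFu u hu']
      have := abs_integrand_sub_le_inner hc hC hy hsad hcy hη1 hη2 hI hJ hP hTP hu (hR u hu')
      linarith
    · have hStail := abs_gauss_tail_le (I := I) hc hy hcy hη0 hny hJ hu.le
      have hFtail : |F (y + u) / E| ≤ (1 + C) * τ * Real.exp (-|u|) := by
        rcases lt_or_ge (-y) u with hu' | hu'
        · rw [hFu u hu', abs_mul, abs_of_pos (Real.exp_pos (phase c n y u))]
          have h1 := phase_le_of_le_abs (by linarith) hc hcy hη0 hηy hu' hu.le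
          have h2 : Real.exp (phase c n y u) ≤ τ * Real.exp (-|u|) := by
            rw [hτ, ← Real.exp_add]
            exact Real.exp_le_exp.mpr (by linarith)
          have h3 : |θ (Real.exp (y + u)) * Real.exp (q * Real.exp (y + u))| ≤ 1 + C := by
            have h4 := hR u hu'
            have h5 : Real.exp (-(3 * q * Real.exp (y + u))) ≤ 1 :=
              Real.exp_le_one_iff.mpr (neg_nonpos.mpr (by positivity))
            have h6 := h4.trans (mul_le_of_le_one_right hC h5)
            rw [abs_le] at h6 ⊢
            constructor <;> linarith
          calc _ ≤ (τ * Real.exp (-|u|)) * (1 + C) := mul_le_mul h2 h3 (abs_nonneg _) (by positivity)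
            _ = _ := by ring
        · rw [hF, Set.indicator_of_notMem (by simp; linarith), zero_div, abs_zero]
          positivity
      refine (abs_sub _ _).trans ?_
      have e : M * Real.exp (-|u|) = (1 + C) * τ * Real.exp (-|u|) +
          I * ((2 * J + 1) * n) ^ I * (9 * (J * I).factorial) * τ * Real.exp (-|u|) := by
        rw [hM]
        ring
      linarith
  have hSint : Integrable S := by
    refine (integrable_exp_neg_abs.const_mul
      (I * ((2 * J + 1) * n) ^ I * (9 * (J * I).factorial))).mono' ?_ ?_
    · refine Continuous.aestronglyMeasurable ?_
      simp only [hS, expPoly, phasePoly]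
      fun_prop
    · filter_upwards [Measure.ae_ne volume (0 : ℝ)] with u hu
      refine (abs_gauss_tail_le hc hy hcy (abs_pos.mpr hu) hny hJ le_rfl).trans ?_
      refine mul_le_mul_of_nonneg_right (mul_le_of_le_one_right (by positivity) ?_)
        (Real.exp_pos _).le
      exact Real.exp_le_one_iff.mpr (neg_nonpos.mpr (by positivity))
  have hgint : Integrable fun u ↦ Real.exp (-A * u ^ 2 / 2) := by
    simpa using integrable_pow_mul_gauss hA0 0
  have hΦint : Integrable fun u ↦ err * Real.exp (-A * u ^ 2 / 2) + M * Real.exp (-|u|) :=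
    (hgint.const_mul err).add (integrable_exp_neg_abs.const_mul M)
  have hFmeas : AEStronglyMeasurable F := by
    rw [hF, aestronglyMeasurable_indicator_iff measurableSet_Ioi]
    refine ContinuousOn.aestronglyMeasurable ?_ measurableSet_Ioi
    refine ContinuousOn.mul (by fun_prop) (ContinuousOn.mul (by fun_prop) ?_)
    exact hθ.comp (by fun_prop) fun x _ ↦ Real.exp_pos x
  have hFmeas' : AEStronglyMeasurable fun u ↦ F (y + u) / E := by
    have h : AEStronglyMeasurable fun u ↦ F (y + u) :=
      hFmeas.comp_measurePreserving (measurePreserving_add_left volume y)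
    simpa only [div_eq_mul_inv] using h.mul_const E⁻¹
  have hDint : Integrable fun u ↦ F (y + u) / E - S u :=
    hΦint.mono' (hFmeas'.sub hSint.aestronglyMeasurable) (Eventually.of_forall hbound)
  have hFint : Integrable fun u ↦ F (y + u) / E :=
    (hDint.add hSint).congr (Eventually.of_forall fun u ↦ sub_add_cancel _ _)
  have hint : (∫ v in Set.Ioi (0 : ℝ), v ^ n * (Real.exp ((1 - c) * v) * θ (Real.exp v))) / E =
      ∫ u, F (y + u) / E := by
    rw [integral_div, integral_add_left_eq_self F y, hF, integral_indicator measurableSet_Ioi]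
  have hgauss : √(A / (2 * Real.pi)) * ∫ u, Real.exp (-A * u ^ 2 / 2) = 1 := by
    have := gaussMean_pow_even hA0 0
    simpa [gaussMean] using this
  have hB : √(A / (2 * Real.pi)) ≤ n := by
    have hA2 : A ≤ 2 * n := by
      have e1 : (n : ℝ) / y ≤ n := div_le_self hn0.le (by linarith)
      have e2 : (n : ℝ) / y ^ 2 ≤ n := div_le_self hn0.le (by nlinarith)
      rw [hA, curvature]
      linarith
    rw [Real.sqrt_le_left hn0.le, div_le_iff₀ (by positivity)]
    nlinarith [Real.pi_gt_three, mul_le_mul hn1 hn1 zero_le_one hn0.le]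
  have hsub : √(A / (2 * Real.pi)) * (∫ u, F (y + u) / E) -
      gaussMean A (fun u ↦ expPoly I (phasePoly c J n y u)) =
      √(A / (2 * Real.pi)) * ∫ u, (F (y + u) / E - S u) := by
    rw [integral_sub hFint hSint, mul_sub]
    rfl
  rw [hint, hsub, abs_mul, abs_of_nonneg (Real.sqrt_nonneg _)]
  have hfin := norm_integral_le_of_norm_le (f := fun u ↦ F (y + u) / E - S u) hΦint (Eventually.of_forall hbound)
  rw [integral_add (hgint.const_mul err) (integrable_exp_neg_abs.const_mul M), integral_const_mul,
    integral_const_mul, integral_exp_neg_abs_eq_two, Real.norm_eq_abs] at hfin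
  calc _ ≤ √(A / (2 * Real.pi)) * (err * (∫ u, Real.exp (-A * u ^ 2 / 2)) + M * 2) := by gcongr
    _ = err * (√(A / (2 * Real.pi)) * ∫ u, Real.exp (-A * u ^ 2 / 2)) +
        2 * √(A / (2 * Real.pi)) * M := by ring
    _ ≤ err + 2 * n * M := by
      rw [hgauss, mul_one]
      gcongr

end

end

/-! ### From Laplace's method to a full asymptotic expansion. -/

section

open Filter Topology Asymptotics DirichletAsymptotics MeasureTheory

theorem IsOrderAtMost.tendsto_zero {r : ℝ} {f : ℕ → ℝ} (hf : IsOrderAtMost r f) (hr : 0 < r) :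
    Tendsto f atTop (𝓝 0) := by
  refine (hf (r / 2) (by positivity)).trans_tendsto ?_
  rw [show -r + r / 2 = -(r / 2) by ring]
  exact (tendsto_rpow_neg_atTop (by positivity)).comp tendsto_natCast_atTop_atTop

theorem IsOrderAtMost.eventually_le_one {r : ℝ} {f : ℕ → ℝ} (hf : IsOrderAtMost r f) (hr : 0 < r) :
    ∀ᶠ n in atTop, f n ≤ 1 :=
  (hf.tendsto_zero hr).eventually_le_const one_pos

theorem IsOrderAtMost.rpow (s : ℝ) : IsOrderAtMost (-s) fun n : ℕ ↦ (n : ℝ) ^ s :=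
  .of_isBigO (by rw [neg_neg])

theorem IsOrderAtMost.const_mul {r : ℝ} {f : ℕ → ℝ} (hf : IsOrderAtMost r f) (a : ℝ) :
    IsOrderAtMost r fun n ↦ a * f n :=
  fun δ hδ ↦ (hf δ hδ).const_mul_left a

theorem slowlyDiverging_of_isHalfSaddle {q c : ℝ} (hq : 0 < q) (hc : 0 < c) {L : ℕ → ℝ}
    (hL : ∀ n : ℕ, 1 ≤ n → IsHalfSaddle q c n (L n / 2)) : SlowlyDiverging L where
  tendsto := by
    exact ((tendsto_of_isHalfSaddle hq hc hL).const_mul_atTop two_pos).congr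
      fun n ↦ mul_div_cancel₀ _ two_ne_zero
  pow k := by
    intro δ hδ
    have h := (pow_isBigO_rpow_of_isHalfSaddle hq hc hL k hδ).const_mul_left (2 ^ k)
    refine h.congr (fun n ↦ ?_) fun n ↦ by rw [neg_zero, zero_add]
    rw [← mul_pow, mul_div_cancel₀ _ two_ne_zero, Pi.pow_apply]

namespace SlowlyDiverging

variable {L : ℕ → ℝ}

theorem half_pow (hL : SlowlyDiverging L) (k : ℕ) : IsOrderAtMost 0 fun n ↦ (L n / 2) ^ k := by
  refine ((hL.pow k).const_mul ((2 ^ k)⁻¹)).congr' (.of_eq ?_)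
  ext n
  rw [Pi.pow_apply, div_pow]
  ring

/-- With η = n^(-49/100) one has n η² = n^(2/100), while y² ≤ n^(1/100) eventually. The exponent is
then at most -n^(1/100)/8, which beats every power. -/
theorem isOrderAtMost_exp_neg (hL : SlowlyDiverging L) (r : ℝ) :
    IsOrderAtMost r fun n : ℕ ↦
      Real.exp (-(n * ((n : ℝ) ^ (-49 / 100 : ℝ)) ^ 2 / (8 * (L n / 2) ^ 2))) := by
  refine .of_isBigO ?_
  have hlim : Tendsto (fun n : ℕ ↦ (n : ℝ) ^ (1 / 100 : ℝ)) atTop atTop :=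
    (tendsto_rpow_atTop (by norm_num)).comp tendsto_natCast_atTop_atTop
  have h1 := ((isLittleO_exp_neg_mul_rpow_atTop (a := 1 / 8) (by norm_num)
    (-(100 * r))).comp_tendsto hlim).isBigO
  have h2 := ((hL.half_pow 2).mul (IsOrderAtMost.rpow (-(1 / 100)))).eventually_le_one (by norm_num)
  refine IsBigO.trans (IsBigO.of_bound 1 ?_) (h1.congr' EventuallyEq.rfl ?_)
  · filter_upwards [h2, eventually_ge_atTop 1, hL.tendsto.eventually_gt_atTop 0] with n hn hn1 h0
    have hn0 : (0 : ℝ) < n := by exact_mod_cast hn1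
    simp only [Function.comp, one_mul, Real.norm_eq_abs, Real.abs_exp]
    refine Real.exp_le_exp.mpr ?_
    have e1 : (n : ℝ) * ((n : ℝ) ^ (-49 / 100 : ℝ)) ^ 2 =
        (n : ℝ) ^ (1 / 100 : ℝ) * (n : ℝ) ^ (1 / 100 : ℝ) := by
      rw [← Real.rpow_natCast, ← Real.rpow_mul hn0.le, ← Real.rpow_add hn0]
      nth_rewrite 1 [← Real.rpow_one (n : ℝ)]
      rw [← Real.rpow_add hn0]
      norm_num
    rw [e1]
    simp only [Pi.mul_apply, Real.rpow_neg hn0.le] at hn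
    have hx : 0 < (n : ℝ) ^ (1 / 100 : ℝ) := by positivity
    rw [← div_eq_mul_inv, div_le_one hx] at hn
    rw [neg_mul, neg_le_neg_iff, le_div_iff₀ (by positivity)]
    nlinarith
  · filter_upwards [eventually_ge_atTop 1] with n hn1
    have hn0 : (0 : ℝ) < n := by exact_mod_cast hn1
    simp only [Function.comp]
    rw [← Real.rpow_mul hn0.le]
    congr 1
    ring

/-- The window is slightly wider than n^(-1/2), so the tails are negligible, and n η³ = n^(-47/100)
is still small. The two exponents come from n η^J and (n η³)^I. -/
theorem isOrderAtMost_laplace_sub_gaussMean {q : ℝ} {c : ℚ} (hq : 0 < q) (hc : 0 < c)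
    (hsad : ∀ n : ℕ, 1 ≤ n → IsHalfSaddle q c n (L n / 2)) (hL : SlowlyDiverging L)
    {θ : ℝ → ℝ} {C : ℝ} (hθ : ContinuousOn θ (Set.Ioi 0))
    (hθC : ∀ x ≥ 1, |θ x - Real.exp (-q * x)| ≤ C * Real.exp (-q * (4 * x))) {I J : ℕ}
    (hI : 0 < I) (hJ : 3 ≤ J) :
    IsOrderAtMost (min (49 / 100 * J - 1) (47 / 100 * I)) fun n : ℕ ↦
      √(curvature c n (L n / 2) / (2 * Real.pi)) *
        ((∫ v in Set.Ioi (0 : ℝ), v ^ n * (Real.exp ((1 - c) * v) * θ (Real.exp v))) /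
          ((L n / 2) ^ n * Real.exp (-(q * Real.exp (L n / 2)) + (1 - c) * (L n / 2)))) -
      gaussMean (curvature c n (L n / 2)) (fun u ↦ expPoly I (phasePoly c J n (L n / 2) u)) := by
  have hc' : (0 : ℝ) < c := by exact_mod_cast hc
  have hJ' : (3 : ℝ) ≤ J := by exact_mod_cast hJ
  have hC : 0 ≤ C := by
    have h := (abs_nonneg _).trans (hθC 1 le_rfl)
    exact nonneg_of_mul_nonneg_left h (Real.exp_pos _)
  set η : ℕ → ℝ := fun n ↦ (n : ℝ) ^ (-49 / 100 : ℝ) with hη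
  have hrη (k : ℕ) : IsOrderAtMost (49 / 100 * k - 1) fun n : ℕ ↦ n * η n ^ k := by
    refine .of_isBigO (IsBigO.of_bound 1 ?_)
    filter_upwards [eventually_ge_atTop 1] with n hn1
    have hn0 : (0 : ℝ) < n := by exact_mod_cast hn1
    rw [one_mul]
    refine le_of_eq (congrArg _ ?_)
    simp only [hη]
    rw [← Real.rpow_natCast, ← Real.rpow_mul hn0.le]
    nth_rewrite 1 [← Real.rpow_one (n : ℝ)]
    rw [← Real.rpow_add hn0]
    congr 1
    ring
  have ho3 := (hrη 3).const_mul (2 * J + 1)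
  have hoJ := hrη J
  have hexp (r : ℝ) := hL.isOrderAtMost_exp_neg r
  set τ : ℕ → ℝ := fun n ↦ Real.exp (-(n * η n ^ 2 / (8 * (L n / 2) ^ 2))) with hτ
  have hn : IsOrderAtMost (-1) fun n : ℕ ↦ (n : ℝ) := by simpa using IsOrderAtMost.rpow 1
  set D : ℝ := I * (2 * J + 1) ^ I * (9 * (J * I).factorial) with hD
  set r := min (49 / 100 * (J : ℝ) - 1) (47 / 100 * I) with hr
  have hbig : IsOrderAtMost r fun n : ℕ ↦ 9 * C * τ n + 24 * (n * η n ^ J) +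
      2 * ((2 * J + 1) * (n * η n ^ 3)) ^ I +
      2 * n * ((1 + C + I * ((2 * J + 1) * n) ^ I * (9 * (J * I).factorial)) * τ n) := by
    have e1 := (hexp r).const_mul (9 * C)
    have e2 := (hoJ.const_mul 24).mono (min_le_left _ (47 / 100 * (I : ℝ)))
    have e3 := ((ho3.pow I).const_mul 2).mono (s := r) (by
      refine (min_le_right _ _).trans (le_of_eq ?_)
      push_cast
      ring)
    have e4 := (hn.mul (hexp (r + 1))).const_mul (2 * (1 + C))
    have e5 := ((hn.pow (I + 1)).mul (hexp (r + (I + 1)))).const_mul (2 * D)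
    have e4' := e4.mono (s := r) (by linarith)
    have e5' := e5.mono (s := r) (by push_cast; linarith)
    refine ((((e1.add e2).add e3).add e4').add e5').congr' (.of_eq ?_)
    ext n
    simp only [Pi.add_apply, Pi.mul_apply, Pi.pow_apply, hD]
    rw [mul_pow (2 * (J : ℝ) + 1) (n : ℝ) I]
    ring
  have hlow (a : ℝ) (ha : 0 ≤ a) (k : ℕ) (s : ℝ) (hs : s < 0) :
      ∀ᶠ n : ℕ in atTop, a * (L n / 2) ^ k * (n : ℝ) ^ s ≤ 1 := by
    have h := (((hL.half_pow k).const_mul a).mul (IsOrderAtMost.rpow s)).eventually_le_one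
      (by linarith)
    simpa using h
  intro δ hδ
  refine IsBigO.trans (IsBigO.of_bound 1 ?_) (hbig δ hδ)
  filter_upwards [eventually_ge_atTop 1, hL.tendsto.eventually_ge_atTop 4,
    hlow (2 * c) (by positivity) 1 (-1) (by norm_num),
    hlow 16 (by norm_num) 1 (-51 / 100) (by norm_num),
    hlow 4 (by norm_num) 2 (-1) (by norm_num), ho3.eventually_le_one (by norm_num),
    (hoJ.const_mul 4).eventually_le_one (by linarith)] with n hn1 hL4 h1 h2 h3 h4 h5
  have hn0 : (0 : ℝ) < n := by exact_mod_cast hn1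
  have hn1' : (1 : ℝ) ≤ n := by exact_mod_cast hn1
  rw [Real.rpow_neg_one, ← div_eq_mul_inv, div_le_one hn0] at h1 h3
  have hη0 : 0 < η n := by positivity
  have h6 : n * η n = (n : ℝ) ^ (51 / 100 : ℝ) := by
    simp only [hη]
    nth_rewrite 1 [← Real.rpow_one (n : ℝ)]
    rw [← Real.rpow_add hn0]
    norm_num
  have h7 : 16 * (L n / 2) ≤ n * η n := by
    rw [h6]
    rw [neg_div, Real.rpow_neg hn0.le, ← div_eq_mul_inv, div_le_one (by positivity), pow_one] at h2
    exact h2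
  have h8 : 1 ≤ n * η n ^ 2 := by
    rw [pow_two, ← mul_assoc, h6]
    simp only [hη]
    rw [← Real.rpow_add hn0]
    exact Real.one_le_rpow hn1' (by norm_num)
  rw [pow_one] at h1
  have h9 := abs_laplace_sub_gaussMean_le hq hc' hC (by linarith : 2 ≤ L n / 2) hθ hθC
    (hsad n hn1).2 h1 hη0 (Real.rpow_le_one_of_one_le_of_nonpos hn1' (by norm_num)) h8 h7 h3 hI hJ
    h4 (by linarith)
  rw [one_mul, Real.norm_eq_abs]
  exact h9.trans (le_abs_self _)

theorem exists_truncation_laplace {q : ℝ} {c : ℚ} (hq : 0 < q) (hc : 0 < c)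
    (hsad : ∀ n : ℕ, 1 ≤ n → IsHalfSaddle q c n (L n / 2))
    {θ : ℝ → ℝ} {C : ℝ} (hθ : ContinuousOn θ (Set.Ioi 0))
    (hθC : ∀ x ≥ 1, |θ x - Real.exp (-q * x)| ≤ C * Real.exp (-q * (4 * x))) :
    ∃ b : ℕ → RatFunc ℚ,
      b 1 = (RatFunc.X ^ 4 + 9 * RatFunc.X ^ 3 + 32 * RatFunc.X ^ 2 + 24 * RatFunc.X + 16) /
          (24 * (RatFunc.X + 2) ^ 3) ∧
      ∀ K : ℕ, IsOrderAtMost (K + 1) fun n : ℕ ↦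
        √(curvature c n (L n / 2) / (2 * Real.pi)) *
        ((∫ v in Set.Ioi (0 : ℝ), v ^ n * (Real.exp ((1 - c) * v) * θ (Real.exp v))) /
          ((L n / 2) ^ n * Real.exp (-(q * Real.exp (L n / 2)) + (1 - c) * (L n / 2)))) -
        truncation b K n (L n) := by
  have hL := slowlyDiverging_of_isHalfSaddle hq (by exact_mod_cast hc : (0 : ℝ) < c) hsad
  have hmain {I J : ℕ} (hI : 0 < I) (hJ : 3 ≤ J) :=
    hL.isOrderAtMost_laplace_sub_gaussMean hq hc hsad hθ hθC hI hJ
  set H : ℕ → ℝ := fun n ↦ √(curvature c n (L n / 2) / (2 * Real.pi)) *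
        ((∫ v in Set.Ioi (0 : ℝ), v ^ n * (Real.exp ((1 - c) * v) * θ (Real.exp v))) /
          ((L n / 2) ^ n * Real.exp (-(q * Real.exp (L n / 2)) + (1 - c) * (L n / 2)))) with hH
  have hex (K : ℕ) : ∃ p, HasExpansion hL ((K + 1 : ℕ) : ℝ) H p := by
    have hK : (0 : ℝ) ≤ ((K + 1 : ℕ) : ℝ) := Nat.cast_nonneg _
    obtain ⟨w, hw, -⟩ := exists_hasExpansion_inv_curvature (hL := hL) c (K + 1)
    -- I = J = 3K + 5 suffices: 0.49 (3K + 5) - 1 and 0.47 (3K + 5) are both at least K + 1.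
    obtain ⟨p, hp⟩ := (isGaussPoly_expPoly_phasePoly (hL := hL) hK c (3 * K + 5)
      (3 * K + 5)).exists_hasExpansion_gaussMean hK (hL.eventually_curvature_pos c) hw
    refine ⟨p, hp.of_sub ((hmain (I := 3 * K + 5) (J := 3 * K + 5) (by omega) (by omega)).mono ?_)⟩
    have hK' : (0 : ℝ) ≤ K := K.cast_nonneg
    push_cast
    rw [le_min_iff]
    constructor <;> linarith
  choose p hp using hex
  set b1 : RatFunc ℚ := (RatFunc.X ^ 4 + 9 * RatFunc.X ^ 3 + 32 * RatFunc.X ^ 2 +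
    24 * RatFunc.X + 16) / (24 * (RatFunc.X + 2) ^ 3) with hb1
  -- I = 3 and J = 5 give min(1.45, 1.41) = 1.41 > 1, enough to determine the coefficients 0 and 1.
  have hfirst : HasExpansion hL (141 / 100) H (Polynomial.C 1 + Polynomial.C b1 * Polynomial.X) := by
    have h0 : (0 : ℝ) ≤ 141 / 100 := by norm_num
    have h1 := (hL.hasExpansion_gaussMean_sub_one c).isOrderAtMost_sub_truncation (K := 1) (by simp)
    rw [← hb1] at h1
    have h2 := h1.mul IsOrderAtMost.inv_natCast
    have h3 : IsOrderAtMost _ fun n ↦ H n - _ := hmain (I := 3) (J := 5) (by norm_num) (by norm_num)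
    refine ((HasExpansion.eval 1).add
      ((HasExpansion.eval b1).mul h0 HasExpansion.inv_natCast)).of_sub ?_
    refine ((h2.mono (s := 141 / 100) (by norm_num)).add
      (h3.mono (s := 141 / 100) (by norm_num))).congr' ?_
    filter_upwards [eventually_ge_atTop 1] with n hn1
    have hn0 : (n : ℝ) ≠ 0 := by exact_mod_cast (by omega : n ≠ 0)
    simp only [Pi.add_apply, Pi.mul_apply, Pi.sub_apply, Finset.sum_range_one, Polynomial.coeff_C_zero,
      pow_zero, mul_one, RatFunc.eval_one]
    generalize H n = x
    field_simp
    ring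
  -- `p k` is valid to order k + 1 and so determines coefficient k; by uniqueness every `p K` with K
  -- ≥ k has the same one.
  refine ⟨fun k ↦ (p k).coeff k, ?_, fun K ↦ ?_⟩
  · have := (hp 1).coeff_eq hfirst (k := 1) (by norm_num) (by norm_num)
    simpa [Polynomial.coeff_one] using this
  · have h := (hp K).isOrderAtMost_sub_truncation le_rfl
    rw [Nat.cast_succ] at h
    refine h.congr' (.of_eq ?_)
    ext n
    rw [Pi.sub_apply, Finset.sum_apply, truncation, Finset.sum_range_succ', add_comm]
    congr 2
    · have := (hp K).coeff_eq hfirst (k := 0) (by exact_mod_cast K.succ_pos) (by norm_num)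
      rw [this]
      simp
    · rw [Finset.range_eq_Ico, Finset.sum_Ico_add' (fun k ↦ ((p K).coeff k).eval (algebraMap ℚ ℝ) (L n) *
        (n : ℝ)⁻¹ ^ k) 0 K 1]
      refine Finset.sum_congr (by rfl) fun k hk ↦ ?_
      have hk' : k ≤ K := (Finset.mem_Icc.mp hk).2
      rw [(hp K).coeff_eq (hp k) (k := k) (by exact_mod_cast (by omega))
        (by exact_mod_cast (by omega)), inv_pow, div_eq_mul_inv]

end SlowlyDiverging

end

/-! ### Assembly: the main term and the two derivative expansions. -/

section

open Filter Topology Asymptotics DirichletAsymptotics MeasureTheory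

theorem parity_le_one {N : ℕ} (χ : DirichletCharacter ℂ N) : parity χ ≤ 1 := by
  unfold parity
  split_ifs <;> simp

theorem apply_neg_one_eq_pow_parity {N : ℕ} {χ : DirichletCharacter ℂ N} {X : DirichletCharacter ℤ N}
    (hχ : χ = X.ringHomComp (Int.castRingHom ℂ)) : X (-1) = (-1) ^ parity χ := by
  have h1 : χ (-1) = ((X (-1) : ℤ) : ℂ) := by rw [hχ]; rfl
  have h2 : X (-1) * X (-1) = 1 := by rw [← map_mul]; simp
  unfold parity
  split_ifs with h
  · have h3 : χ (-1) = 1 := h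
    rw [h1] at h3
    rw [pow_zero]
    exact_mod_cast h3
  · rcases mul_self_eq_one_iff.mp h2 with h3 | h3
    · refine absurd ?_ h
      change χ (-1) = 1
      rw [h1, h3, Int.cast_one]
    · rw [h3, pow_one]

theorem DirichletCharacter.IsPrimitive.ne_one {N : ℕ} [NeZero N] (hN : 1 < N)
    {χ : DirichletCharacter ℂ N} (hprim : χ.IsPrimitive) : χ ≠ 1 := by
  rintro rfl
  rw [DirichletCharacter.isPrimitive_def, DirichletCharacter.conductor_one] at hprim
  omega

theorem iteratedDeriv_Xi {N : ℕ} [NeZero N] (hN : 1 < N) {χ : DirichletCharacter ℂ N} (hχ : χ ≠ 1)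
    (n : ℕ) : iteratedDeriv n (Xi χ) 0 = (-Complex.I) ^ n * iteratedDeriv n (completedL χ) (1 / 2) := by
  have h1 : Xi χ = fun z ↦ (fun w ↦ completedL χ (1 / 2 + w)) (-Complex.I * z) := by
    ext z
    rw [Xi, if_neg hχ]
    congr 1
    ring
  have h2 : ContDiff ℂ n fun w ↦ completedL χ (1 / 2 + w) :=
    ((differentiable_completedL hN hχ).comp (differentiable_id.const_add _)).contDiff
  rw [h1, iteratedDeriv_comp_const_mul h2, iteratedDeriv_comp_const_add]
  simp only [mul_zero, add_zero]

/-- The radicand in `mainTerm` is ℓ² A, whose root uses up one power of ℓ. Of 2^(2n), one 2^n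
belongs to (ℓ/2)^n and the other to the Mellin variable s/2. The power of N cancels the term log(N²)
in the exponent, and the saddle equation replaces q e^(ℓ/2) by 2n/ℓ - c. -/
theorem mainTerm_eq {N ν n : ℕ} (hN : 0 < N) {l : ℝ}
    (hsad : IsHalfSaddle (Real.pi / N) (3 / 4 - ν / 2) n (l / 2))
    (hA : 0 < curvature (3 / 4 - ν / 2) n (l / 2)) :
    mainTerm N ν n l * √(curvature (3 / 4 - ν / 2) n (l / 2) / (2 * Real.pi)) =
      (1 + (-1) ^ n) / 2 ^ n * ((l / 2) ^ n * Real.exp (-(Real.pi / N * Real.exp (l / 2)) +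
        (1 - (3 / 4 - ν / 2)) * (l / 2))) := by
  obtain ⟨hy, hsad⟩ := hsad
  have hN' : (0 : ℝ) < N := by exact_mod_cast hN
  set A := curvature (3 / 4 - ν / 2) n (l / 2) with hAdef
  have hl : 0 < l := by linarith
  have h1 : 4 * (n : ℝ) * (1 + l / 2) - (3 / 4 - ν / 2) * l ^ 2 = l ^ 2 * A := by
    rw [hAdef, curvature]
    field_simp
    ring
  have h2 : √(l ^ 2 * A) = l * √A := by rw [Real.sqrt_mul (sq_nonneg l), Real.sqrt_sq hl.le]
  have h3 : Real.pi / N * Real.exp (l / 2) = 2 * n / l - (3 / 4 - ν / 2) := by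
    rw [hsad]
    generalize Real.exp (l / 2) = e
    field_simp
    ring
  have h4 : (N : ℝ) ^ (1 / 4 + (ν : ℝ) / 2) = Real.exp (Real.log N * (1 / 4 + (ν : ℝ) / 2)) :=
    Real.rpow_def_of_pos hN' _
  have h5 : Real.exp (Real.log N * (1 / 4 + (ν : ℝ) / 2)) *
      Real.exp ((1 / 8 + (ν : ℝ) / 4) * (l - Real.log ((N : ℝ) ^ 2)) - 2 * n / l + 3 / 4 - (ν : ℝ) / 2) =
      Real.exp (-(Real.pi / N * Real.exp (l / 2)) + (1 - (3 / 4 - ν / 2)) * (l / 2)) := by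
    rw [← Real.exp_add, h3, Real.log_pow]
    congr 1
    push_cast
    ring
  have hsA : √A ≠ 0 := by positivity
  have hs2 : √(2 * Real.pi) ≠ 0 := by positivity
  rw [mainTerm, h1, h2, h4, Real.sqrt_div hA.le, ← h5, div_pow, pow_mul, pow_succ l n,
    show (2 : ℝ) ^ 2 = 2 * 2 by norm_num, mul_pow]
  generalize Real.exp (Real.log N * (1 / 4 + (ν : ℝ) / 2)) = e1
  generalize Real.exp ((1 / 8 + (ν : ℝ) / 4) * (l - Real.log ((N : ℝ) ^ 2)) - 2 * n / l + 3 / 4 -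
    (ν : ℝ) / 2) = e2
  field_simp

theorem iteratedDeriv_completedL_half {N : ℕ} [NeZero N] (hN : 1 < N) {χ : DirichletCharacter ℂ N}
    (hχ1 : χ ≠ 1) {X : DirichletCharacter ℤ N} (hX : X.IsPrimitive)
    (hχ : χ = X.ringHomComp (Int.castRingHom ℂ)) (n : ℕ) :
    iteratedDeriv n (completedL χ) (1 / 2) = (((1 + (-1) ^ n) / 2 ^ n *
      ∫ u in Set.Ioi (0 : ℝ), u ^ n * (Real.exp ((1 / 4 + parity χ / 2) * u) *
        realTheta X (parity χ) (Real.exp u)) : ℝ) : ℂ) := by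
  have hpar := apply_neg_one_eq_pow_parity hχ
  rw [iteratedDeriv_completedL hN (parity_le_one χ) hX hpar hχ1 hχ rfl]
  simp only
  rw [mellin_logTheta_center hN (parity_le_one χ) hX hpar]
  generalize (∫ u in Set.Ioi (0 : ℝ), u ^ n * (Real.exp ((1 / 4 + (parity χ : ℝ) / 2) * u) *
    realTheta X (parity χ) (Real.exp u))) = x
  push_cast
  rw [one_div, inv_pow]
  ring

/-- The asymptotic expansion of the derivatives at the centre. -/
theorem exists_expansion_completedL {N : ℕ} [NeZero N] (hN : 1 < N) {χ : DirichletCharacter ℂ N}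
    (hreal : ∀ a : ZMod N, (χ a).im = 0) (hprim : χ.IsPrimitive) {L : ℕ → ℝ}
    (hsad : ∀ n : ℕ, 1 ≤ n → IsSaddle N (parity χ) n (L n)) :
    ∃ b : ℕ → RatFunc ℚ,
      b 1 = (RatFunc.X ^ 4 + 9 * RatFunc.X ^ 3 + 32 * RatFunc.X ^ 2 + 24 * RatFunc.X + 16) /
          (24 * (RatFunc.X + 2) ^ 3) ∧
      ∀ (K : ℕ) (δ : ℝ), 0 < δ →
        (fun n : ℕ ↦ iteratedDeriv n (completedL χ) (1 / 2) -
            ((mainTerm N (parity χ) n (L n) * truncation b K n (L n) : ℝ) : ℂ))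
          =O[atTop] fun n : ℕ ↦ mainTerm N (parity χ) n (L n) * (n : ℝ) ^ (-((K : ℝ) + 1) + δ) := by
  have hN0 : 0 < N := by omega
  have hq : 0 < Real.pi / N := div_pos Real.pi_pos (by exact_mod_cast hN0)
  obtain ⟨X, hX, hχ⟩ := DirichletCharacter.exists_int_of_real hreal hprim
  have hχ1 := hprim.ne_one hN
  have hν := parity_le_one χ
  set ν := parity χ with hνdef
  set c : ℚ := 3 / 4 - ν / 2 with hc
  have hcast : (c : ℝ) = 3 / 4 - (ν : ℝ) / 2 := by
    rw [hc]
    push_cast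
    rfl
  have hc0 : 0 < c := by
    have : (ν : ℚ) ≤ 1 := by exact_mod_cast hν
    rw [hc]
    linarith
  have hsad' : ∀ n : ℕ, 1 ≤ n → IsHalfSaddle (Real.pi / N) c n (L n / 2) := by
    intro n hn
    rw [hcast]
    exact (isSaddle_iff hN0).mp (hsad n hn)
  obtain ⟨C, hC⟩ := exists_realTheta_sub_le hN hν X
  obtain ⟨b, hb1, hb⟩ := SlowlyDiverging.exists_truncation_laplace hq hc0 hsad'
    (continuousOn_realTheta hN hν X) hC
  refine ⟨b, hb1, fun K δ hδ ↦ ?_⟩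
  have hL := slowlyDiverging_of_isHalfSaddle hq (by exact_mod_cast hc0 : (0 : ℝ) < c) hsad'
  -- The normalized integral is controlled for all n, so multiplication by `mainTerm` also covers
  -- odd n, where `mainTerm` and the derivative both vanish.
  have h1 := (isBigO_refl (fun n : ℕ ↦ mainTerm N ν n (L n)) atTop).mul (hb K δ hδ)
  rw [← isBigO_norm_left] at h1 ⊢
  refine h1.congr' ?_ EventuallyEq.rfl
  filter_upwards [eventually_ge_atTop 1, hL.eventually_curvature_pos c] with n hn hA
  have h2 := mainTerm_eq hN0 (hcast ▸ hsad' n hn) (hcast ▸ hA)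
  have h3 := iteratedDeriv_completedL_half hN hχ1 hX hχ n
  rw [← hνdef] at h3
  rw [h3, ← Complex.ofReal_sub, Complex.norm_real, mul_sub, ← mul_assoc (mainTerm N ν n (L n))]
  rw [← hcast] at h2
  rw [h2, show (1 / 4 + (ν : ℝ) / 2) = 1 - c by rw [hcast]; ring]
  have hy : 0 < L n / 2 := (hsad' n hn).1
  congr 2
  field_simp

end

theorem mainTheorem7 {N : ℕ} [NeZero N] (hN : 1 < N) (χ : DirichletCharacter ℂ N)
    (hreal : ∀ a : ZMod N, (χ a).im = 0) (hprim : χ.IsPrimitive) :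
    (∀ n : ℕ, 1 ≤ n → ∃! ℓ : ℝ, DirichletAsymptotics.IsSaddle N (DirichletAsymptotics.parity χ) n ℓ) ∧
    ∀ L : ℕ → ℝ,
      (∀ n : ℕ, 1 ≤ n → DirichletAsymptotics.IsSaddle N (DirichletAsymptotics.parity χ) n (L n)) →
      ((fun n : ℕ => L n - 2 * Real.log ((n : ℝ) * N / Real.log ((n : ℝ) * N)))
        =O[Filter.atTop] (fun _ : ℕ => (1 : ℝ))) ∧
      ∃ b : ℕ → RatFunc ℚ,
        b 1 = (RatFunc.X ^ 4 + 9 * RatFunc.X ^ 3 + 32 * RatFunc.X ^ 2 + 24 * RatFunc.X + 16) /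
          (24 * (RatFunc.X + 2) ^ 3) ∧
        ∀ (K : ℕ) (δ : ℝ), 0 < δ →
          ((fun n : ℕ => iteratedDeriv n (DirichletAsymptotics.completedL χ) (1 / 2) -
              ((DirichletAsymptotics.mainTerm N (DirichletAsymptotics.parity χ) n (L n) *
                DirichletAsymptotics.truncation b K n (L n) : ℝ) : ℂ))
            =O[Filter.atTop] (fun n : ℕ =>
              DirichletAsymptotics.mainTerm N (DirichletAsymptotics.parity χ) n (L n) *
                (n : ℝ) ^ (-((K : ℝ) + 1) + δ))) ∧
          ((fun n : ℕ => iteratedDeriv n (DirichletAsymptotics.Xi χ) 0 -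
              (-Complex.I) ^ n *
              ((DirichletAsymptotics.mainTerm N (DirichletAsymptotics.parity χ) n (L n) *
                DirichletAsymptotics.truncation b K n (L n) : ℝ) : ℂ))
            =O[Filter.atTop] (fun n : ℕ =>
              DirichletAsymptotics.mainTerm N (DirichletAsymptotics.parity χ) n (L n) *
                (n : ℝ) ^ (-((K : ℝ) + 1) + δ))) := by
  have hN0 : 0 < N := by omega
  have hq : 0 < Real.pi / N := div_pos Real.pi_pos (by exact_mod_cast hN0)
  have hc : (0 : ℝ) < 3 / 4 - (DirichletAsymptotics.parity χ : ℝ) / 2 := by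
    have : (DirichletAsymptotics.parity χ : ℝ) ≤ 1 := by exact_mod_cast parity_le_one χ
    linarith
  refine ⟨fun n hn ↦ ?_, fun L hL ↦ ⟨?_, ?_⟩⟩
  · obtain ⟨y, hy, huniq⟩ := existsUnique_isHalfSaddle hq hc
      (show (0 : ℝ) < n by exact_mod_cast hn)
    refine ⟨2 * y, (isSaddle_iff hN0).mpr (by simpa using hy), fun z hz ↦ ?_⟩
    have := huniq _ ((isSaddle_iff hN0).mp hz)
    linarith
  · refine ((isBigO_of_isHalfSaddle hq hc (fun n hn ↦ (isSaddle_iff hN0).mp (hL n hn))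
      (by exact_mod_cast hN0 : (0 : ℝ) < N)).const_mul_left 2).congr_left fun n ↦ ?_
    ring
  · obtain ⟨b, hb1, hb⟩ := exists_expansion_completedL hN hreal hprim hL
    refine ⟨b, hb1, fun K δ hδ ↦ ⟨hb K δ hδ, ?_⟩⟩
    refine (Asymptotics.isBigO_norm_left.mp ?_)
    refine (Asymptotics.isBigO_norm_left.mpr (hb K δ hδ)).congr_left fun n ↦ ?_
    rw [iteratedDeriv_Xi hN (hprim.ne_one hN), ← mul_sub, norm_mul, norm_pow, norm_neg,
      Complex.norm_I, one_pow, one_mul]
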